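/- **Setup.** Let $\hat f_1,\dots,\hat f_n\in\mathbb C[t_1^{\pm1},\dots,t_n^{\pm1}]$, $\hat f_j=\sum_m c_{m,j}t^m$, be $n$ Laurent polynomials with Newton polytopes $P_1,\dots,P_n\subset\mathbb R^n$, such that the Minkowski sum $P=P_1+\dots+P_n$ is full-dimensional. Let $X$ be the complete normal toric variety over $\mathbb C$ of the (inner) normal fan $\Sigma_P$ of $P$, let $u_1,\dots,u_k\in\mathbb Z^n$ be the primitive generators of the rays of $\Sigma_P$, and let $D_1,\dots,D_k$ be the corresponding torus-invariant prime divisors. Let $S=\mathbb C[x_1,\dots,x_k]$ be the Cox ring of $X$, graded by $\mathrm{Cl}(X)=\mathbb Z^k/\{(\langle u_1,m\rangle,\dots,\langle u_k,m\rangle):m\in\mathbb Z^n\}$ via $\deg x_i=[D_i]$. Let $Z=V(K)\subset\mathbb C^k$ be the exceptional set, where $K$ is the ideal generated by the monomials $x^{\hat\sigma}=\prod_{u_i\notin\sigma}x_i$ for the $n$-dimensional cones $\sigma\in\Sigma_P$. Let $\pi:\mathbb C^k\setminus Z\to X$ be Cox's quotient map by the group $G=\mathrm{Hom}_{\mathbb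 Z}(\mathrm{Cl}(X),\mathbb C^*)$. Let $U\subset X$ be the open toric subvariety given by the simplicial cones of $\Sigma_P$. For each $j$ put $a_{j,i}=-\min_{m\in P_j}\langle u_i,m\rangle$, $\alpha_j=[\sum_i a_{j,i}D_i]\in\mathrm{Pic}(X)$, and let $$f_j=\sum_m c_{m,j}\prod_{i=1}^k x_i^{\langle u_i,m\rangle+a_{j,i}}\in S_{\alpha_j}$$ be the homogenization of $\hat f_j$. Let $I=\langle f_1,\dots,f_n\rangle\subset S$, and let $V_X(I)\subset X$ be the image under $\pi$ of the common zeros of $I$ in $\mathbb C^k\setminus Z$. The Hilbert function is $\mathrm{HF}_I(\alpha)=\dim_{\mathbb C}(S/I)_\alpha$ for $\alpha\in\mathrm{Cl}(X)$. The mixed volume $\mathrm{MV}(P_1,\dots,P_n)$ is the coefficient of $\lambda_1\cdots\lambda_n$ in the polynomial $\mathrm{Vol}_n(\lambda_1P_1+\dots+\lambda_nP_n)$, $\lambda_j\ge0$; denote it by $\delta$. Let $\mathrm{Pic}(X)_+$ be the set of classes in $\mathrm{Pic}(X)$ that are nonnegative integer combinations of $\deg x_1,\dots,\deg x_k$. A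 class $\alpha_0\in\mathrm{Pic}(X)$ is *basepoint free* if the elements of $S_{\alpha_0}$ have no common zero in $\mathbb C^k\setminus Z$. **Theorem.** Suppose that $V_X(I)$ is zero-dimensional (that is, a finite set of points) and contained in $U$, and that $\mathrm{codim}(Z)\ge n$ in $\mathbb C^k$. Then for every basepoint free $\alpha_0\in\mathrm{Pic}(X)_+$ the space $(S/I)_{\alpha_0+\alpha_1+\dots+\alpha_n}$ is finite-dimensional and $$\mathrm{HF}_I(\alpha_0+\alpha_1+\dots+\alpha_n)=\delta=\mathrm{MV}(P_1,\dots,P_n).$$ -/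

import Mathlib

open scoped Pointwise

namespace CoxToric

noncomputable section

/-! ## Lattices, polytopes and normal fans

The character lattice `M` and the cocharacter lattice `N` are both `Fin n → ℤ`, paired by the dot
product; `M_ℝ` and `N_ℝ` are both `Fin n → ℝ`. -/

/-- The inclusion of the lattice `ℤⁿ` into `ℝⁿ`. -/
def toReal {n : ℕ} (m : Fin n → ℤ) : Fin n → ℝ := fun i => (m i : ℝ)

/-- Laurent polynomials in `n` variables: the group algebra `ℂ[M]`, `M = ℤⁿ`. -/
abbrev Laurent (n : ℕ) : Type := AddMonoidAlgebra ℂ (Fin n → ℤ)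

/-- The Newton polytope `Conv (m ∈ M : c_m ≠ 0) ⊆ M_ℝ`. -/
def newtonPolytope {n : ℕ} (f : Laurent n) : Set (Fin n → ℝ) :=
  convexHull ℝ (toReal '' (f.coeff.support : Set (Fin n → ℤ)))

/-- The Minkowski sum `P = P₁ + ⋯ + Pₙ` of the Newton polytopes of the input system. -/
def newtonSum {n : ℕ} (f : Fin n → Laurent n) : Set (Fin n → ℝ) :=
  ∑ j, newtonPolytope (f j)

/-- The cone of all `v ∈ N_ℝ` whose linear form attains its minimum over `P` at `m`.
If `m` lies in the relative interior of the face `Q` of `P`, this is the cone `σ_Q` dual to `Q`. -/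
def normalCone {n : ℕ} (P : Set (Fin n → ℝ)) (m : Fin n → ℝ) : Set (Fin n → ℝ) :=
  {v | ∀ m' ∈ P, v ⬝ᵥ m ≤ v ⬝ᵥ m'}

/-- The (inner) normal fan of a polytope `P`, as the set of its cones. As every point of `P` lies
in the relative interior of exactly one face, these are the cones `σ_Q`, `Q` a nonempty face. -/
def normalFan {n : ℕ} (P : Set (Fin n → ℝ)) : Set (Set (Fin n → ℝ)) :=
  normalCone P '' P

/-- The ray `ℝ≥0 · u` spanned by a lattice vector `u`. -/
def raySet {n : ℕ} (u : Fin n → ℤ) : Set (Fin n → ℝ) :=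
  {v | ∃ c : ℝ, 0 ≤ c ∧ v = c • toReal u}

/-- `Σ(1)`: the rays of the fan `Σ`, each given by its primitive generator `u ∈ N`. -/
def Ray {n : ℕ} (Δ : Set (Set (Fin n → ℝ))) : Type :=
  {u : Fin n → ℤ // Finset.univ.gcd u = 1 ∧ raySet u ∈ Δ}

/-- The primitive generator `u_ρ ∈ N` of the ray `ρ`. -/
def Ray.gen {n : ℕ} {Δ : Set (Set (Fin n → ℝ))} (ρ : Ray Δ) : Fin n → ℤ := ρ.1

/-- The dimension of a cone. -/
def coneDim {n : ℕ} (σ : Set (Fin n → ℝ)) : ℕ :=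
  Module.finrank ℝ (Submodule.span ℝ σ)

/-- A cone `σ` of the fan is simplicial if its ray generators are linearly independent over `ℝ`. -/
def IsSimplicialCone {n : ℕ} (Δ : Set (Set (Fin n → ℝ))) (σ : Set (Fin n → ℝ)) : Prop :=
  LinearIndependent ℝ (fun ρ : {ρ : Ray Δ // toReal ρ.gen ∈ σ} => toReal ρ.1.gen)

/-! ### The normal fan of the Newton polytopes has finitely many rays -/

theorem toReal_injective {n : ℕ} : Function.Injective (toReal (n := n)) := by
  intro u v h
  funext i
  have := congrFun h i
  simpa [toReal] using this

/-- A primitive vector is determined by the ray that it spans. -/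
theorem raySet_inj {n : ℕ} {u v : Fin n → ℤ} (hu : Finset.univ.gcd u = 1)
    (hv : Finset.univ.gcd v = 1) (h : raySet u = raySet v) : u = v := by
  have h1 : toReal u ∈ raySet v := by
    rw [← h]; exact ⟨1, zero_le_one, by simp⟩
  obtain ⟨c, hc, huv⟩ := h1
  have hi : ∀ i, (u i : ℝ) = c * v i := fun i => by
    have := congrFun huv i
    simpa [toReal] using this
  obtain ⟨b, hb⟩ := Finset.gcd_eq_sum_mul Finset.univ v
  rw [hv] at hb
  have hd : c = ((∑ j, u j * b j : ℤ) : ℝ) := by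
    have hb' : (1 : ℝ) = ∑ j, (v j : ℝ) * b j := by exact_mod_cast hb
    push_cast
    simp_rw [hi, mul_assoc]
    rw [← Finset.mul_sum, ← hb', mul_one]
  set d : ℤ := ∑ j, u j * b j
  have hud : ∀ i, u i = d * v i := fun i => by
    have := hi i
    rw [hd] at this
    exact_mod_cast this
  have hdvd : d ∣ Finset.univ.gcd u :=
    Finset.dvd_gcd fun i _ => ⟨v i, hud i⟩
  rw [hu] at hdvd
  have hd0 : 0 ≤ d := by rw [hd] at hc; exact_mod_cast hc
  have hd1 : d = 1 := Int.eq_one_of_dvd_one hd0 hdvd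
  funext i
  rw [hud i, hd1, one_mul]

/-- The normal fan of the convex hull of a finite set is finite. -/
theorem normalFan_finite {n : ℕ} (A : Finset (Fin n → ℝ)) :
    (normalFan (convexHull ℝ (A : Set (Fin n → ℝ)))).Finite := by
  classical
  set P := convexHull ℝ (A : Set (Fin n → ℝ)) with hP
  refine Set.Finite.subset (A.powerset.finite_toSet.image
    fun s : Finset (Fin n → ℝ) => {v | ∀ a ∈ s, v ∈ normalCone P a}) ?_
  rintro _ ⟨m, hm, rfl⟩
  obtain ⟨w, hw0, hw1, hwm⟩ := Finset.mem_convexHull'.1 hm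
  refine ⟨A.filter fun a => 0 < w a,
    Finset.mem_coe.2 (Finset.mem_powerset.2 (Finset.filter_subset _ _)), ?_⟩
  have hval : ∀ v : Fin n → ℝ, v ⬝ᵥ m = ∑ a ∈ A, w a * (v ⬝ᵥ a) := by
    intro v
    rw [← hwm, dotProduct_sum]
    simp [dotProduct_smul]
  ext v
  simp only [Set.mem_ofPred_eq, Finset.mem_filter, and_imp]
  constructor
  · intro h m' hm'
    calc v ⬝ᵥ m = ∑ a ∈ A, w a * (v ⬝ᵥ a) := hval v
      _ ≤ ∑ a ∈ A, w a * (v ⬝ᵥ m') := by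
        refine Finset.sum_le_sum fun a ha => ?_
        rcases (hw0 a ha).lt_or_eq with hpos | h0
        · exact mul_le_mul_of_nonneg_left (h a ha hpos m' hm') hpos.le
        · simp [← h0]
      _ = v ⬝ᵥ m' := by rw [← Finset.sum_mul, hw1, one_mul]
  · intro h a ha hpos m' hm'
    refine le_trans ?_ (h m' hm')
    by_contra hlt
    push Not at hlt
    have hsum : ∑ b ∈ A, w b * (v ⬝ᵥ m) < ∑ b ∈ A, w b * (v ⬝ᵥ b) :=
      Finset.sum_lt_sum
        (fun b hb => mul_le_mul_of_nonneg_left (h b (subset_convexHull ℝ _ hb)) (hw0 b hb))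
        ⟨a, ha, mul_lt_mul_of_pos_left hlt hpos⟩
    rw [← Finset.sum_mul, hw1, one_mul, ← hval v] at hsum
    exact lt_irrefl _ hsum

theorem newtonSum_eq {n : ℕ} (f : Fin n → Laurent n) :
    ∃ A : Finset (Fin n → ℝ), newtonSum f = convexHull ℝ (A : Set (Fin n → ℝ)) := by
  classical
  refine ⟨∑ j, (f j).coeff.support.image toReal, ?_⟩
  simp only [newtonSum, newtonPolytope, ← convexHull_sum, Finset.coe_sum, Finset.coe_image]

instance rayFinite {n : ℕ} (f : Fin n → Laurent n) : Finite (Ray (normalFan (newtonSum f))) := by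
  obtain ⟨A, hA⟩ := newtonSum_eq f
  have hfin : (normalFan (newtonSum f)).Finite := hA ▸ normalFan_finite A
  have : Finite (normalFan (newtonSum f)) := hfin
  refine Finite.of_injective
    (fun ρ : Ray (normalFan (newtonSum f)) =>
      (⟨raySet ρ.1, ρ.2.2⟩ : normalFan (newtonSum f))) ?_
  intro ρ ρ' h
  exact Subtype.ext (raySet_inj ρ.2.1 ρ'.2.1 (congrArg Subtype.val h))

instance rayFintype {n : ℕ} (f : Fin n → Laurent n) : Fintype (Ray (normalFan (newtonSum f))) :=
  Fintype.ofFinite _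

/-! ## The class group and the Cox ring of the toric variety of a fan `Δ` -/

/-- The map `Fᵀ : M → ℤᵏ`, `m ↦ (⟨u_ρ, m⟩)_ρ = div (χ^m)`. -/
def charDiv {n : ℕ} (Δ : Set (Set (Fin n → ℝ))) : (Fin n → ℤ) →+ (Ray Δ → ℤ) where
  toFun m ρ := ρ.gen ⬝ᵥ m
  map_zero' := by funext ρ; simp
  map_add' m m' := by funext ρ; simp [dotProduct_add]

/-- The class group `Cl(X)`: torus-invariant Weil divisors `∑ a_ρ D_ρ` modulo the divisors of
characters. -/
abbrev Cl {n : ℕ} (Δ : Set (Set (Fin n → ℝ))) : Type := (Ray Δ → ℤ) ⧸ (charDiv Δ).range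

/-- The class `[∑ a_ρ D_ρ]`. -/
def divClass {n : ℕ} {Δ : Set (Set (Fin n → ℝ))} (a : Ray Δ → ℤ) : Cl Δ :=
  QuotientAddGroup.mk a

/-- The torus-invariant divisor `∑ a_ρ D_ρ` is Cartier (locally principal): on the affine chart of
every cone `σ` of the fan it is the divisor of a character. -/
def IsCartier {n : ℕ} {Δ : Set (Set (Fin n → ℝ))} (a : Ray Δ → ℤ) : Prop :=
  ∀ σ ∈ Δ, ∃ m : Fin n → ℤ, ∀ ρ : Ray Δ, toReal ρ.gen ∈ σ → a ρ = ρ.gen ⬝ᵥ m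

/-- `Pic(X) ⊆ Cl(X)`: the classes of Cartier divisors. -/
def Pic {n : ℕ} (Δ : Set (Set (Fin n → ℝ))) : Set (Cl Δ) :=
  {α | ∃ a : Ray Δ → ℤ, IsCartier a ∧ divClass a = α}

/-- The Cox ring `S`: one variable for each ray. -/
abbrev CoxRing {n : ℕ} (Δ : Set (Set (Fin n → ℝ))) : Type := MvPolynomial (Ray Δ) ℂ

open Classical in
/-- The degree `deg x_ρ = [D_ρ]` of a variable. -/
def degVar {n : ℕ} {Δ : Set (Set (Fin n → ℝ))} (ρ : Ray Δ) : Cl Δ :=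
  divClass (Pi.single ρ 1)

/-- The graded piece `S_α`, spanned by the monomials `x^a` with `[∑ a_ρ D_ρ] = α`. -/
def gradedPiece {n : ℕ} {Δ : Set (Set (Fin n → ℝ))} (α : Cl Δ) : Submodule ℂ (CoxRing Δ) :=
  MvPolynomial.weightedHomogeneousSubmodule ℂ degVar α

/-- `Cl(X)₊`: the nonnegative integer combinations of the degrees of the variables. -/
def ClPlus {n : ℕ} (Δ : Set (Set (Fin n → ℝ))) : Set (Cl Δ) :=
  (AddSubmonoid.closure (Set.range (degVar (Δ := Δ))) : Set (Cl Δ))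

/-- `Pic(X)₊ = Cl(X)₊ ∩ Pic(X)`. -/
def PicPlus {n : ℕ} (Δ : Set (Set (Fin n → ℝ))) : Set (Cl Δ) := ClPlus Δ ∩ Pic Δ

/-- The degree-`α` part `(S/I)_α = S_α / I_α` of `S/I`. -/
abbrev GradedQuotient {n : ℕ} {Δ : Set (Set (Fin n → ℝ))} (I : Ideal (CoxRing Δ)) (α : Cl Δ) :
    Type :=
  gradedPiece α ⧸ (I.restrictScalars ℂ).submoduleOf (gradedPiece α)

/-- The Hilbert function `HF_I(α) = dim_ℂ (S/I)_α`. -/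
def hilbertFunction {n : ℕ} {Δ : Set (Set (Fin n → ℝ))} (I : Ideal (CoxRing Δ)) (α : Cl Δ) : ℕ :=
  Module.finrank ℂ (GradedQuotient I α)

/-! ## The Cox construction of `X` -/

section Quotient

variable {n : ℕ} (Δ : Set (Set (Fin n → ℝ))) [Fintype (Ray Δ)]

open Classical in
/-- The monomial `x^σ̂`, the product of the variables of the rays not in `σ`. -/
def coneMonomial (σ : Set (Fin n → ℝ)) : CoxRing Δ :=
  ∏ ρ : Ray Δ, if toReal ρ.gen ∈ σ then 1 else MvPolynomial.X ρ

/-- The irrelevant ideal `K = ⟨x^σ̂ : σ ∈ Σ(n)⟩`. -/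
def irrelevantIdeal : Ideal (CoxRing Δ) :=
  Ideal.span (coneMonomial Δ '' {σ ∈ Δ | coneDim σ = n})

/-- The exceptional set `Z = V(K) ⊆ ℂᵏ`. -/
def exceptionalSet : Set (Ray Δ → ℂ) :=
  MvPolynomial.zeroLocus ℂ (irrelevantIdeal Δ)

/-- The codimension of the Zariski closed set `Z` in `ℂᵏ`: the height of its vanishing ideal (the
minimum over the components of `Z`, and `⊤` for `Z = ∅`). -/
def codimExceptionalSet : ℕ∞ :=
  (MvPolynomial.vanishingIdeal ℂ (exceptionalSet Δ)).height

/-- `ℂᵏ ∖ Z`. -/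
abbrev CoxSpace : Type := {x : Ray Δ → ℂ // x ∉ exceptionalSet Δ}

/-- The reductive group `G = {g ∈ (ℂ*)ᵏ : g^{F_{j,:}} = 1, j = 1, …, n}`, as a subset of `(ℂ*)ᵏ`. -/
def coxGroup : Set (Ray Δ → ℂˣ) :=
  {g | ∀ j : Fin n, ∏ ρ : Ray Δ, g ρ ^ ρ.gen j = 1}

variable {Δ}

/-- The orbit `G · x ⊆ ℂᵏ ∖ Z`. -/
def orbit (x : CoxSpace Δ) : Set (CoxSpace Δ) :=
  {y | ∃ g ∈ coxGroup Δ, ∀ ρ, y.1 ρ = (g ρ : ℂ) * x.1 ρ}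

variable (Δ)

/-- The points of `X`, as the good categorical quotient of `ℂᵏ ∖ Z` by `G`: two points of `ℂᵏ ∖ Z`
have the same image if and only if the closures of their orbits in `ℂᵏ ∖ Z` meet. Every class
contains exactly one closed orbit. -/
def ToricVariety : Type :=
  Quot fun x y : CoxSpace Δ => (closure (orbit x) ∩ closure (orbit y)).Nonempty

variable {Δ}

/-- The quotient map `π : ℂᵏ ∖ Z → X`. -/
def proj (x : CoxSpace Δ) : ToricVariety Δ := Quot.mk _ x

/-- `V_X(I)`, for a homogeneous ideal `I`. -/
def zeroSet (I : Ideal (CoxRing Δ)) : Set (ToricVariety Δ) :=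
  {p | ∃ x : CoxSpace Δ, proj x = p ∧ ∀ h ∈ I, MvPolynomial.eval x.1 h = 0}

variable (Δ)

/-- The simplicial part `U ⊆ X`: the open toric subvariety of the subfan of simplicial cones, whose
preimage under `π` is the union of the charts `{x : x^σ̂ ≠ 0}`, `σ` a simplicial cone of the fan. -/
def simplicialPart : Set (ToricVariety Δ) :=
  {p | ∀ x : CoxSpace Δ, proj x = p →
    ∃ σ ∈ Δ, IsSimplicialCone Δ σ ∧ MvPolynomial.eval x.1 (coneMonomial Δ σ) ≠ 0}

variable {Δ}

/-- `α` is basepoint free: no point of `ℂᵏ ∖ Z` is a common zero of `S_α`. -/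
def BasepointFree (α : Cl Δ) : Prop :=
  ∀ x : CoxSpace Δ, ∃ h ∈ gradedPiece α, MvPolynomial.eval x.1 h ≠ 0

end Quotient

/-! ## Homogenization of the input system -/

/-- The fan `Σ_P` of the input system, where `P` is the Minkowski sum of its Newton polytopes. -/
abbrev sysFan {n : ℕ} (f : Fin n → Laurent n) : Set (Set (Fin n → ℝ)) := normalFan (newtonSum f)

/-- The coefficients `a_{j,ρ} = - min_{m ∈ P_j} ⟨u_ρ, m⟩` of the divisor `D_{P_j}`. The minimum of a
linear form over the Newton polytope `P_j` is attained at an exponent of `f_j`. -/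
def sysDiv {n : ℕ} (f : Fin n → Laurent n) (j : Fin n) : Ray (sysFan f) → ℤ :=
  fun ρ => - sInf ((fun m => ρ.gen ⬝ᵥ m) '' ((f j).coeff.support : Set (Fin n → ℤ)))

/-- The degree `α_j = [D_{P_j}]`. -/
def sysDeg {n : ℕ} (f : Fin n → Laurent n) (j : Fin n) : Cl (sysFan f) := divClass (sysDiv f j)

/-- The homogenization `∑ c_{m,j} x^{Fᵀ m + a_j}` of the `j`-th polynomial; the exponents
`⟨u_ρ, m⟩ + a_{j,ρ}` are nonnegative for every exponent `m` of `f_j`. -/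
def homogenization {n : ℕ} (f : Fin n → Laurent n) (j : Fin n) : CoxRing (sysFan f) :=
  ∑ m ∈ (f j).coeff.support,
    MvPolynomial.monomial
      (Finsupp.equivFunOnFinite.symm fun ρ : Ray (sysFan f) => (ρ.gen ⬝ᵥ m + sysDiv f j ρ).toNat)
      ((f j).coeff m)

/-- The homogeneous ideal `I = ⟨f₁, …, fₙ⟩ ⊆ S`. -/
def sysIdeal {n : ℕ} (f : Fin n → Laurent n) : Ideal (CoxRing (sysFan f)) :=
  Ideal.span (Set.range (homogenization f))

/-! ## Mixed volume -/

/-- `V` is the mixed volume of `P₁, …, Pₙ ⊆ ℝⁿ`: for `c ≥ 0` the volume of `c₁ P₁ + ⋯ + cₙ Pₙ` is a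
polynomial in `c`, and `V` is its coefficient of `c₁ c₂ ⋯ cₙ`. -/
def IsMixedVolume {n : ℕ} (P : Fin n → Set (Fin n → ℝ)) (V : ℝ) : Prop :=
  ∃ p : MvPolynomial (Fin n) ℝ,
    (∀ c : Fin n → ℝ, (∀ j, 0 ≤ c j) →
      (MeasureTheory.volume (∑ j, c j • P j)).toReal = MvPolynomial.eval c p) ∧
    V = p.coeff (Finsupp.equivFunOnFinite.symm fun _ => 1)

end

end CoxToric

/-!
The proof computes the Hilbert function by a Koszul resolution and identifies the resulting
alternating sum of lattice point counts with the mixed volume.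

*Exactness of the Koszul complex.* The Cox ring is a polynomial ring in `k` variables, and the
Koszul complex of the `n` polynomials `fⱼ` is exact in positive degrees as soon as the ideal `I`
contains a regular sequence of length `n` (`exists_koszulD_eq`). Noether normalization produces such
a sequence if every prime `p ⊇ I` has a residue ring of transcendence degree at most `k - n`
(`exists_isWeaklyRegular_of_trdeg_le`). For a given `p`, let `B` be a transcendence basis made of
variables. If `V(p)` is forced into the exceptional set by the vanishing of its variables, then the
bound is the hypothesis on the codimension of `Z`. Otherwise the general point of `V(p)` maps to one
of the finitely many points of `V_X(I)`. As these lie in the simplicial part, a Laurent monomial of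
a character is constant along the fibres of `π` over them wherever it is defined
(`zeros_and_charValue_eq_of_proj_eq`); so every character that is orthogonal to the rays of the
variables in `p` yields a binomial in `p` (`exists_binomial_mem`). Algebraic independence of `B`
then makes `m ↦ (⟨u_ρ, m⟩)_{ρ ∉ B}` injective on `ℤⁿ`, which gives `n ≤ k - |B|`
(`card_add_le_of_algebraicIndependent`). Taking Euler characteristics in degree
`α = α₀ + α₁ + ⋯ + αₙ`, `dim (S/I)_α = ∑_J (-1)^|J| dim S_{α - ∑_{j ∈ J} αⱼ}`
(`finrank_quotient_eq_sum`).

*Graded pieces and lattice points.* A basepoint free class `α₀` has a lattice polytope `P₀`, the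
convex hull of the characters that generate it at the fixed points of the full-dimensional cones
(`exists_isDivisorPolytope_of_basepointFree`). The polytopes of basepoint free divisors are cut out
by the inequalities of the rays, and this property is stable under Minkowski sums, because it can be
tested on full-dimensional cones of the normal fan, which cover the space and are generated by their
rays (`dotProduct_nonneg_of_forall_ray`, `exists_mem_normalCone_coneDim`). Hence
`dim S_{α₀ + ∑_{j ∈ J} αⱼ}` is the number of lattice points of `P₀ + ∑_{j ∈ J} Pⱼ`
(`IsDivisorPolytope.finrank_gradedPiece`).

*Lattice points and mixed volume.* The number of lattice points of `∑ lᵢ Pᵢ` is a polynomial in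
`l ∈ ℕ^{n+1}`: the relation `∏ₐ ([Pᵢ] - [a]) = 0` between polytopes, the product being over
points `a` that span `Pᵢ` (`sum_powerset_mem_eq_zero`), shows that its iterated differences vanish.
Its component of degree `n` is the volume, and a mixed difference in `n` variables of a polynomial of
degree at most `n` is the coefficient of their product, whatever the value of the remaining variable
(`isMixedVolume_sum_latticeCount`).
-/

namespace CoxToric

/-! ### The Euler characteristic of compact convex sets -/

open Classical in
/-- A linear relation between indicator functions of compact intervals is respected by the
valuation that sends every nonempty interval to `1`. -/
theorem sum_nonempty_eq_zero_real {ι : Type*} (s : Finset ι) (a : ι → ℤ) (K : ι → Set ℝ)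
    (hconv : ∀ i ∈ s, Convex ℝ (K i)) (hcomp : ∀ i ∈ s, IsCompact (K i))
    (h : ∀ x, ∑ i ∈ s, (if x ∈ K i then a i else 0) = 0) :
    ∑ i ∈ s, (if (K i).Nonempty then a i else 0) = 0 := by
  -- The jump of the relation to the right of `x` is the sum over the intervals ending at `x`.
  have key : ∀ x, ∑ i ∈ s, (if (K i).Nonempty ∧ sSup (K i) = x then a i else 0) = 0 := by
    intro x
    have hev : ∀ᶠ y in nhdsWithin x (Set.Ioi x), ∀ i ∈ s,
        (y ∈ K i ↔ x ∈ K i ∧ sSup (K i) ≠ x) := by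
      rw [Filter.eventually_all_finset]
      intro i hi
      by_cases hx : x ∈ K i
      · have hle : x ≤ sSup (K i) := le_csSup (hcomp i hi).bddAbove hx
        rcases hle.lt_or_eq with hlt | heq
        · filter_upwards [Ioo_mem_nhdsGT hlt] with y hy
          have : y ∈ K i := (hconv i hi).ordConnected.out hx
            ((hcomp i hi).sSup_mem ⟨x, hx⟩) ⟨hy.1.le, hy.2.le⟩
          simp [this, hx, hlt.ne']
        · filter_upwards [self_mem_nhdsWithin] with y hy
          have : y ∉ K i := fun hyK =>
            absurd (le_csSup (hcomp i hi).bddAbove hyK) (not_le.2 (heq ▸ hy))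
          simp [this, heq.symm]
      · have := nhdsWithin_le_nhds (s := Set.Ioi x)
          ((hcomp i hi).isClosed.isOpen_compl.mem_nhds hx)
        filter_upwards [this] with y hy
        have hy' : y ∉ K i := hy
        simp [hx, hy']
    obtain ⟨y, hy⟩ := hev.exists
    have h1 := congrArg₂ (· - ·) (h x) (h y)
    simp only [← Finset.sum_sub_distrib, sub_zero] at h1
    refine Eq.trans (Finset.sum_congr rfl fun i hi => ?_) h1
    have hmem : (K i).Nonempty → sSup (K i) ∈ K i := (hcomp i hi).sSup_mem
    by_cases hx : x ∈ K i
    · have hne : (K i).Nonempty := ⟨x, hx⟩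
      by_cases he : sSup (K i) = x <;> simp [hy i hi, hx, he, hne]
    · have : ¬ ((K i).Nonempty ∧ sSup (K i) = x) := fun h' => hx (h'.2 ▸ hmem h'.1)
      simp [hy i hi, hx, this]
  have h2 : ∑ x ∈ s.image fun i => sSup (K i),
      ∑ i ∈ s, (if (K i).Nonempty ∧ sSup (K i) = x then a i else 0) = 0 :=
    Finset.sum_eq_zero fun x _ => key x
  rw [Finset.sum_comm] at h2
  refine Eq.trans (Finset.sum_congr rfl fun i hi => ?_) h2
  by_cases hne : (K i).Nonempty
  · simp [hne, Finset.mem_image]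
    intro h'; exact absurd rfl (h' i hi)
  · simp [hne]

open Classical in
/-- A linear relation between indicator functions of compact convex sets is respected by the
Euler characteristic, which is `1` on every nonempty compact convex set. The induction slices by
the first coordinate: the slices reduce the relation to one between the projections to `ℝ`. -/
theorem sum_nonempty_eq_zero_fin {ι : Type*} (s : Finset ι) (a : ι → ℤ) :
    ∀ {d : ℕ} (K : ι → Set (Fin d → ℝ)), (∀ i ∈ s, Convex ℝ (K i)) →
      (∀ i ∈ s, IsCompact (K i)) → (∀ x, ∑ i ∈ s, (if x ∈ K i then a i else 0) = 0) →
      ∑ i ∈ s, (if (K i).Nonempty then a i else 0) = 0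
  | 0, K, _, _, h => by
    refine Eq.trans (Finset.sum_congr rfl fun i _ => ?_) (h 0)
    have : (K i).Nonempty ↔ (0 : Fin 0 → ℝ) ∈ K i :=
      ⟨fun ⟨x, hx⟩ => Subsingleton.elim x 0 ▸ hx, fun hx => ⟨_, hx⟩⟩
    simp [this]
  | d + 1, K, hconv, hcomp, h => by
    let slice : ℝ → ι → Set (Fin d → ℝ) := fun t i => {y | (Fin.cons t y : Fin (d + 1) → ℝ) ∈ K i}
    have hslice : ∀ t, ∑ i ∈ s, (if t ∈ (fun x : Fin (d + 1) → ℝ => x 0) '' K i then a i else 0)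
        = 0 := by
      intro t
      have := sum_nonempty_eq_zero_fin s a (slice t) ?_ ?_ (fun y => h (Fin.cons t y))
      · refine Eq.trans (Finset.sum_congr rfl fun i _ => ?_) this
        have : t ∈ (fun x : Fin (d + 1) → ℝ => x 0) '' K i ↔ (slice t i).Nonempty := by
          constructor
          · rintro ⟨x, hx, rfl⟩
            refine ⟨Fin.tail x, ?_⟩
            simpa [slice, Fin.cons_self_tail] using hx
          · rintro ⟨y, hy⟩
            exact ⟨_, hy, by simp⟩
        simp [this]
      · intro i hi y hy z hz b c hb hc hbc
        have := hconv i hi hy hz hb hc hbc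
        have e : b • (Fin.cons t y : Fin (d + 1) → ℝ) + c • (Fin.cons t z : Fin (d + 1) → ℝ)
            = Fin.cons t (b • y + c • z) := by
          funext j
          refine Fin.cases ?_ (fun j => ?_) j
          · simp [← add_mul, hbc]
          · simp
        rwa [e] at this
      · intro i hi
        have hclosed : IsClosed (slice t i) :=
          (hcomp i hi).isClosed.preimage (by fun_prop)
        have hsub : slice t i ⊆ Fin.tail '' K i := fun y hy => ⟨_, hy, by simp⟩
        exact IsCompact.of_isClosed_subset ((hcomp i hi).image (by unfold Fin.tail; fun_prop))
          hclosed hsub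
    have := sum_nonempty_eq_zero_real s a _ ?_ ?_ hslice
    · simpa using this
    · intro i hi
      exact (hconv i hi).is_linear_image ⟨fun _ _ => rfl, fun _ _ => rfl⟩
    · intro i hi
      exact (hcomp i hi).image (by fun_prop)

open Classical in
theorem sum_nonempty_eq_zero {ι κ : Type*} [Fintype κ] (s : Finset ι) (a : ι → ℤ)
    (K : ι → Set (κ → ℝ)) (hconv : ∀ i ∈ s, Convex ℝ (K i)) (hcomp : ∀ i ∈ s, IsCompact (K i))
    (h : ∀ x, ∑ i ∈ s, (if x ∈ K i then a i else 0) = 0) :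
    ∑ i ∈ s, (if (K i).Nonempty then a i else 0) = 0 := by
  let e : (κ → ℝ) ≃L[ℝ] (Fin (Fintype.card κ) → ℝ) :=
    ContinuousLinearEquiv.piCongrLeft ℝ (fun _ => ℝ) (Fintype.equivFin κ)
  have := sum_nonempty_eq_zero_fin s a (fun i => e '' K i)
    (fun i hi => (hconv i hi).linear_image e.toLinearMap)
    (fun i hi => (hcomp i hi).image e.continuous) (fun x => ?_)
  · simpa using this
  · refine Eq.trans (Finset.sum_congr rfl fun i _ => ?_) (h (e.symm x))
    have : x ∈ e '' K i ↔ e.symm x ∈ K i := by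
      constructor
      · rintro ⟨y, hy, rfl⟩; simpa using hy
      · intro hx; exact ⟨_, hx, by simp⟩
    simp [this]

theorem mem_smul_convexHull_iff {n : ℕ} {A : Finset (Fin n → ℝ)} (hA : A.Nonempty) {c : ℝ}
    (hc : 0 ≤ c) {y : Fin n → ℝ} : y ∈ c • convexHull ℝ (A : Set (Fin n → ℝ)) ↔
      ∃ t : A → ℝ, (∀ a, 0 ≤ t a) ∧ ∑ a, t a = c ∧ ∑ a, t a • (a : Fin n → ℝ) = y := by
  classical
  constructor
  · rintro ⟨z, hz, rfl⟩
    obtain ⟨w, hw0, hw1, hwz⟩ := Finset.mem_convexHull'.1 hz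
    refine ⟨fun a => c * w a, fun a => mul_nonneg hc (hw0 _ a.2), ?_, ?_⟩
    · rw [← Finset.mul_sum, Finset.sum_coe_sort A w, hw1, mul_one]
    · simp only [mul_smul, ← Finset.smul_sum]
      rw [Finset.sum_coe_sort A fun a => w a • a, hwz]
  · rintro ⟨t, ht0, htc, rfl⟩
    rcases hc.eq_or_lt with rfl | hpos
    · have : ∀ a, t a = 0 := fun a =>
        (Finset.sum_eq_zero_iff_of_nonneg fun a _ => ht0 a).1 htc a (Finset.mem_univ _)
      rw [Set.zero_smul_set (by simpa using hA)]
      simp [this]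
    · refine ⟨∑ a, (t a / c) • (a : Fin n → ℝ), ?_, ?_⟩
      · refine (convex_convexHull ℝ _).sum_mem (fun a _ => div_nonneg (ht0 a) hc) ?_
          fun a _ => subset_convexHull ℝ _ a.2
        rw [← Finset.sum_div, htc, div_self hpos.ne']
      · simp only [Finset.smul_sum, smul_smul]
        refine Finset.sum_congr rfl fun a _ => ?_
        rw [mul_div_cancel₀ _ hpos.ne']

open Classical in
/-- The relation `∏ₐ ([P] - [a]) * [Q] = 0` in the convolution algebra of polytopes, where `P` is
the convex hull of the points `a`. The representations of `x` as a point of `Q + |A| P` form a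
compact convex set `F`, covered by the sets `F_a` where `a` has weight at least `1`, and `x` lies in
`Q + (|A| - |S|) P + ∑ S` if and only if `⋂_{a ∈ S} F_a` is nonempty. -/
theorem sum_powerset_mem_eq_zero {n : ℕ} (A : Finset (Fin n → ℝ)) (hA : A.Nonempty)
    (Q : Set (Fin n → ℝ)) (hQ : Convex ℝ Q) (hQc : IsClosed Q) (x : Fin n → ℝ) :
    ∑ S ∈ (Finset.univ : Finset A).powerset,
      (if x - ∑ a ∈ S, (a : Fin n → ℝ) ∈
        Q + ((A.card - S.card : ℕ) : ℝ) • convexHull ℝ (A : Set (Fin n → ℝ))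
        then (-1 : ℤ) ^ S.card else 0) = 0 := by
  let F : Finset A → Set (A → ℝ) := fun S => {t | (∀ a, 0 ≤ t a) ∧ ∑ a, t a = A.card ∧
    x - ∑ a, t a • (a : Fin n → ℝ) ∈ Q ∧ ∀ a ∈ S, 1 ≤ t a}
  have hF := sum_nonempty_eq_zero (Finset.univ : Finset A).powerset
    (fun S => (-1 : ℤ) ^ S.card) F ?_ ?_ ?_
  · refine Eq.trans (Finset.sum_congr rfl fun S _ => ?_) hF
    have hcard : S.card ≤ A.card := by simpa using S.card_le_univ
    refine if_congr ?_ rfl rfl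
    rw [Set.mem_add]
    constructor
    · rintro ⟨q, hq, y, hy, hqy⟩
      obtain ⟨t, ht0, htc, rfl⟩ := (mem_smul_convexHull_iff hA (Nat.cast_nonneg _)).1 hy
      refine ⟨fun a => t a + if a ∈ S then 1 else 0, fun a => ?_, ?_, ?_, fun a ha => ?_⟩
      · exact add_nonneg (ht0 a) (by split_ifs <;> simp)
      · rw [Finset.sum_add_distrib, htc, Finset.sum_ite_mem, Finset.univ_inter,
          Nat.cast_sub hcard]
        simp
      · have : x - ∑ a, (t a + if a ∈ S then 1 else 0) • (a : Fin n → ℝ) = q := by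
          rw [← sub_eq_iff_eq_add.2 hqy.symm]
          simp only [add_smul, Finset.sum_add_distrib, ite_smul, one_smul, zero_smul,
            Finset.sum_ite_mem, Finset.univ_inter]
          abel
        rw [this]; exact hq
      · simpa [ha] using ht0 a
    · rintro ⟨t, ht0, htc, htQ, htS⟩
      refine ⟨_, htQ, _, (mem_smul_convexHull_iff hA (Nat.cast_nonneg _)).2
        ⟨fun a => t a - if a ∈ S then 1 else 0, fun a => ?_, ?_, rfl⟩, ?_⟩
      · by_cases ha : a ∈ S
        · simpa [ha] using htS a ha
        · simpa [ha] using ht0 a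
      · rw [Finset.sum_sub_distrib, htc, Finset.sum_ite_mem, Finset.univ_inter,
          Nat.cast_sub hcard]
        simp
      · simp only [sub_smul, Finset.sum_sub_distrib, ite_smul, one_smul, zero_smul,
            Finset.sum_ite_mem, Finset.univ_inter]
        abel
  · rintro S -
    have e : F S = {t : A → ℝ | ∀ a, 0 ≤ t a} ∩ ({t | ∑ a, t a = (A.card : ℝ)} ∩
      ((fun t : A → ℝ => x - ∑ a, t a • (a : Fin n → ℝ)) ⁻¹' Q ∩ {t | ∀ a ∈ S, 1 ≤ t a})) := rfl
    intro t ht u hu b c hb hc hbc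
    refine ⟨fun a => ?_, ?_, ?_, fun a ha => ?_⟩
    · exact add_nonneg (mul_nonneg hb (ht.1 a)) (mul_nonneg hc (hu.1 a))
    · simp only [Pi.add_apply, Pi.smul_apply, smul_eq_mul, Finset.sum_add_distrib,
        ← Finset.mul_sum, ht.2.1, hu.2.1, ← add_mul, hbc, one_mul]
    · have := hQ ht.2.2.1 hu.2.2.1 hb hc hbc
      convert this using 1
      simp only [Pi.add_apply, Pi.smul_apply, smul_eq_mul, add_smul, mul_smul,
        Finset.sum_add_distrib, ← Finset.smul_sum, smul_sub]
      have hx : x = b • x + c • x := by rw [← add_smul, hbc, one_smul]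
      nth_rewrite 1 [hx]
      abel
    · have h1 := mul_le_mul_of_nonneg_left (ht.2.2.2 a ha) hb
      have h2 := mul_le_mul_of_nonneg_left (hu.2.2.2 a ha) hc
      simp only [Pi.add_apply, Pi.smul_apply, smul_eq_mul]
      linarith
  · rintro S -
    refine IsCompact.of_isClosed_subset (isCompact_univ_pi fun _ : A =>
      isCompact_Icc (a := (0 : ℝ)) (b := A.card)) ?_ ?_
    · refine IsClosed.inter (s₁ := {t : A → ℝ | ∀ a, 0 ≤ t a}) ?_ (IsClosed.inter
        (s₁ := {t : A → ℝ | ∑ a, t a = (A.card : ℝ)}) ?_ (IsClosed.inter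
        (s₁ := {t : A → ℝ | x - ∑ a, t a • (a : Fin n → ℝ) ∈ Q})
        (s₂ := {t : A → ℝ | ∀ a ∈ S, 1 ≤ t a}) ?_ ?_))
      · simp only [Set.ofPred_forall]
        exact isClosed_iInter fun a => isClosed_le continuous_const (by fun_prop)
      · exact isClosed_eq (by fun_prop) continuous_const
      · exact hQc.preimage (by fun_prop)
      · simp only [Set.ofPred_forall]
        exact isClosed_iInter fun a => isClosed_iInter fun _ =>
          isClosed_le continuous_const (by fun_prop)
    · intro t ht a _
      refine ⟨ht.1 a, ?_⟩
      rw [← ht.2.1]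
      exact Finset.single_le_sum (fun a _ => ht.1 a) (Finset.mem_univ a)
  · intro t
    -- For `t ∈ F` the sum is over the subsets of `{a | 1 ≤ t a}`, which is nonempty because the
    -- weights sum up to `|A|`.
    by_cases ht : (∀ a, 0 ≤ t a) ∧ ∑ a, t a = A.card ∧ x - ∑ a, t a • (a : Fin n → ℝ) ∈ Q
    · have hne : (Finset.univ.filter fun a : A => 1 ≤ t a).Nonempty := by
        by_contra hne
        rw [Finset.not_nonempty_iff_eq_empty, Finset.filter_eq_empty_iff] at hne
        have : ∑ a, t a < ∑ _a : A, (1 : ℝ) := by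
          have := hA.to_subtype
          exact Finset.sum_lt_sum_of_nonempty Finset.univ_nonempty
            fun a ha => not_le.1 (hne ha)
        rw [ht.2.1] at this
        simp at this
      refine Eq.trans ?_ (Finset.sum_powerset_neg_one_pow_card_of_nonempty hne)
      refine (@Finset.sum_filter _ _ _ _ (fun S => t ∈ F S) (fun _ => Classical.propDecidable _)
        _).symm.trans (Finset.sum_congr ?_ fun _ _ => rfl)
      ext S
      simp only [F, Finset.mem_filter, Finset.mem_powerset, Finset.subset_univ, true_and]
      constructor
      · intro h a ha
        simpa using h.2.2.2 a ha
      · intro h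
        exact ⟨ht.1, ht.2.1, ht.2.2, fun a ha => by simpa using h ha⟩
    · refine Finset.sum_eq_zero fun S _ => if_neg fun h => ht ⟨h.1, h.2.1, h.2.2.1⟩

/-! ### Lattice points and volumes of Minkowski combinations -/

/-- The number of lattice points in `K` (only meaningful for bounded `K`). -/
noncomputable def latticeCount {n : ℕ} (K : Set (Fin n → ℝ)) : ℕ :=
  Nat.card {m : Fin n → ℤ // toReal m ∈ K}

/-- The lattice polytope `Conv A`. -/
def latticePolytope {n : ℕ} (A : Finset (Fin n → ℤ)) : Set (Fin n → ℝ) :=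
  convexHull ℝ (toReal '' (A : Set (Fin n → ℤ)))

/-- The Minkowski combination `∑ cᵢ Pᵢ` of the lattice polytopes `Pᵢ = Conv Aᵢ`. -/
def minkowskiComb {n : ℕ} {ι : Type*} [Fintype ι] (A : ι → Finset (Fin n → ℤ)) (c : ι → ℝ) :
    Set (Fin n → ℝ) :=
  ∑ i, c i • latticePolytope (A i)

section

variable {n : ℕ}

theorem toReal_add (u v : Fin n → ℤ) : toReal (u + v) = toReal u + toReal v := by
  funext i; simp [toReal]

theorem toReal_sum {κ : Type*} (s : Finset κ) (u : κ → Fin n → ℤ) :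
    toReal (∑ k ∈ s, u k) = ∑ k ∈ s, toReal (u k) := by
  funext i; simp [toReal]

theorem toReal_sub (u v : Fin n → ℤ) : toReal (u - v) = toReal u - toReal v := by
  funext i; simp [toReal]

theorem finite_toReal_mem {K : Set (Fin n → ℝ)} (hK : Bornology.IsBounded K) :
    Finite {m : Fin n → ℤ // toReal m ∈ K} := by
  obtain ⟨R, hR⟩ := hK.subset_closedBall 0
  have : ({m : Fin n → ℤ | toReal m ∈ K}).Finite := by
    refine (Set.finite_Icc (fun _ => -⌈R⌉) (fun _ : Fin n => ⌈R⌉)).subset fun m hm => ?_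
    have h1 := mem_closedBall_zero_iff.1 (hR hm)
    have h2 : ∀ i, |(m i : ℝ)| ≤ R := fun i => (norm_le_pi_norm (toReal m) i).trans h1
    refine ⟨fun i => ?_, fun i => ?_⟩
    · have := (neg_le_neg (Int.le_ceil R)).trans (abs_le.1 (h2 i)).1
      exact_mod_cast this
    · have := (abs_le.1 (h2 i)).2.trans (Int.le_ceil R)
      exact_mod_cast this
  exact this

theorem isCompact_latticePolytope (A : Finset (Fin n → ℤ)) : IsCompact (latticePolytope A) :=
  (A.finite_toSet.image _).isCompact_convexHull ℝ

theorem convex_latticePolytope (A : Finset (Fin n → ℤ)) : Convex ℝ (latticePolytope A) :=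
  convex_convexHull ℝ _

theorem latticePolytope_nonempty {A : Finset (Fin n → ℤ)} (hA : A.Nonempty) :
    (latticePolytope A).Nonempty :=
  hA.elim fun a ha => ⟨toReal a, subset_convexHull ℝ _ ⟨a, ha, rfl⟩⟩

variable {ι : Type*} [Fintype ι] (A : ι → Finset (Fin n → ℤ))

theorem isCompact_minkowskiComb (c : ι → ℝ) : IsCompact (minkowskiComb A c) :=
  Finset.sum_induction _ IsCompact (fun _ _ => IsCompact.add) isCompact_singleton
    fun i _ => (isCompact_latticePolytope (A i)).smul (c i)

theorem convex_minkowskiComb (c : ι → ℝ) : Convex ℝ (minkowskiComb A c) :=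
  Finset.sum_induction _ (Convex ℝ) (fun _ _ => Convex.add) (convex_singleton 0)
    fun i _ => (convex_latticePolytope (A i)).smul (c i)

theorem minkowskiComb_add {c d : ι → ℝ} (hc : ∀ i, 0 ≤ c i) (hd : ∀ i, 0 ≤ d i) :
    minkowskiComb A (c + d) = minkowskiComb A c + minkowskiComb A d := by
  simp only [minkowskiComb, ← Finset.sum_add_distrib, Pi.add_apply]
  exact Finset.sum_congr rfl fun i _ => (convex_latticePolytope (A i)).add_smul (hc i) (hd i)

theorem minkowskiComb_smul (r : ℝ) (c : ι → ℝ) :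
    minkowskiComb A (r • c) = r • minkowskiComb A c := by
  simp only [minkowskiComb, Finset.smul_sum, Pi.smul_apply, smul_assoc]

theorem minkowskiComb_single [DecidableEq ι] (hA : ∀ i, (A i).Nonempty) (j : ι) (r : ℝ) :
    minkowskiComb A (Pi.single j r) = r • latticePolytope (A j) := by
  rw [minkowskiComb, Finset.sum_eq_single j]
  · simp
  · intro i _ hij
    rw [Pi.single_eq_of_ne hij, Set.zero_smul_set (latticePolytope_nonempty (hA i))]
  · simp

end

section

variable {n : ℕ} {ι : Type*} [Fintype ι]

/-- Along `Pⱼ = Conv Aⱼ` the lattice point count satisfies a linear recurrence with characteristic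
polynomial `(T - 1) ^ |Aⱼ|`. -/
theorem fwdDiff_iter_latticeCount [DecidableEq ι] {A : ι → Finset (Fin n → ℤ)}
    (hA : ∀ i, (A i).Nonempty) (j : ι) (l : ι → ℕ) :
    (fwdDiff (Pi.single j 1))^[(A j).card]
      (fun l : ι → ℕ => (latticeCount (minkowskiComb A fun i => (l i : ℝ)) : ℝ)) l = 0 := by
  classical
  set s := (A j).card with hs
  set Q := minkowskiComb A fun i => (l i : ℝ) with hQ
  have hQk : ∀ k : ℕ, minkowskiComb A (fun i => ((l + k • Pi.single j 1 : ι → ℕ) i : ℝ)) =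
      Q + (k : ℝ) • latticePolytope (A j) := by
    intro k
    rw [← minkowskiComb_single A hA, hQ, ← minkowskiComb_add]
    · congr 1
      funext i
      by_cases h : i = j
      · subst h; simp
      · simp [h]
    · exact fun i => Nat.cast_nonneg _
    · intro i
      by_cases h : i = j
      · subst h; simp
      · simp [h]
  -- the recurrence, as a sum over the subsets of `A j`
  let B : Finset (Fin n → ℝ) := (A j).map ⟨toReal, toReal_injective⟩
  have hBcard : B.card = s := by simp [B, hs]
  have hBhull : convexHull ℝ (B : Set (Fin n → ℝ)) = latticePolytope (A j) := by
    simp [B, latticePolytope]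
  have hBint : ∀ b : B, ∃ m : Fin n → ℤ, toReal m = b := fun b => by
    obtain ⟨m, _, hm⟩ := Finset.mem_map.1 b.2
    exact ⟨m, hm⟩
  choose μ hμ using hBint
  let K : ℕ → Set (Fin n → ℝ) := fun k => Q + (k : ℝ) • latticePolytope (A j)
  have hKc : ∀ k, IsCompact (K k) := fun k =>
    (isCompact_minkowskiComb A _).add ((isCompact_latticePolytope _).smul _)
  have hfin : ∀ S : Finset B, ({m : Fin n → ℤ | toReal (m - ∑ b ∈ S, μ b) ∈
      K (s - S.card)}).Finite := by
    intro S
    have := finite_toReal_mem (hKc (s - S.card)).isBounded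
    exact Set.Finite.preimage (f := fun m : Fin n → ℤ => m - ∑ b ∈ S, μ b)
      (sub_left_injective.injOn) (s := {m | toReal m ∈ K (s - S.card)}) this
  -- a finite set that contains all lattice points to be counted
  let W : Finset (Fin n → ℤ) := (Finset.univ : Finset B).powerset.biUnion fun S => (hfin S).toFinset
  have hcount : ∀ S : Finset B, (latticeCount (K (s - S.card)) : ℤ) =
      ∑ m ∈ W, if toReal (m - ∑ b ∈ S, μ b) ∈ K (s - S.card) then 1 else 0 := by
    intro S
    rw [Finset.sum_boole, latticeCount]
    congr 1
    rw [← Nat.card_congr (Equiv.subtypeEquiv (Equiv.subRight (∑ b ∈ S, μ b))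
      (p := fun m => toReal (m - ∑ b ∈ S, μ b) ∈ K (s - S.card)) fun m => Iff.rfl)]
    refine Nat.subtype_card _ fun m => ?_
    simp only [Finset.mem_filter, and_iff_right_iff_imp]
    exact fun hm => Finset.mem_biUnion.2
      ⟨S, Finset.mem_powerset.2 (Finset.subset_univ S), (hfin S).mem_toFinset.2 hm⟩
  have hrec : ∑ S ∈ (Finset.univ : Finset B).powerset,
      (-1 : ℤ) ^ S.card * latticeCount (K (s - S.card)) = 0 := by
    simp only [hcount, Finset.mul_sum, mul_ite, mul_one, mul_zero]
    rw [Finset.sum_comm]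
    refine Finset.sum_eq_zero fun m _ => ?_
    have hBne : B.Nonempty := by simpa [B] using hA j
    have := sum_powerset_mem_eq_zero B hBne Q (convex_minkowskiComb A _)
      (isCompact_minkowskiComb A _).isClosed (toReal m)
    rw [hBhull, hBcard] at this
    simpa only [K, toReal_sub, toReal_sum, hμ] using this
  rw [Finset.sum_powerset_apply_card (fun k => (-1 : ℤ) ^ k * latticeCount (K (s - k)))] at hrec
  rw [fwdDiff_iter_eq_sum_shift, ← Finset.sum_range_reflect]
  simp only [Finset.card_univ, Fintype.card_coe, hBcard] at hrec
  replace hrec := congrArg (Int.cast : ℤ → ℝ) hrec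
  push_cast at hrec
  refine Eq.trans (Finset.sum_congr rfl fun k hk => ?_) hrec
  have hk' : k ≤ s := Nat.lt_succ_iff.1 (Finset.mem_range.1 hk)
  have e1 : s + 1 - 1 - k = s - k := by omega
  rw [e1, Nat.sub_sub_self hk', Nat.choose_symm hk', hQk]
  simp only [K, zsmul_eq_mul, nsmul_eq_mul]
  push_cast
  ring

end

/-! ### Polynomiality from difference equations -/

theorem fwdDiff_comm_apply {M G : Type*} [AddCommMonoid M] [AddCommGroup G] (h k : M) :
    Function.Commute (fwdDiff h : (M → G) → M → G) (fwdDiff k) := by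
  intro f
  funext x
  simp only [fwdDiff, add_right_comm x k h]
  abel

theorem fwdDiff_iter_zero {M G : Type*} [AddCommMonoid M] [AddCommGroup G] (h : M) (b : ℕ) :
    (fwdDiff h)^[b] (0 : M → G) = 0 := by
  induction b with
  | zero => rfl
  | succ b ih =>
    rw [Function.iterate_succ_apply', ih]
    funext x
    simp [fwdDiff]

section

variable {ι : Type*}

/-- The polynomial `binom (Xᵢ) b`. -/
noncomputable def choosePoly (i : ι) (b : ℕ) : MvPolynomial ι ℝ :=
  MvPolynomial.C ((b.factorial : ℝ)⁻¹) * Polynomial.aeval (MvPolynomial.X i) (descPochhammer ℝ b)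

theorem eval_choosePoly (i : ι) (b : ℕ) (l : ι → ℕ) :
    MvPolynomial.eval (fun i => (l i : ℝ)) (choosePoly i b) = (l i).choose b := by
  have h1 : MvPolynomial.eval (fun i => (l i : ℝ))
      (Polynomial.aeval (MvPolynomial.X i) (descPochhammer ℝ b)) =
      (descPochhammer ℝ b).eval (l i : ℝ) := by
    rw [← MvPolynomial.coe_aeval_eq_eval, RingHom.coe_coe, ← Polynomial.aeval_algHom_apply]
    simp [Polynomial.aeval_def]
  rw [choosePoly, map_mul, MvPolynomial.eval_C, h1, descPochhammer_eval_eq_descFactorial,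
    Nat.descFactorial_eq_factorial_mul_choose, Nat.cast_mul, ← mul_assoc,
    inv_mul_cancel₀ (by exact_mod_cast b.factorial_ne_zero), one_mul]

/-- A function on `ℕ^ι` that is annihilated by a power of each partial difference operator is a
polynomial. -/
theorem exists_polynomial_of_fwdDiff_iter [Fintype ι] [DecidableEq ι] (s : ι → ℕ) (g : (ι → ℕ) → ℝ)
    (hg : ∀ i l, (fwdDiff (Pi.single i 1))^[s i] g l = 0) :
    ∃ p : MvPolynomial ι ℝ, ∀ l : ι → ℕ, g l = MvPolynomial.eval (fun i => (l i : ℝ)) p := by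
  -- polynomial dependence on the coordinates in `T`, one coordinate at a time
  suffices H : ∀ (T : Finset ι) (g : (ι → ℕ) → ℝ),
      (∀ i ∈ T, ∀ l, (fwdDiff (Pi.single i 1))^[s i] g l = 0) →
      ∃ q : (ι → ℕ) → MvPolynomial ι ℝ, ∀ l : ι → ℕ,
        g l = MvPolynomial.eval (fun i => (l i : ℝ)) (q fun i => if i ∈ T then 0 else l i) by
    obtain ⟨q, hq⟩ := H Finset.univ g fun i _ => hg i
    exact ⟨q 0, fun l => by simpa [Pi.zero_def] using hq l⟩
  intro T
  induction T using Finset.induction_on with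
  | empty => exact fun g _ => ⟨fun l => MvPolynomial.C (g l), fun l => by simp⟩
  | insert i T hi ih =>
    intro g hg
    have hstep : ∀ b, ∃ q : (ι → ℕ) → MvPolynomial ι ℝ, ∀ l : ι → ℕ,
        (fwdDiff (Pi.single i 1))^[b] g l = MvPolynomial.eval (fun i => (l i : ℝ))
          (q fun i => if i ∈ T then 0 else l i) := by
      intro b
      refine ih _ fun j hj l => ?_
      have hc := ((fwdDiff_comm_apply (G := ℝ) (Pi.single j 1 : ι → ℕ) (Pi.single i 1)).iterate_left
        (s j)).iterate_right b
      rw [hc.eq g, show (fwdDiff (Pi.single j 1))^[s j] g = 0 from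
        funext (hg j (Finset.mem_insert_of_mem hj)), fwdDiff_iter_zero]
      rfl
    choose q hq using hstep
    refine ⟨fun l => ∑ b ∈ Finset.range (s i), choosePoly i b *
      MvPolynomial.bind₁ (Function.update MvPolynomial.X i 0) (q b l), fun l => ?_⟩
    have hzero : ∀ b, s i ≤ b → ∀ l, (fwdDiff (Pi.single i 1))^[b] g l = 0 := by
      intro b hb l
      obtain ⟨c, rfl⟩ := Nat.exists_eq_add_of_le hb
      rw [add_comm, Function.iterate_add_apply, show (fwdDiff (Pi.single i 1))^[s i] g = 0 from
        funext (hg i (Finset.mem_insert_self _ _)), fwdDiff_iter_zero]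
      rfl
    have hl : l = Function.update l i 0 + l i • Pi.single i 1 := by
      funext j
      by_cases h : j = i
      · subst h; simp
      · simp [h]
    -- Newton's formula in the `i`-th coordinate, in which the differences of high order vanish
    have hexp := shift_eq_sum_fwdDiff_iter (Pi.single i 1) g (l i) (Function.update l i 0)
    rw [← hl] at hexp
    have hrange : ∑ b ∈ Finset.range (l i + 1), (l i).choose b •
        (fwdDiff (Pi.single i 1))^[b] g (Function.update l i 0) =
        ∑ b ∈ Finset.range (s i), (l i).choose b •
        (fwdDiff (Pi.single i 1))^[b] g (Function.update l i 0) := by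
      have h1 : ∀ N, (∀ b, N ≤ b → (l i).choose b •
          (fwdDiff (Pi.single i 1))^[b] g (Function.update l i 0) = 0) →
          ∑ b ∈ Finset.range N, (l i).choose b •
            (fwdDiff (Pi.single i 1))^[b] g (Function.update l i 0) =
          ∑ b ∈ Finset.range (max (l i + 1) (s i)), (l i).choose b •
            (fwdDiff (Pi.single i 1))^[b] g (Function.update l i 0) ∨ max (l i + 1) (s i) < N := by
        intro N hN
        by_cases hlt : max (l i + 1) (s i) < N
        · exact Or.inr hlt
        · left
          refine Finset.sum_subset (Finset.range_mono (not_lt.1 hlt)) fun b _ hb => hN b ?_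
          simpa using hb
      rcases h1 (l i + 1) (fun b hb => by rw [Nat.choose_eq_zero_of_lt hb, zero_smul]) with h | h
      · rcases h1 (s i) (fun b hb => by rw [hzero b hb, smul_zero]) with h' | h'
        · rw [h, h']
        · omega
      · omega
    rw [hexp, hrange, map_sum]
    refine Finset.sum_congr rfl fun b _ => ?_
    rw [map_mul, eval_choosePoly, hq, nsmul_eq_mul]
    congr 1
    have hμ : (fun j => if j ∈ T then 0 else Function.update l i 0 j) =
        fun j => if j ∈ insert i T then 0 else l j := by
      funext j
      by_cases h : j = i
      · subst h; simp
      · simp [h]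
    rw [hμ, ← MvPolynomial.coe_aeval_eq_eval, ← MvPolynomial.coe_aeval_eq_eval, RingHom.coe_coe,
      RingHom.coe_coe, MvPolynomial.aeval_bind₁]
    congr 2
    funext j
    by_cases h : j = i
    · subst h; simp
    · simp [h]

theorem _root_.Polynomial.coeff_eq_of_tendsto_div_pow (P : Polynomial ℝ) {d : ℕ} {v : ℝ}
    (h : Filter.Tendsto (fun N : ℕ => P.eval (N : ℝ) / (N : ℝ) ^ d) Filter.atTop (nhds v)) :
    P.natDegree ≤ d ∧ P.coeff d = v := by
  have hlead : ∀ e : ℕ, P.degree = e → Filter.Tendsto (fun N : ℕ => P.eval (N : ℝ) / (N : ℝ) ^ e)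
      Filter.atTop (nhds P.leadingCoeff) := by
    intro e he
    have := (Polynomial.div_tendsto_atTop_leadingCoeff_div_of_degree_eq P (Polynomial.X ^ e)
      (by simpa using he)).comp tendsto_natCast_atTop_atTop
    simpa [Function.comp_def] using this
  have hdeg : P.natDegree ≤ d := by
    by_contra hlt
    push Not at hlt
    have hP : P ≠ 0 := by rintro rfl; simp at hlt
    have h1 := hlead _ (Polynomial.degree_eq_natDegree hP)
    have h2 : Filter.Tendsto (fun N : ℕ => P.eval (N : ℝ) / (N : ℝ) ^ P.natDegree)
        Filter.atTop (nhds (v * 0)) := by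
      have h3 : Filter.Tendsto (fun N : ℕ => (((N : ℝ)) ^ (P.natDegree - d))⁻¹) Filter.atTop
          (nhds 0) :=
        (Filter.tendsto_pow_atTop (by omega)).comp tendsto_natCast_atTop_atTop |>.inv_tendsto_atTop
      refine (h.mul h3).congr' ?_
      filter_upwards [Filter.eventually_gt_atTop 0] with N hN
      have hN' : (N : ℝ) ≠ 0 := by exact_mod_cast hN.ne'
      have : (N : ℝ) ^ P.natDegree = (N : ℝ) ^ d * (N : ℝ) ^ (P.natDegree - d) := by
        rw [← pow_add]; congr 1; omega
      rw [this]
      field_simp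
    rw [mul_zero] at h2
    exact hP (Polynomial.leadingCoeff_eq_zero.1 (tendsto_nhds_unique h1 h2))
  refine ⟨hdeg, ?_⟩
  rcases hdeg.lt_or_eq with hlt | heq
  · rw [Polynomial.coeff_eq_zero_of_natDegree_lt hlt]
    have := (Polynomial.div_tendsto_atTop_zero_of_degree_lt P (Polynomial.X ^ d)
      (by simpa using Polynomial.degree_le_natDegree.trans_lt (by exact_mod_cast hlt))).comp
        tendsto_natCast_atTop_atTop
    exact tendsto_nhds_unique (by simpa [Function.comp_def] using this) h
  · by_cases hP : P = 0
    · subst hP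
      simp only [Polynomial.eval_zero, zero_div] at h
      simpa using tendsto_nhds_unique tendsto_const_nhds h
    · have := hlead d (by rw [Polynomial.degree_eq_natDegree hP, heq])
      rw [← heq, Polynomial.coeff_natDegree]
      exact tendsto_nhds_unique this h

theorem homogeneousComponent_eval_smul [Fintype ι] (p : MvPolynomial ι ℝ) (d : ℕ) (r : ℝ) (x : ι → ℝ) :
    MvPolynomial.eval (r • x) (MvPolynomial.homogeneousComponent d p) =
      r ^ d * MvPolynomial.eval x (MvPolynomial.homogeneousComponent d p) := by
  rw [MvPolynomial.eval_eq', MvPolynomial.eval_eq', Finset.mul_sum]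
  refine Finset.sum_congr rfl fun m hm => ?_
  have hd := MvPolynomial.homogeneousComponent_isHomogeneous d p (MvPolynomial.mem_support_iff.1 hm)
  replace hd : m.degree = d := by rw [Finsupp.degree_eq_weight_one]; exact hd
  rw [Finsupp.degree_eq_sum] at hd
  simp only [Pi.smul_apply, smul_eq_mul, mul_pow, Finset.prod_mul_distrib, Finset.prod_pow_eq_pow_sum]
  rw [hd]
  ring

/-- If `p (N l) / N ^ d` converges for every `l ∈ ℕ^ι`, then `p` has degree at most `d`, and the
limit is the value of its homogeneous component of degree `d`. -/
theorem totalDegree_le_of_tendsto [Fintype ι] (p : MvPolynomial ι ℝ) (d : ℕ) (V : (ι → ℕ) → ℝ)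
    (h : ∀ l : ι → ℕ, Filter.Tendsto (fun N : ℕ => MvPolynomial.eval
      ((N : ℝ) • fun i => (l i : ℝ)) p / (N : ℝ) ^ d) Filter.atTop (nhds (V l))) :
    p.totalDegree ≤ d ∧ ∀ l : ι → ℕ,
      MvPolynomial.eval (fun i => (l i : ℝ)) (MvPolynomial.homogeneousComponent d p) = V l := by
  let P : (ι → ℕ) → Polynomial ℝ := fun l => ∑ e ∈ Finset.range (p.totalDegree + 1),
    Polynomial.monomial e
      (MvPolynomial.eval (fun i => (l i : ℝ)) (MvPolynomial.homogeneousComponent e p))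
  have hPeval : ∀ l (r : ℝ), (P l).eval r = MvPolynomial.eval (r • fun i => (l i : ℝ)) p := by
    intro l r
    conv_rhs => rw [← MvPolynomial.sum_homogeneousComponent p, map_sum]
    simp only [P, Polynomial.eval_finsetSum, Polynomial.eval_monomial,
      homogeneousComponent_eval_smul, mul_comm]
  have hPcoeff : ∀ l e, (P l).coeff e = MvPolynomial.eval (fun i => (l i : ℝ))
      (MvPolynomial.homogeneousComponent e p) := by
    intro l e
    simp only [P, Polynomial.finsetSum_coeff, Polynomial.coeff_monomial, Finset.sum_ite_eq',
      Finset.mem_range]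
    split_ifs with he
    · rfl
    · rw [MvPolynomial.homogeneousComponent_eq_zero _ _ (by omega), map_zero]
  have hmain := fun l => Polynomial.coeff_eq_of_tendsto_div_pow (P l) (d := d) (v := V l)
    (by simpa only [hPeval] using h l)
  refine ⟨?_, fun l => by rw [← hPcoeff, (hmain l).2]⟩
  have hzero : ∀ e, d < e → MvPolynomial.homogeneousComponent e p = 0 := by
    intro e he
    refine MvPolynomial.funext_set (fun _ => Set.range (Nat.cast : ℕ → ℝ))
      (fun _ => Set.infinite_range_of_injective Nat.cast_injective) fun x hx => ?_
    choose l hl using fun i => hx i (Set.mem_univ i)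
    obtain rfl : (fun i => (l i : ℝ)) = x := funext hl
    rw [map_zero, ← hPcoeff]
    exact Polynomial.coeff_eq_zero_of_natDegree_lt ((hmain l).1.trans_lt he)
  refine Finset.sup_le fun m hm => ?_
  by_contra hlt
  push Not at hlt
  have := congrArg (MvPolynomial.coeff m)
    (hzero m.degree (by simpa [Finsupp.degree_apply, Finsupp.sum] using hlt))
  rw [MvPolynomial.coeff_homogeneousComponent, if_pos rfl] at this
  exact MvPolynomial.mem_support_iff.1 hm this

end

/-! ### The mixed volume as an alternating sum of lattice point counts -/

theorem tendsto_latticeCount_div_pow {n : ℕ} {K : Set (Fin n → ℝ)} (hK : IsCompact K)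
    (hconv : Convex ℝ K) : Filter.Tendsto
      (fun N : ℕ => (latticeCount ((N : ℝ) • K) : ℝ) / (N : ℝ) ^ n) Filter.atTop
      (nhds (MeasureTheory.volume.real K)) := by
  have h := tendsto_card_div_pow_atTop_volume K hK.isBounded hK.measurableSet
    (hconv.addHaar_frontier _)
  rw [Fintype.card_fin] at h
  refine h.congr' ?_
  filter_upwards [Filter.eventually_gt_atTop 0] with N hN
  have : NeZero N := ⟨hN.ne'⟩
  have hN' : (N : ℝ) ≠ 0 := by exact_mod_cast hN.ne'
  congr 2
  refine (Nat.card_congr (Equiv.ofBijective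
    (fun m : {m : Fin n → ℤ // toReal m ∈ (N : ℝ) • K} => (⟨(N : ℝ)⁻¹ • toReal m.1, ?_, ?_⟩ :
      ↑(K ∩ (N : ℝ)⁻¹ • (Submodule.span ℤ (Set.range (Pi.basisFun ℝ (Fin n))) :
        Set (Fin n → ℝ))))) ⟨?_, ?_⟩)).symm
  · exact (Set.mem_smul_set_iff_inv_smul_mem₀ hN' _ _).1 m.2
  · rw [← Submodule.coe_pointwise_smul, SetLike.mem_coe,
      BoxIntegral.unitPartition.mem_smul_span_iff]
    intro i
    exact ⟨m.1 i, by simp [toReal, hN']⟩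
  · intro m m' hmm
    have h1 := congrArg Subtype.val hmm
    simp only [smul_right_inj (inv_ne_zero hN')] at h1
    exact Subtype.ext (toReal_injective h1)
  · rintro ⟨x, hxK, hx⟩
    rw [← Submodule.coe_pointwise_smul, SetLike.mem_coe,
      BoxIntegral.unitPartition.mem_smul_span_iff] at hx
    choose m hm using hx
    have hmx : toReal m = (N : ℝ) • x := funext hm
    refine ⟨⟨m, hmx ▸ Set.smul_mem_smul_set hxK⟩, ?_⟩
    simp [hmx, smul_smul, hN']

section

variable {n : ℕ} {ι : Type*} [Fintype ι] {A : ι → Finset (Fin n → ℤ)}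

theorem volume_minkowskiComb_mono (hA : ∀ i, (A i).Nonempty) {c d : ι → ℝ} (hc : ∀ i, 0 ≤ c i)
    (hcd : ∀ i, c i ≤ d i) : MeasureTheory.volume.real (minkowskiComb A c) ≤
      MeasureTheory.volume.real (minkowskiComb A d) := by
  have hd : minkowskiComb A d = minkowskiComb A c + minkowskiComb A (d - c) := by
    rw [← minkowskiComb_add A hc (d := d - c) fun i => sub_nonneg.2 (hcd i), add_sub_cancel]
  obtain ⟨x, hx⟩ : (minkowskiComb A (d - c)).Nonempty := by
    choose a ha using hA
    exact ⟨_, Set.finsetSum_mem_finsetSum _ _ (fun i => (d - c) i • toReal (a i)) fun i _ =>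
      Set.smul_mem_smul_set (subset_convexHull ℝ _ ⟨a i, ha i, rfl⟩)⟩
  have hsub : minkowskiComb A c + {x} ⊆ minkowskiComb A d := by
    rw [hd]; exact Set.add_subset_add_left (Set.singleton_subset_iff.2 hx)
  have hvol : MeasureTheory.volume.real (minkowskiComb A c) =
      MeasureTheory.volume.real (minkowskiComb A c + {x}) := by
    rw [Set.add_singleton, Set.image_add_right, MeasureTheory.measureReal_def,
      MeasureTheory.measureReal_def, MeasureTheory.measure_preimage_add_right]
  rw [hvol]
  exact MeasureTheory.measureReal_mono hsub (isCompact_minkowskiComb A d).measure_lt_top.ne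

theorem volume_minkowskiComb_smul {r : ℝ} (hr : 0 ≤ r) (c : ι → ℝ) :
    MeasureTheory.volume.real (minkowskiComb A (r • c)) =
      r ^ n * MeasureTheory.volume.real (minkowskiComb A c) := by
  rw [minkowskiComb_smul, MeasureTheory.measureReal_def, MeasureTheory.Measure.addHaar_smul,
    ENNReal.toReal_mul, ENNReal.toReal_ofReal (abs_nonneg _), abs_of_nonneg (pow_nonneg hr _)]
  simp [MeasureTheory.measureReal_def]

/-- The volume of `∑ cᵢ Pᵢ` is the top homogeneous component of a polynomial that counts lattice
points. Integral `c` are covered by the asymptotic point count, rational `c` by homogeneity, and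
real `c` because the volume is monotone in `c`. -/
theorem volume_minkowskiComb_eq_eval (hA : ∀ i, (A i).Nonempty) (p : MvPolynomial ι ℝ)
    (hp : ∀ l : ι → ℕ, MeasureTheory.volume.real (minkowskiComb A fun i => (l i : ℝ)) =
      MvPolynomial.eval (fun i => (l i : ℝ)) (MvPolynomial.homogeneousComponent n p))
    {c : ι → ℝ} (hc : ∀ i, 0 ≤ c i) : MeasureTheory.volume.real (minkowskiComb A c) =
      MvPolynomial.eval c (MvPolynomial.homogeneousComponent n p) := by
  have hrat : ∀ (N : ℕ) (l : ι → ℕ),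
      MeasureTheory.volume.real (minkowskiComb A ((N : ℝ)⁻¹ • fun i => (l i : ℝ))) =
      MvPolynomial.eval ((N : ℝ)⁻¹ • fun i => (l i : ℝ))
        (MvPolynomial.homogeneousComponent n p) := by
    intro N l
    rw [volume_minkowskiComb_smul (by positivity), hp, homogeneousComponent_eval_smul]
  have hcont := MvPolynomial.continuous_eval (MvPolynomial.homogeneousComponent n p)
  have hlow : Filter.Tendsto (fun N : ℕ => (N : ℝ)⁻¹ • fun i => ((⌊(N : ℝ) * c i⌋₊ : ℕ) : ℝ))
      Filter.atTop (nhds c) := by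
    rw [tendsto_pi_nhds]
    intro i
    have := (tendsto_nat_floor_mul_div_atTop (hc i)).comp
      (tendsto_natCast_atTop_atTop (R := ℝ))
    refine this.congr fun N => ?_
    simp [div_eq_inv_mul, mul_comm]
  have hupp : Filter.Tendsto (fun N : ℕ => (N : ℝ)⁻¹ • fun i => ((⌊(N : ℝ) * c i⌋₊ + 1 : ℕ) : ℝ))
      Filter.atTop (nhds c) := by
    have h1 : Filter.Tendsto (fun N : ℕ => fun _ : ι => (N : ℝ)⁻¹) Filter.atTop (nhds 0) := by
      rw [tendsto_pi_nhds]
      exact fun _ => tendsto_inv_atTop_nhds_zero_nat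
    have := hlow.add h1
    rw [add_zero] at this
    refine this.congr fun N => ?_
    funext i
    simp [mul_add]
  refine le_antisymm (ge_of_tendsto ((hcont.tendsto c).comp hupp) ?_)
    (le_of_tendsto ((hcont.tendsto c).comp hlow) ?_)
  · filter_upwards [Filter.eventually_gt_atTop 0] with N hN
    have hN' : (0 : ℝ) < N := by exact_mod_cast hN
    simp only [Function.comp_apply]
    rw [← hrat]
    refine volume_minkowskiComb_mono hA hc fun i => ?_
    simp only [Pi.smul_apply, smul_eq_mul]
    rw [← div_eq_inv_mul, le_div_iff₀ hN', mul_comm]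
    push_cast
    exact (Nat.lt_floor_add_one _).le
  · filter_upwards [Filter.eventually_gt_atTop 0] with N hN
    have hN' : (0 : ℝ) < N := by exact_mod_cast hN
    simp only [Function.comp_apply]
    rw [← hrat]
    refine volume_minkowskiComb_mono hA (fun i => by simp only [Pi.smul_apply]; positivity)
      fun i => ?_
    simp only [Pi.smul_apply, smul_eq_mul]
    rw [← div_eq_inv_mul, div_le_iff₀ hN', mul_comm (c i)]
    exact Nat.floor_le (mul_nonneg hN'.le (hc i))

end

/-- For a polynomial of degree at most `n`, the mixed difference in `n` of the variables is the
coefficient of their product. -/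
theorem sum_neg_one_pow_mul_eval {n : ℕ} (p : MvPolynomial (Option (Fin n)) ℝ)
    (hp : p.totalDegree ≤ n) (t : ℝ) :
    ∑ J : Finset (Fin n), (-1 : ℝ) ^ J.card *
      MvPolynomial.eval (fun o => o.elim t fun j => if j ∈ J then 0 else 1) p =
    p.coeff (Finsupp.mapDomain some (Finsupp.equivFunOnFinite.symm fun _ => 1)) := by
  classical
  set e : Option (Fin n) →₀ ℕ :=
    Finsupp.mapDomain some (Finsupp.equivFunOnFinite.symm fun _ => 1) with he
  have he_some : ∀ j, e (some j) = 1 := fun j => by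
    rw [he, Finsupp.mapDomain_apply (Option.some_injective _)]; rfl
  have he_none : e none = 0 := Finsupp.mapDomain_of_notMem_range _ _ (by simp)
  simp only [MvPolynomial.eval_eq', Fintype.prod_option, Option.elim_none, Option.elim_some,
    Finset.mul_sum]
  rw [Finset.sum_comm]
  have hterm : ∀ m : Option (Fin n) →₀ ℕ, ∑ J : Finset (Fin n), (-1 : ℝ) ^ J.card *
      (p.coeff m * (t ^ m none * ∏ j, (if j ∈ J then 0 else 1 : ℝ) ^ m (some j))) =
      p.coeff m * t ^ m none * if ∀ j, m (some j) ≠ 0 then 1 else 0 := by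
    intro m
    have h1 := Finset.prod_sub (fun _ : Fin n => (1 : ℝ)) (fun j => 0 ^ m (some j)) Finset.univ
    have h2 : ∏ j : Fin n, ((1 : ℝ) - 0 ^ m (some j)) =
        if ∀ j, m (some j) ≠ 0 then 1 else 0 := by
      split_ifs with h
      · exact Finset.prod_eq_one fun j _ => by simp [h j]
      · push Not at h
        obtain ⟨j, hj⟩ := h
        exact Finset.prod_eq_zero (Finset.mem_univ j) (by simp [hj])
    rw [← h2, h1, Finset.mul_sum, Finset.powerset_univ]
    refine Finset.sum_congr rfl fun J _ => ?_
    have h3 : ∏ j, (if j ∈ J then 0 else 1 : ℝ) ^ m (some j) = ∏ j ∈ J, (0 : ℝ) ^ m (some j) := by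
      rw [← Finset.prod_subset (Finset.subset_univ J)]
      · exact Finset.prod_congr rfl fun j hj => by simp [hj]
      · intro j _ hj; simp [hj]
    rw [h3, Finset.prod_const_one]
    ring
  simp only [hterm]
  rw [Finset.sum_eq_single e]
  · simp [he_some, he_none]
  · intro m hm hme
    rw [if_neg, mul_zero]
    intro hall
    refine hme ?_
    -- a monomial of degree at most `n` that involves all `n` variables is their product
    have hdeg : m none + ∑ j, m (some j) ≤ n := by
      have := (MvPolynomial.le_totalDegree hm).trans hp
      rwa [Finsupp.sum_fintype _ _ (fun _ => rfl), Fintype.sum_option] at this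
    have hge : ∀ j, 1 ≤ m (some j) := fun j => Nat.one_le_iff_ne_zero.2 (hall j)
    have hsum : n ≤ ∑ j, m (some j) := by
      simpa using Finset.sum_le_sum fun j (_ : j ∈ Finset.univ) => hge j
    have hone : ∀ j, m (some j) = 1 := by
      have h4 : ∑ j : Fin n, 1 = ∑ j, m (some j) := by
        simp only [Finset.sum_const, Finset.card_univ, Fintype.card_fin, smul_eq_mul, mul_one]
        omega
      exact fun j => ((Finset.sum_eq_sum_iff_of_le fun j _ => hge j).1 h4 j (Finset.mem_univ j)).symm
    ext o
    cases o with
    | none => rw [he_none]; omega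
    | some j => rw [he_some, hone]
  · intro h
    rw [MvPolynomial.notMem_support_iff.1 h]
    ring

/-- The mixed volume of `P₁, …, Pₙ` is the mixed difference, with base point `P₀`, of the lattice
point count, for every lattice polytope `P₀`. -/
theorem isMixedVolume_sum_latticeCount {n : ℕ} (A₀ : Finset (Fin n → ℤ))
    (A : Fin n → Finset (Fin n → ℤ)) (hA₀ : A₀.Nonempty) (hA : ∀ j, (A j).Nonempty) :
    IsMixedVolume (fun j => latticePolytope (A j)) (∑ J : Finset (Fin n), (-1 : ℝ) ^ J.card *
      latticeCount (latticePolytope A₀ + ∑ j ∈ Jᶜ, latticePolytope (A j))) := by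
  classical
  -- the index `none` stands for the base polytope `P₀`
  let B : Option (Fin n) → Finset (Fin n → ℤ) := fun o => o.elim A₀ A
  have hB : ∀ o, (B o).Nonempty := by rintro (_ | j) <;> simp [B, hA₀, hA]
  obtain ⟨p, hp⟩ := exists_polynomial_of_fwdDiff_iter (fun o => (B o).card)
    (fun l => (latticeCount (minkowskiComb B fun i => (l i : ℝ)) : ℝ))
    (fun o l => fwdDiff_iter_latticeCount hB o l)
  obtain ⟨hdeg, hvol⟩ := totalDegree_le_of_tendsto p n
    (fun l => MeasureTheory.volume.real (minkowskiComb B fun i => (l i : ℝ))) fun l => by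
      refine (tendsto_latticeCount_div_pow (isCompact_minkowskiComb B _)
        (convex_minkowskiComb B _)).congr fun N => ?_
      have := hp (N • l)
      rw [← minkowskiComb_smul]
      have e : ((N : ℝ) • fun i => (l i : ℝ)) = fun i => (((N • l) i : ℕ) : ℝ) := by
        funext i; simp
      rw [e, this]
  set q := MvPolynomial.homogeneousComponent n p with hq
  have hqvol : ∀ c : Option (Fin n) → ℝ, (∀ o, 0 ≤ c o) →
      MeasureTheory.volume.real (minkowskiComb B c) = MvPolynomial.eval c q := fun c hc =>
    volume_minkowskiComb_eq_eval hB p (fun l => (hvol l).symm) hc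
  -- the volume polynomial of `P₁, …, Pₙ` alone
  let g : Option (Fin n) → MvPolynomial (Fin n) ℝ := fun o => o.elim 0 MvPolynomial.X
  let p' : MvPolynomial (Fin n) ℝ := MvPolynomial.eval₂ MvPolynomial.C g q
  have hp'eval : ∀ c : Fin n → ℝ, MvPolynomial.eval c p' =
      MvPolynomial.eval (fun o => o.elim 0 c) q := by
    intro c
    have e : (fun o => MvPolynomial.eval c (g o)) = fun o : Option (Fin n) => o.elim 0 c := by
      funext o; cases o <;> simp [g]
    have e' : (MvPolynomial.eval c).comp MvPolynomial.C = RingHom.id ℝ := by ext; simp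
    rw [MvPolynomial.eval_eval₂, e, e', MvPolynomial.eval₂_id]
  have hp'deg : p'.totalDegree ≤ n := by
    have := (MvPolynomial.homogeneousComponent_isHomogeneous n p).eval₂ MvPolynomial.C g
      (fun r => MvPolynomial.isHomogeneous_C _ r) (n := 1) (by
        rintro (_ | j)
        · exact MvPolynomial.isHomogeneous_zero _ _ _
        · exact MvPolynomial.isHomogeneous_X _ _)
    rw [one_mul] at this
    exact this.totalDegree_le
  refine ⟨p', fun c hc => ?_, ?_⟩
  · rw [hp'eval, ← hqvol _ (by rintro (_ | j) <;> simp [hc])]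
    rw [minkowskiComb, Fintype.sum_option, MeasureTheory.measureReal_def]
    simp only [Option.elim_none, Option.elim_some, B,
      Set.zero_smul_set (latticePolytope_nonempty hA₀), zero_add]
  · -- The mixed differences of the volume at `0 P₀` and of the lattice point count at `1 P₀` are
    -- the same coefficient, because the polynomials agree in degree `n`.
    have h1 := sum_neg_one_pow_mul_eval (MvPolynomial.rename some p')
      ((MvPolynomial.totalDegree_rename_le _ _).trans hp'deg) 0
    rw [MvPolynomial.coeff_rename_mapDomain _ (Option.some_injective _)] at h1
    have h2 := sum_neg_one_pow_mul_eval q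
      ((MvPolynomial.homogeneousComponent_isHomogeneous n p).totalDegree_le) 0
    have h3 := sum_neg_one_pow_mul_eval p hdeg 1
    rw [← h1]
    simp only [MvPolynomial.eval_rename, Function.comp_def, Option.elim_some, hp'eval]
    rw [h2, hq, MvPolynomial.coeff_homogeneousComponent, if_pos, ← h3]
    · refine Finset.sum_congr rfl fun J _ => ?_
      congr 1
      have h4 := hp fun o => o.elim 1 fun j => if j ∈ J then 0 else 1
      have e : (fun i : Option (Fin n) => ((i.elim 1 fun j => if j ∈ J then 0 else 1 : ℕ) : ℝ)) =
          fun o => o.elim 1 fun j => if j ∈ J then 0 else 1 := by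
        funext o; cases o <;> simp
      rw [e] at h4
      rw [← h4, minkowskiComb, Fintype.sum_option]
      congr 3
      · simp [B]
      · rw [← Finset.sum_compl_add_sum J]
        rw [Finset.sum_eq_zero (s := J), add_zero]
        · exact Finset.sum_congr rfl fun j hj => by simp [Finset.mem_compl.1 hj, B]
        · intro j hj
          simp [hj, Set.zero_smul_set (latticePolytope_nonempty (hA j)), B]
    · rw [Finsupp.degree_eq_sum, Fintype.sum_option, Finsupp.mapDomain_of_notMem_range _ _ (by simp)]
      simp [Finsupp.mapDomain_apply (Option.some_injective _)]

/-! ### The Koszul complex -/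

section Koszul

variable {ι : Type*} [LinearOrder ι]

/-- The sign of moving `j` past the smaller elements of `S`. -/
def koszulSign (j : ι) (S : Finset ι) : ℤ := (-1) ^ (S.filter (· < j)).card

theorem koszulSign_insert {i j : ι} {S : Finset ι} (hi : i ∉ S) :
    koszulSign j (insert i S) = (if i < j then -1 else 1) * koszulSign j S := by
  rw [koszulSign, koszulSign, Finset.filter_insert]
  split_ifs with h
  · rw [Finset.card_insert_of_notMem (by simp [hi]), pow_succ, mul_comm]
  · rw [one_mul]

theorem koszulSign_mul_self (j : ι) (S : Finset ι) : koszulSign j S * koszulSign j S = 1 := by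
  rw [koszulSign, ← pow_add, ← two_mul, pow_mul]; simp

variable {R : Type*} [CommRing R] {M : Type*} [AddCommGroup M] [Module R M]

variable (R M) in
/-- Contraction of `M ⊗ Λ(ι)` against the dual basis vector `j`. An element of `M ⊗ Λ(ι)` is given
by its coefficients, indexed by the finite subsets of `ι`. -/
def contract (j : ι) : (Finset ι → M) →ₗ[R] (Finset ι → M) where
  toFun z S := if j ∈ S then 0 else koszulSign j S • z (insert j S)
  map_add' z w := by funext S; by_cases h : j ∈ S <;> simp [h]
  map_smul' r z := by
    funext S
    by_cases h : j ∈ S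
    · simp [h]
    · simp [h, smul_comm r (koszulSign j S)]

variable (R M) in
/-- Exterior multiplication by the basis vector `j` on `M ⊗ Λ(ι)`. -/
def wedge (j : ι) : (Finset ι → M) →ₗ[R] (Finset ι → M) where
  toFun z S := if j ∈ S then koszulSign j (S.erase j) • z (S.erase j) else 0
  map_add' z w := by funext S; by_cases h : j ∈ S <;> simp [h]
  map_smul' r z := by
    funext S
    by_cases h : j ∈ S
    · simp [h, smul_comm r (koszulSign j (S.erase j))]
    · simp [h]

theorem contract_contract (i j : ι) (z : Finset ι → M) :
    contract R M i (contract R M j z) + contract R M j (contract R M i z) = 0 := by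
  funext S
  simp only [contract, LinearMap.coe_mk, AddHom.coe_mk, Pi.add_apply, Pi.zero_apply]
  by_cases hij : i = j
  · subst hij; simp
  by_cases hi : i ∈ S
  · simp [hi]
  by_cases hj : j ∈ S
  · simp [hj]
  have hij' : j ≠ i := Ne.symm hij
  simp only [hi, hj, Finset.mem_insert, hij, hij', or_self, if_false, smul_smul,
    koszulSign_insert hi, koszulSign_insert hj, Finset.insert_comm i j, ← add_smul]
  rcases lt_or_gt_of_ne hij with h | h
  · rw [if_pos h, if_neg h.not_gt]
    convert zero_smul ℤ _
    ring
  · rw [if_pos h, if_neg h.not_gt]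
    convert zero_smul ℤ _
    ring

theorem contract_wedge (i j : ι) (z : Finset ι → M) :
    contract R M i (wedge R M j z) + wedge R M j (contract R M i z) = if i = j then z else 0 := by
  funext S
  simp only [contract, wedge, LinearMap.coe_mk, AddHom.coe_mk, Pi.add_apply]
  by_cases hij : i = j
  · subst hij
    by_cases hi : i ∈ S
    · simp [hi, smul_smul, koszulSign_mul_self]
    · simp [hi, smul_smul, koszulSign_mul_self]
  simp only [if_neg hij, Pi.zero_apply]
  by_cases hi : i ∈ S
  · have : i ∈ S.erase j := by simp [hi, hij]
    simp [hi, this]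
  by_cases hj : j ∈ S
  · have h1 : i ∉ S.erase j := by simp [hi]
    have h2 : (insert i S).erase j = insert i (S.erase j) :=
      Finset.erase_insert_of_ne hij
    have h3 : koszulSign i S = (if j < i then -1 else 1) * koszulSign i (S.erase j) := by
      rw [← koszulSign_insert (Finset.notMem_erase j S), Finset.insert_erase hj]
    simp only [hi, hj, h1, h2, h3, koszulSign_insert h1, Finset.mem_insert, or_true, if_true,
      if_false, smul_smul, ← add_smul]
    rcases lt_or_gt_of_ne hij with h | h
    · rw [if_pos h, if_neg h.not_gt]
      convert zero_smul ℤ _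
      ring
    · rw [if_pos h, if_neg h.not_gt]
      convert zero_smul ℤ _
      ring
  · simp [hi, hj, Ne.symm hij]

variable [Fintype ι]

variable (M) in
/-- The differential of the Koszul complex `K(f; M)`. -/
def koszulD (f : ι → R) : (Finset ι → M) →ₗ[R] (Finset ι → M) :=
  ∑ j, f j • contract R M j

variable (M) in
/-- Exterior multiplication by `∑ rⱼ eⱼ`. -/
def koszulH (r : ι → R) : (Finset ι → M) →ₗ[R] (Finset ι → M) :=
  ∑ j, r j • wedge R M j

theorem koszulD_koszulD (f : ι → R) (z : Finset ι → M) : koszulD M f (koszulD M f z) = 0 := by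
  simp only [koszulD, LinearMap.sum_apply, LinearMap.smul_apply, map_sum, map_smul]
  simp only [Finset.smul_sum, smul_smul]
  refine Eq.trans (Finset.sum_product' Finset.univ Finset.univ
    fun i j => (f i * f j) • contract R M j (contract R M i z)).symm ?_
  refine Finset.sum_involution (fun p _ => p.swap) ?_ ?_ (by simp) (by simp)
  · rintro ⟨i, j⟩ _
    simp only [Prod.swap_prod_mk]
    rw [mul_comm (f j), ← smul_add, contract_contract, smul_zero]
  · rintro ⟨i, j⟩ _ hne heq
    obtain rfl : j = i := (Prod.ext_iff.1 heq).1
    refine hne ?_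
    have : contract R M j (contract R M j z) = 0 := by
      funext S
      by_cases h : j ∈ S <;> simp [contract, h]
    simp [this]

/-- The homotopy formula `d h + h d = ∑ rⱼ fⱼ`. -/
theorem koszulD_koszulH (f r : ι → R) (z : Finset ι → M) :
    koszulD M f (koszulH M r z) + koszulH M r (koszulD M f z) = (∑ j, r j * f j) • z := by
  simp only [koszulD, koszulH, LinearMap.sum_apply, LinearMap.smul_apply, map_sum, map_smul]
  simp only [Finset.smul_sum, smul_smul]
  rw [Finset.sum_comm (γ := ι), ← Finset.sum_add_distrib, Finset.sum_smul]
  refine Finset.sum_congr rfl fun j _ => ?_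
  rw [← Finset.sum_add_distrib, Finset.sum_eq_single j]
  · rw [mul_comm (f j), ← smul_add, contract_wedge, if_pos rfl]
  · intro i _ hij
    rw [mul_comm (f j), ← smul_add, contract_wedge, if_neg (Ne.symm hij), smul_zero]
  · simp

/-- The elements of the Koszul complex of homological degree `i`. -/
def SupportedIn (i : ℕ) (z : Finset ι → M) : Prop := ∀ S : Finset ι, S.card ≠ i → z S = 0

theorem SupportedIn.koszulH {i : ℕ} {z : Finset ι → M} (hz : SupportedIn i z) (r : ι → R) :
    SupportedIn (i + 1) (koszulH M r z) := by
  intro S hS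
  simp only [CoxToric.koszulH, LinearMap.sum_apply, LinearMap.smul_apply, Finset.sum_apply,
    Pi.smul_apply]
  refine Finset.sum_eq_zero fun j _ => ?_
  by_cases h : j ∈ S
  · have : (S.erase j).card ≠ i := by
      have := Finset.card_erase_add_one h; omega
    simp [wedge, h, hz _ this]
  · simp [wedge, h]

theorem SupportedIn.koszulD {i : ℕ} {z : Finset ι → M} (hz : SupportedIn (i + 1) z) (f : ι → R) :
    SupportedIn i (koszulD M f z) := by
  intro S hS
  simp only [CoxToric.koszulD, LinearMap.sum_apply, LinearMap.smul_apply, Finset.sum_apply,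
    Pi.smul_apply]
  refine Finset.sum_eq_zero fun j _ => ?_
  by_cases h : j ∈ S
  · simp [contract, h]
  · have : (insert j S).card ≠ i + 1 := by
      rw [Finset.card_insert_of_notMem h]; omega
    simp [contract, h, hz _ this]

theorem koszulD_comp {N : Type*} [AddCommGroup N] [Module R N] (φ : M →ₗ[R] N) (f : ι → R)
    (z : Finset ι → M) : koszulD N f (φ ∘ z) = φ ∘ koszulD M f z := by
  funext S
  simp only [koszulD, LinearMap.sum_apply, LinearMap.smul_apply, Finset.sum_apply, Pi.smul_apply,
    Function.comp_apply, map_sum, map_smul]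
  refine Finset.sum_congr rfl fun j _ => ?_
  by_cases h : j ∈ S <;> simp [contract, h]

/-- Depth sensitivity of the Koszul complex: an `M`-regular sequence of length `r` in the ideal
`(f₁, …, fₙ)` makes the homology of `K(f; M)` vanish in degrees above `n - r`. If `a = ∑ rⱼ fⱼ` is
the first element of the sequence and `z` is a cycle, then `h z` is a cycle modulo `a`, where `h` is
the homotopy with `d h + h d = a`; so `h z = d w + a y` and `a z = d h z = a d y`. -/
theorem exists_koszulD_eq (f : ι → R) (rs : List R) (hrs : ∀ a ∈ rs, a ∈ Ideal.span (Set.range f)) :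
    ∀ {M : Type*} [AddCommGroup M] [Module R M], RingTheory.Sequence.IsWeaklyRegular M rs →
      ∀ (i : ℕ), Fintype.card ι < i + rs.length → ∀ z : Finset ι → M, SupportedIn i z →
        koszulD M f z = 0 → ∃ y : Finset ι → M, SupportedIn (i + 1) y ∧ koszulD M f y = z := by
  induction rs with
  | nil =>
    intro M _ _ _ i hi z hz _
    refine ⟨0, fun _ _ => rfl, ?_⟩
    rw [map_zero]
    funext S
    refine (hz S ?_).symm
    have := S.card_le_univ
    simp only [List.length_nil, add_zero] at hi
    omega
  | cons a rs ih =>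
    intro M _ _ hreg i hi z hz hdz
    rw [RingTheory.Sequence.isWeaklyRegular_cons_iff] at hreg
    obtain ⟨r, hr⟩ := Submodule.mem_span_range_iff_exists_fun R |>.1 (hrs a List.mem_cons_self)
    have hhom : koszulD M f (koszulH M r z) = a • z := by
      have := koszulD_koszulH f r z
      rwa [hdz, map_zero, add_zero, show ∑ j, r j * f j = a from hr] at this
    let φ : M →ₗ[R] QuotSMulTop a M := Submodule.mkQ _
    have hφ : ∀ x, φ x = 0 ↔ ∃ y, a • y = x := by
      intro x
      rw [Submodule.mkQ_apply, Submodule.Quotient.mk_eq_zero, Submodule.mem_smul_pointwise_iff_exists]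
      simp
    have hcyc : koszulD _ f (φ ∘ koszulH M r z) = 0 := by
      rw [koszulD_comp, hhom]
      funext S
      exact (hφ _).2 ⟨z S, rfl⟩
    obtain ⟨w', hw', hdw'⟩ := ih (fun b hb => hrs b (List.mem_cons_of_mem _ hb)) hreg.2 (i + 1)
      (by simp only [List.length_cons] at hi; omega) (φ ∘ koszulH M r z)
      (fun S hS => by simp [hz.koszulH r S hS]) hcyc
    have hlift : ∀ S, ∃ x : M, φ x = w' S ∧ (S.card ≠ i + 2 → x = 0) := by
      intro S
      by_cases hS : S.card = i + 2
      · obtain ⟨x, hx⟩ := Submodule.mkQ_surjective _ (w' S)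
        exact ⟨x, hx, fun h => absurd hS h⟩
      · exact ⟨0, by rw [map_zero, hw' S hS], fun _ => rfl⟩
    choose w hw hw0 using hlift
    have hdw : φ ∘ koszulD M f w = φ ∘ koszulH M r z := by
      rw [← koszulD_comp, ← hdw']
      congr 1
      exact funext hw
    have hwsupp : SupportedIn (i + 2) w := hw0
    have hdiff : ∀ S, ∃ x : M, a • x = koszulH M r z S - koszulD M f w S ∧
        (S.card ≠ i + 1 → x = 0) := by
      intro S
      by_cases hS : S.card = i + 1
      · obtain ⟨x, hx⟩ := (hφ (koszulH M r z S - koszulD M f w S)).1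
          (by rw [map_sub, sub_eq_zero]; exact (congrFun hdw S).symm)
        exact ⟨x, hx, fun h => absurd hS h⟩
      · refine ⟨0, ?_, fun _ => rfl⟩
        rw [smul_zero, hz.koszulH r S hS, hwsupp.koszulD f S hS, sub_zero]
    choose y hy hy0 using hdiff
    refine ⟨y, hy0, ?_⟩
    have hay : a • y = koszulH M r z - koszulD M f w := funext hy
    have : a • koszulD M f y = a • z := by
      rw [← map_smul, hay, map_sub, koszulD_koszulD, sub_zero, hhom]
    funext S
    exact hreg.1 (congrFun this S)

end Koszul

/-! ### Hilbert functions from the Koszul complex -/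

section GradedKoszul

variable {k R Γ ι : Type*} [Field k] [CommRing R] [Algebra k R] [AddCommGroup Γ]
  (𝒜 : Γ → Submodule k R) (deg : ι → Γ) (α : Γ)

/-- The part of the Koszul complex of homological degree `p` and internal degree `α`. -/
def koszulPiece (p : ℕ) : Submodule k (Finset ι → R) :=
  Submodule.pi Set.univ fun J => if J.card = p then 𝒜 (α - ∑ j ∈ J, deg j) else ⊥

variable {𝒜 deg α}

theorem mem_koszulPiece {p : ℕ} {z : Finset ι → R} : z ∈ koszulPiece 𝒜 deg α p ↔
    SupportedIn p z ∧ ∀ J, z J ∈ 𝒜 (α - ∑ j ∈ J, deg j) := by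
  simp only [koszulPiece, Submodule.mem_pi, Set.mem_univ, true_imp_iff]
  constructor
  · intro h
    have h0 : SupportedIn p z := fun J hJ => by
      have := h J
      rwa [if_neg hJ, Submodule.mem_bot] at this
    refine ⟨h0, fun J => ?_⟩
    by_cases hJ : J.card = p
    · have := h J
      rwa [if_pos hJ] at this
    · rw [h0 J hJ]; exact zero_mem _
  · rintro ⟨h0, h1⟩ J
    split_ifs with hJ
    · exact h1 J
    · exact h0 J hJ

variable (𝒜 deg α) in
theorem finrank_koszulPiece [Fintype ι]
    (hfd : ∀ J : Finset ι, FiniteDimensional k (𝒜 (α - ∑ j ∈ J, deg j)))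
    (p : ℕ) : FiniteDimensional k (koszulPiece 𝒜 deg α p) ∧
      Module.finrank k (koszulPiece 𝒜 deg α p) = ∑ J : Finset ι with J.card = p,
        Module.finrank k (𝒜 (α - ∑ j ∈ J, deg j)) := by
  let B : Finset ι → Submodule k R := fun J =>
    if J.card = p then 𝒜 (α - ∑ j ∈ J, deg j) else ⊥
  have hB : ∀ J, FiniteDimensional k (B J) := by
    intro J
    by_cases hJ : J.card = p
    · have hBJ : B J = 𝒜 (α - ∑ j ∈ J, deg j) := if_pos hJ
      rw [hBJ]; exact hfd J
    · have hBJ : B J = ⊥ := if_neg hJ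
      rw [hBJ]; infer_instance
  let e : koszulPiece 𝒜 deg α p ≃ₗ[k] ∀ J, B J :=
    { toFun := fun z J => ⟨z.1 J, z.2 J (Set.mem_univ J)⟩
      invFun := fun z => ⟨fun J => (z J : R), fun J _ => (z J).2⟩
      map_add' := fun _ _ => rfl
      map_smul' := fun _ _ => rfl
      left_inv := fun _ => rfl
      right_inv := fun _ => rfl }
  refine ⟨Module.Finite.equiv e.symm, ?_⟩
  rw [e.finrank_eq, Module.finrank_pi_fintype, Finset.sum_filter]
  refine Finset.sum_congr rfl fun J _ => ?_
  split_ifs with hJ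
  · have hBJ : B J = 𝒜 (α - ∑ j ∈ J, deg j) := if_pos hJ
    rw [hBJ]
  · have hBJ : B J = ⊥ := if_neg hJ
    rw [hBJ, finrank_bot]

variable [DecidableEq Γ] [GradedAlgebra 𝒜]

variable (𝒜 deg α) in
/-- The component of internal degree `α` of an element of the Koszul complex. -/
def koszulComponent (z : Finset ι → R) : Finset ι → R :=
  fun J => GradedAlgebra.proj 𝒜 (α - ∑ j ∈ J, deg j) (z J)

theorem koszulComponent_mem {p : ℕ} {z : Finset ι → R} (hz : SupportedIn p z) :
    koszulComponent 𝒜 deg α z ∈ koszulPiece 𝒜 deg α p := by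
  refine mem_koszulPiece.2 ⟨fun J hJ => ?_, fun J => ?_⟩
  · simp [koszulComponent, hz J hJ]
  · rw [koszulComponent, GradedAlgebra.proj_apply]; exact SetLike.coe_mem _

theorem koszulComponent_eq_self {z : Finset ι → R} (hz : ∀ J, z J ∈ 𝒜 (α - ∑ j ∈ J, deg j)) :
    koszulComponent 𝒜 deg α z = z := by
  funext J
  rw [koszulComponent, GradedAlgebra.proj_apply, DirectSum.decompose_of_mem_same _ (hz J)]

variable [Fintype ι] [LinearOrder ι] {f : ι → R}

theorem koszulD_koszulComponent (hf : ∀ j, f j ∈ 𝒜 (deg j)) (z : Finset ι → R) :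
    koszulD R f (koszulComponent 𝒜 deg α z) = koszulComponent 𝒜 deg α (koszulD R f z) := by
  funext S
  simp only [koszulD, koszulComponent, LinearMap.sum_apply, LinearMap.smul_apply, Finset.sum_apply,
    Pi.smul_apply, map_sum]
  refine Finset.sum_congr rfl fun j _ => ?_
  by_cases h : j ∈ S
  · simp [contract, h]
  · have e : α - ∑ i ∈ S, deg i = deg j + (α - ∑ i ∈ insert j S, deg i) := by
      rw [Finset.sum_insert h]; abel
    simp only [contract, LinearMap.coe_mk, AddHom.coe_mk, h, if_false, smul_eq_mul,
      mul_smul_comm, map_zsmul, koszulComponent]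
    rw [e, GradedAlgebra.proj_apply, GradedAlgebra.proj_apply,
      DirectSum.coe_decompose_mul_add_of_left_mem 𝒜 (hf j)]

theorem map_koszulD_le (hf : ∀ j, f j ∈ 𝒜 (deg j)) (p : ℕ) :
    (koszulPiece 𝒜 deg α (p + 1)).map ((koszulD R f).restrictScalars k) ≤
      koszulPiece 𝒜 deg α p := by
  rintro _ ⟨z, hz, rfl⟩
  obtain ⟨h1, h2⟩ := mem_koszulPiece.1 hz
  rw [← koszulComponent_eq_self h2]
  simp only [LinearMap.coe_restrictScalars]
  rw [koszulD_koszulComponent hf]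
  exact koszulComponent_mem (h1.koszulD f)

/-- In internal degree `α`, the image of the first Koszul differential is `I_α`. -/
theorem finrank_map_koszulPiece_one (hf : ∀ j, f j ∈ 𝒜 (deg j)) :
    Module.finrank k ((koszulPiece 𝒜 deg α 1).map ((koszulD R f).restrictScalars k)) =
      Module.finrank k (((Ideal.span (Set.range f)).restrictScalars k).submoduleOf (𝒜 α)) := by
  let ev : (Finset ι → R) →ₗ[k] R := LinearMap.proj ∅
  have hev : ∀ z : Finset ι → R, koszulD R f z ∅ = ∑ j, f j * z {j} := by
    intro z
    simp only [koszulD, LinearMap.sum_apply, LinearMap.smul_apply, Finset.sum_apply, Pi.smul_apply]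
    exact Finset.sum_congr rfl fun j _ => by simp [contract, koszulSign]
  have himage : ((koszulPiece 𝒜 deg α 1).map ((koszulD R f).restrictScalars k)).map ev =
      (((Ideal.span (Set.range f)).restrictScalars k).submoduleOf (𝒜 α)).map (𝒜 α).subtype := by
    rw [Submodule.submoduleOf, Submodule.map_comap_subtype]
    ext x
    constructor
    · rintro ⟨y, hy, rfl⟩
      refine ⟨?_, ?_⟩
      · have := (mem_koszulPiece.1 (map_koszulD_le hf 0 hy)).2 ∅
        rwa [Finset.sum_empty, sub_zero] at this
      · obtain ⟨z, _, rfl⟩ := hy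
        change koszulD R f z ∅ ∈ Ideal.span (Set.range f)
        rw [hev]
        exact sum_mem fun j _ => Ideal.mul_mem_right _ _ (Ideal.subset_span ⟨j, rfl⟩)
    · rintro ⟨hxα, hxI⟩
      obtain ⟨g, hg⟩ := Submodule.mem_span_range_iff_exists_fun R |>.1 hxI
      let z : Finset ι → R := fun J => if h : J.card = 1 then g (Finset.card_eq_one.1 h).choose else 0
      have hz1 : ∀ j, z {j} = g j := by
        intro j
        have h : ({j} : Finset ι).card = 1 := Finset.card_singleton j
        have := (Finset.card_eq_one.1 h).choose_spec
        simp only [z, dif_pos h]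
        rw [← Finset.singleton_injective this]
      have hz : SupportedIn 1 z := fun J hJ => dif_neg hJ
      refine ⟨_, ⟨koszulComponent 𝒜 deg α z, koszulComponent_mem hz, rfl⟩, ?_⟩
      simp only [LinearMap.coe_restrictScalars]
      rw [koszulD_koszulComponent hf]
      change GradedAlgebra.proj 𝒜 (α - ∑ j ∈ (∅ : Finset ι), deg j) (koszulD R f z ∅) = x
      rw [hev, Finset.sum_empty, sub_zero]
      have : ∑ j, f j * z {j} = x := by
        rw [← hg]; exact Finset.sum_congr rfl fun j _ => by rw [hz1, smul_eq_mul, mul_comm]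
      rw [this, GradedAlgebra.proj_apply, DirectSum.decompose_of_mem_same _ hxα]
  rw [← Submodule.finrank_map_subtype_eq (𝒜 α), ← himage]
  -- an element of homological degree `0` is determined by its coefficient at `∅`
  have hinj : Function.Injective (ev.domRestrict
      ((koszulPiece 𝒜 deg α 1).map ((koszulD R f).restrictScalars k))) := by
    rintro ⟨y, hy⟩ ⟨y', hy'⟩ hyy
    refine Subtype.ext (funext fun J => ?_)
    by_cases hJ : J = ∅
    · subst hJ; exact hyy
    · have hcard : J.card ≠ 0 := fun h => hJ (Finset.card_eq_zero.1 h)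
      exact ((mem_koszulPiece.1 (map_koszulD_le hf 0 hy)).1 J hcard).trans
        ((mem_koszulPiece.1 (map_koszulD_le hf 0 hy')).1 J hcard).symm
  rw [← LinearMap.finrank_range_of_inj hinj, LinearMap.range_domRestrict]

/-- If the Koszul complex of homogeneous elements `fⱼ` is exact in positive degrees, then the
Hilbert function of `R / (f₁, …, fₙ)` is the alternating sum of the Hilbert functions of its terms. -/
theorem finrank_quotient_eq_sum (hf : ∀ j, f j ∈ 𝒜 (deg j))
    (hex : ∀ i, 1 ≤ i → ∀ z : Finset ι → R, SupportedIn i z → koszulD R f z = 0 →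
      ∃ y, SupportedIn (i + 1) y ∧ koszulD R f y = z)
    (hfd : ∀ J : Finset ι, FiniteDimensional k (𝒜 (α - ∑ j ∈ J, deg j))) :
    (Module.finrank k (𝒜 α ⧸ ((Ideal.span (Set.range f)).restrictScalars k).submoduleOf (𝒜 α)) : ℤ)
      = ∑ J : Finset ι, (-1 : ℤ) ^ J.card * Module.finrank k (𝒜 (α - ∑ j ∈ J, deg j)) := by
  set D := (koszulD R f).restrictScalars k with hD
  set C := koszulPiece 𝒜 deg α with hC
  have hCfd := fun p => (finrank_koszulPiece 𝒜 deg α hfd p).1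
  have hαfd : FiniteDimensional k (𝒜 α) := by
    have := hfd ∅
    rwa [Finset.sum_empty, sub_zero] at this
  set h := Module.finrank k
    (𝒜 α ⧸ ((Ideal.span (Set.range f)).restrictScalars k).submoduleOf (𝒜 α)) with hh
  -- the dimensions of the terms, and of their images under the differential
  let c : ℕ → ℕ := fun p => Module.finrank k (C p)
  let r : ℕ → ℕ := fun p => Module.finrank k ((C p).map D)
  have hker : ∀ p, r p + Module.finrank k (C p ⊓ LinearMap.ker D : Submodule k (Finset ι → R)) =
      c p := by
    intro p
    have := hCfd p
    have h1 := LinearMap.finrank_range_add_finrank_ker (D.domRestrict (C p))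
    rw [LinearMap.range_domRestrict, LinearMap.ker_domRestrict, ← Submodule.finrank_map_subtype_eq,
      Submodule.map_comap_subtype] at h1
    exact h1
  have hexact : ∀ p, c (p + 1) = r (p + 1) + r (p + 2) := by
    intro p
    rw [← hker (p + 1)]
    congr 1
    refine (LinearEquiv.ofEq _ _ ?_).finrank_eq
    refine le_antisymm ?_ (le_inf (map_koszulD_le hf _) ?_)
    · rintro z ⟨hz, hdz⟩
      obtain ⟨h1, h2⟩ := mem_koszulPiece.1 hz
      obtain ⟨y, hy, hyz⟩ := hex (p + 1) (by omega) z h1 hdz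
      refine ⟨koszulComponent 𝒜 deg α y, koszulComponent_mem hy, ?_⟩
      simp only [hD, LinearMap.coe_restrictScalars]
      rw [koszulD_koszulComponent hf, hyz, koszulComponent_eq_self h2]
    · rintro _ ⟨z, _, rfl⟩
      exact koszulD_koszulD f z
  have hzero : c 0 = h + r 1 := by
    have h1 : c 0 = Module.finrank k (𝒜 α) := by
      simp only [c]
      rw [(finrank_koszulPiece 𝒜 deg α hfd 0).2, show (Finset.univ.filter fun J : Finset ι =>
        J.card = 0) = {∅} by ext J; simp, Finset.sum_singleton, Finset.sum_empty, sub_zero]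
    rw [h1, hh]
    simp only [r]
    rw [finrank_map_koszulPiece_one hf, Submodule.finrank_quotient_add_finrank]
  have htop : r (Fintype.card ι + 1) = 0 := by
    have : C (Fintype.card ι + 1) = ⊥ := by
      rw [eq_bot_iff]
      intro z hz
      funext J
      refine (mem_koszulPiece.1 hz).1 J ?_
      have := J.card_le_univ
      omega
    simp only [r]
    rw [this, Submodule.map_bot, finrank_bot]
  have hsum : ∀ N, ∑ p ∈ Finset.range (N + 1), (-1 : ℤ) ^ p * c p = h + (-1) ^ N * r (N + 1) := by
    intro N
    induction N with
    | zero => simp [hzero]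
    | succ N ih =>
      rw [Finset.sum_range_succ, ih, hexact]
      push_cast
      ring
  have := hsum (Fintype.card ι)
  rw [htop, Nat.cast_zero, mul_zero, add_zero] at this
  rw [← this, ← Finset.sum_fiberwise_of_maps_to (s := Finset.univ)
    (t := Finset.range (Fintype.card ι + 1)) (g := Finset.card)
    (fun J _ => Finset.mem_range.2 (Nat.lt_succ_of_le J.card_le_univ))]
  refine Finset.sum_congr rfl fun p _ => ?_
  simp only [c]
  rw [(finrank_koszulPiece 𝒜 deg α hfd p).2, Nat.cast_sum, Finset.mul_sum]
  exact Finset.sum_congr rfl fun J hJ => by rw [(Finset.mem_filter.1 hJ).2]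

end GradedKoszul

/-! ### Regular sequences in ideals of polynomial rings -/

section Nagata

open MvPolynomial

variable {k : Type*} [Field k] {n : ℕ}

/-- Nagata's substitution `Xᵢ ↦ Xᵢ + c X₀ ^ (b ^ i)` for `i ≠ 0`, `X₀ ↦ X₀`. -/
noncomputable def nagataHom (b : ℕ) (c : k) :
    MvPolynomial (Fin (n + 1)) k →ₐ[k] MvPolynomial (Fin (n + 1)) k :=
  aeval fun i => if i = 0 then X 0 else X i + c • X 0 ^ b ^ (i : ℕ)

theorem nagataHom_comp_neg (b : ℕ) (c : k) :
    (nagataHom (n := n) b c).comp (nagataHom b (-c)) = AlgHom.id _ _ := by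
  unfold nagataHom
  rw [comp_aeval, ← MvPolynomial.aeval_X_left]
  ext i v
  cases i using Fin.cases <;> simp

/-- Nagata's substitution with `c = 1`, as an automorphism. -/
noncomputable def nagataEquiv (b : ℕ) :
    MvPolynomial (Fin (n + 1)) k ≃ₐ[k] MvPolynomial (Fin (n + 1)) k :=
  AlgEquiv.ofAlgHom (nagataHom b 1) (nagataHom b (-1))
  (nagataHom_comp_neg b 1) (by simpa using nagataHom_comp_neg (n := n) b (-1 : k))

theorem finSuccEquiv_nagata_X {b : ℕ} (hb : b ≠ 0) (i : Fin (n + 1)) :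
    (finSuccEquiv k n (nagataEquiv b (X i))).Monic ∧
      (finSuccEquiv k n (nagataEquiv b (X i))).natDegree = b ^ (i : ℕ) := by
  have h : nagataEquiv b (X i : MvPolynomial (Fin (n + 1)) k) =
      if i = 0 then X 0 else X i + (1 : k) • X 0 ^ b ^ (i : ℕ) := by
    simp [nagataEquiv, nagataHom]
  rw [h]
  cases i using Fin.cases with
  | zero => simp [finSuccEquiv_X_zero, Polynomial.monic_X]
  | succ j =>
    have hpos : b ^ ((j.succ : Fin (n + 1)) : ℕ) ≠ 0 := pow_ne_zero _ hb
    simp only [Fin.succ_ne_zero, if_false, one_smul, map_add, map_pow, finSuccEquiv_X_succ,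
      finSuccEquiv_X_zero]
    rw [add_comm]
    exact ⟨Polynomial.monic_X_pow_add_C _ hpos, Polynomial.natDegree_X_pow_add_C⟩

theorem finSuccEquiv_nagata_monomial {b : ℕ} (hb : b ≠ 0) (v : Fin (n + 1) →₀ ℕ) {a : k}
    (ha : a ≠ 0) :
    (finSuccEquiv k n (nagataEquiv b (monomial v a))).leadingCoeff = C a ∧
      (finSuccEquiv k n (nagataEquiv b (monomial v a))).natDegree =
        ∑ i : Fin (n + 1), b ^ (i : ℕ) * v i := by
  have h : finSuccEquiv k n (nagataEquiv b (monomial v a)) = Polynomial.C (C a) *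
      ∏ i, finSuccEquiv k n (nagataEquiv b (X i)) ^ v i := by
    have hC : nagataEquiv b (C a : MvPolynomial (Fin (n + 1)) k) = C a :=
      (nagataEquiv (n := n) b).commutes a
    have hC' : finSuccEquiv k n (C a) = Polynomial.C (C a) := by
      simp [finSuccEquiv_apply]
    rw [monomial_eq, Finsupp.prod_fintype _ _ (fun i => pow_zero _), map_mul, map_mul, hC, hC']
    simp only [map_prod, map_pow]
  have hm : (∏ i, finSuccEquiv k n (nagataEquiv b (X i)) ^ v i).Monic :=
    Polynomial.monic_prod_of_monic _ _ fun i _ => (finSuccEquiv_nagata_X hb i).1.pow _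
  rw [h]
  refine ⟨by rw [Polynomial.leadingCoeff_mul_monic hm, Polynomial.leadingCoeff_C], ?_⟩
  rw [Polynomial.natDegree_C_mul (by simpa using ha), Polynomial.natDegree_prod_of_monic _ _
    fun i _ => (finSuccEquiv_nagata_X hb i).1.pow _]
  refine Finset.sum_congr rfl fun i _ => ?_
  rw [(finSuccEquiv_nagata_X hb i).1.natDegree_pow, (finSuccEquiv_nagata_X hb i).2, mul_comm]

theorem sum_pow_mul_injOn {b : ℕ} (hb : 1 < b) {v w : Fin (n + 1) →₀ ℕ} (hv : ∀ i, v i < b)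
    (hw : ∀ i, w i < b) (h : ∑ i : Fin (n + 1), b ^ (i : ℕ) * v i =
      ∑ i : Fin (n + 1), b ^ (i : ℕ) * w i) : v = w := by
  refine Finsupp.ext <| congrFun <| List.ofFn_inj.mp ?_
  apply Nat.ofDigits_inj_of_len_eq hb (by simp)
  · intro l hl
    obtain ⟨i, rfl⟩ := (List.mem_ofFn' _ _).1 hl
    exact hv i
  · intro l hl
    obtain ⟨i, rfl⟩ := (List.mem_ofFn' _ _).1 hl
    exact hw i
  · simpa only [Nat.ofDigits_eq_sum_mapIdx, List.mapIdx_eq_ofFn, List.get_ofFn, List.length_ofFn,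
      Fin.val_cast, mul_comm, List.sum_ofFn] using! h

/-- Nagata's substitution with a large base makes a nonzero polynomial monic in `X₀`, up to a unit:
distinct monomials acquire distinct degrees in `X₀`. -/
theorem isUnit_leadingCoeff_nagata (f : MvPolynomial (Fin (n + 1)) k) (hf : f ≠ 0) :
    ∃ b, IsUnit (finSuccEquiv k n (nagataEquiv b f)).leadingCoeff := by
  let b := 2 + f.totalDegree
  have hb : b ≠ 0 := by omega
  let D : (Fin (n + 1) →₀ ℕ) → ℕ := fun v => ∑ i : Fin (n + 1), b ^ (i : ℕ) * v i
  obtain ⟨v, hv, hmax⟩ := Finset.exists_max_image f.support D (support_nonempty.mpr hf)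
  have hlt : ∀ w ∈ f.support, ∀ i, w i < b := fun w hw i =>
    (monomial_le_degreeOf i hw).trans_lt ((degreeOf_le_totalDegree f i).trans_lt (by omega))
  have hstrict : ∀ w ∈ f.support, w ≠ v → D w < D v := fun w hw hne =>
    (hmax w hw).lt_of_ne fun h => hne (sum_pow_mul_injOn (by omega) (hlt w hw) (hlt v hv) h)
  let φ : (Fin (n + 1) →₀ ℕ) → Polynomial (MvPolynomial (Fin n) k) := fun w =>
    finSuccEquiv k n (nagataEquiv b (monomial w (coeff w f)))
  have hφ : ∀ w ∈ f.support, (φ w).leadingCoeff = C (coeff w f) ∧ (φ w).natDegree = D w :=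
    fun w hw => finSuccEquiv_nagata_monomial hb w (mem_support_iff.1 hw)
  have hsum : finSuccEquiv k n (nagataEquiv b f) = ∑ w ∈ f.support, φ w := by
    conv_lhs => rw [← f.support_sum_monomial_coeff]
    simp only [map_sum, φ]
  have hcoeff : (∑ w ∈ f.support, φ w).coeff (D v) = C (coeff v f) := by
    rw [Polynomial.finsetSum_coeff, Finset.sum_eq_single_of_mem v hv, ← (hφ v hv).1,
      Polynomial.leadingCoeff, (hφ v hv).2]
    intro w hw hne
    exact Polynomial.coeff_eq_zero_of_natDegree_lt ((hφ w hw).2 ▸ hstrict w hw hne)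
  have hne : coeff v f ≠ 0 := mem_support_iff.1 hv
  have hdeg : (∑ w ∈ f.support, φ w).natDegree = D v :=
    Polynomial.natDegree_eq_of_le_of_coeff_ne_zero
      (Polynomial.natDegree_sum_le_of_forall_le _ _ fun w hw => (hφ w hw).2 ▸ hmax w hw)
      (by rw [hcoeff]; simpa using hne)
  refine ⟨b, ?_⟩
  rw [hsum, Polynomial.leadingCoeff, hdeg, hcoeff]
  exact hne.isUnit.map C

end Nagata

/-- A polynomial that is monic up to a unit is a nonzerodivisor modulo an ideal of constants. -/
theorem mem_map_C_of_monic_mul_mem {A : Type*} [CommRing A] (L : Ideal A) {p g : Polynomial A}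
    (hp : p.Monic) (h : p * g ∈ L.map Polynomial.C) : g ∈ L.map Polynomial.C := by
  have hmap : ∀ q : Polynomial A, q ∈ L.map Polynomial.C ↔ q.map (Ideal.Quotient.mk L) = 0 := by
    intro q
    rw [Ideal.mem_map_C_iff, Polynomial.ext_iff]
    simp [Polynomial.coeff_map, Ideal.Quotient.eq_zero_iff_mem]
  rw [hmap] at h ⊢
  rwa [Polynomial.map_mul, (hp.map _).mul_right_eq_zero_iff] at h

/-- Noether normalization, with a regular sequence of complementary length in the ideal. The
regular sequence consists of polynomials that are monic in one variable after another. -/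
theorem exists_isWeaklyRegular_and_injective {k : Type*} [Field k] : ∀ {N : ℕ}
    (I : Ideal (MvPolynomial (Fin N) k)), I ≠ ⊤ → ∃ (d : ℕ) (rs : List (MvPolynomial (Fin N) k)),
      (∀ a ∈ rs, a ∈ I) ∧ RingTheory.Sequence.IsWeaklyRegular (MvPolynomial (Fin N) k) rs ∧
      d + rs.length = N ∧ ∃ g : MvPolynomial (Fin d) k →ₐ[k] MvPolynomial (Fin N) k ⧸ I,
        Function.Injective g
  | 0, I, hI => by
    have := Ideal.Quotient.nontrivial_iff.2 hI
    refine ⟨0, [], by simp, by simp, by simp, MvPolynomial.aeval fun i => i.elim0, ?_⟩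
    have h := (MvPolynomial.isEmptyAlgEquiv k (Fin 0)).symm.surjective
    refine (injective_iff_map_eq_zero _).2 fun x hx => ?_
    obtain ⟨c, rfl⟩ := h x
    have e : (MvPolynomial.isEmptyAlgEquiv k (Fin 0)).symm c = MvPolynomial.C c := by simp
    rw [e, MvPolynomial.aeval_C, map_eq_zero_iff _ (algebraMap k _).injective] at hx
    rw [hx, map_zero]
  | N + 1, I, hI => by
    have hnt := Ideal.Quotient.nontrivial_iff.2 hI
    by_cases hbot : I = ⊥
    · subst hbot
      exact ⟨N + 1, [], by simp, by simp, by simp, Ideal.Quotient.mkₐ k ⊥,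
        ((Ideal.Quotient.mk_bijective_iff_eq_bot _).2 rfl).1⟩
    obtain ⟨f, hfI, hf0⟩ := Submodule.exists_mem_ne_zero_of_ne_bot hbot
    obtain ⟨b, hb⟩ := isUnit_leadingCoeff_nagata f hf0
    let e : MvPolynomial (Fin (N + 1)) k ≃ₐ[k] Polynomial (MvPolynomial (Fin N) k) :=
      (nagataEquiv b).trans (MvPolynomial.finSuccEquiv k N)
    let p : Polynomial (MvPolynomial (Fin N) k) :=
      Polynomial.C (hb.unit⁻¹ : (MvPolynomial (Fin N) k)ˣ).1 * e f
    have hpm : p.Monic := by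
      have := Polynomial.monic_of_isUnit_leadingCoeff_inv_smul hb
      rwa [Units.smul_def, Polynomial.smul_eq_C_mul] at this
    have hpI : e.symm p ∈ I := by
      simp only [p, map_mul, AlgEquiv.symm_apply_apply]
      exact I.mul_mem_left _ hfI
    -- the induction continues with the contraction of `I` to the polynomials in the other variables
    let ψ : MvPolynomial (Fin N) k →ₐ[k] MvPolynomial (Fin (N + 1)) k ⧸ I :=
      (Ideal.Quotient.mkₐ k I).comp (e.symm.toAlgHom.comp Polynomial.CAlgHom)
    obtain ⟨d, rs, hrsI, hreg, hlen, g, hg⟩ :=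
      exists_isWeaklyRegular_and_injective (RingHom.ker ψ) (RingHom.ker_ne_top _)
    have hrsmap : ∀ a ∈ rs, e.symm (Polynomial.C a) ∈ I := fun a ha =>
      Ideal.Quotient.eq_zero_iff_mem.1 (hrsI a ha)
    have hregX : RingTheory.Sequence.IsWeaklyRegular (Polynomial (MvPolynomial (Fin N) k))
        (rs.map Polynomial.C ++ [p]) := by
      rw [RingTheory.Sequence.isWeaklyRegular_append_iff,
        RingTheory.Sequence.isWeaklyRegular_singleton_iff]
      refine ⟨hreg.of_flat (S := Polynomial (MvPolynomial (Fin N) k)), ?_⟩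
      rw [isSMulRegular_iff_right_eq_zero_of_smul]
      intro x hx
      obtain ⟨x, rfl⟩ := Submodule.Quotient.mk_surjective _ x
      rw [← Submodule.Quotient.mk_smul, Submodule.Quotient.mk_eq_zero] at hx
      rw [Submodule.Quotient.mk_eq_zero]
      rw [smul_eq_mul, Ideal.mul_top, ← Ideal.map_ofList] at hx ⊢
      exact mem_map_C_of_monic_mul_mem _ hpm hx
    refine ⟨d, (rs.map Polynomial.C ++ [p]).map e.symm, ?_, ?_, ?_,
      (Ideal.kerLiftAlg ψ).comp g, (Ideal.kerLiftAlg_injective ψ).comp hg⟩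
    · intro a ha
      simp only [List.map_append, List.map_map, List.mem_append, List.mem_map, List.map_cons,
        List.map_nil, List.mem_singleton] at ha
      rcases ha with ⟨c, hc, rfl⟩ | rfl
      · exact hrsmap c hc
      · exact hpI
    · refine (AddEquiv.isWeaklyRegular_congr (e := e.symm.toAddEquiv) ?_).1 hregX
      rw [List.forall₂_map_right_iff, List.forall₂_same]
      intro a _ x
      exact map_mul e.symm a x
    · simp only [List.map_append, List.map_map, List.length_append, List.length_map, List.length_cons,
        List.length_nil]
      omega

/-- The transcendence degree of a finitely generated domain is the size of some algebraically
independent set of the given generators. -/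
theorem exists_algebraicIndependent_of_adjoin_eq_top {k σ A : Type*} [Field k] [Fintype σ]
    [CommRing A] [IsDomain A] [Algebra k A] (x : σ → A)
    (hadj : Algebra.adjoin k (Set.range x) = ⊤) : ∃ B : Finset σ,
      AlgebraicIndependent k (fun i : B => x i) ∧ Algebra.trdeg k A = B.card := by
  classical
  have halg : Algebra.IsAlgebraic (Algebra.adjoin k (Set.range x)) A := by
    rw [hadj]
    exact ⟨fun a => isAlgebraic_algebraMap (⟨a, trivial⟩ : (⊤ : Subalgebra k A))⟩
  obtain ⟨t, ht, htb⟩ := exists_isTranscendenceBasis_subset (R := k) (Set.range x)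
  choose s hs using fun a : t => ht a.2
  have htfin : t.Finite := (Set.finite_range x).subset ht
  have : Fintype t := htfin.fintype
  have hinj : Function.Injective s := fun a b h => Subtype.ext (by rw [← hs a, ← hs b, h])
  obtain ⟨B, hB⟩ : ∃ B : Finset σ, B = Finset.univ.image s := ⟨_, rfl⟩
  have hBs : ∀ i : B, ∃ a : t, s a = i := fun i => by
    simpa using (hB ▸ i.2 : (i : σ) ∈ Finset.univ.image s)
  choose r hr using hBs
  have hxr : (fun i : B => x i) = (fun a : t => (a : A)) ∘ r := by
    funext i
    simp only [Function.comp_apply, ← hr i, hs]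
  refine ⟨B, ?_, ?_⟩
  · rw [hxr]
    exact htb.1.comp _ fun i j hij => Subtype.ext (by rw [← hr i, ← hr j, hij])
  · rw [← htb.cardinalMk_eq_trdeg, hB, Finset.card_image_of_injective _ hinj, Finset.card_univ,
      Cardinal.mk_fintype]

/-- The transcendence degree of the coordinate ring of an irreducible variety is the size of some
algebraically independent set of coordinate functions. -/
theorem exists_algebraicIndependent_X {k σ : Type*} [Field k] [Fintype σ]
    (p : Ideal (MvPolynomial σ k)) [p.IsPrime] : ∃ B : Finset σ,
      AlgebraicIndependent k (fun i : B => Ideal.Quotient.mk p (MvPolynomial.X (i : σ))) ∧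
      Algebra.trdeg k (MvPolynomial σ k ⧸ p) = B.card := by
  refine exists_algebraicIndependent_of_adjoin_eq_top
    (fun i => Ideal.Quotient.mk p (MvPolynomial.X i)) ?_
  have h1 : (Set.range fun i => Ideal.Quotient.mk p (MvPolynomial.X i)) =
      (Ideal.Quotient.mkₐ k p) '' Set.range MvPolynomial.X := by
    rw [← Set.range_comp]; rfl
  rw [h1, ← AlgHom.map_adjoin, MvPolynomial.adjoin_range_X, Algebra.map_top,
    AlgHom.range_eq_top]
  exact Ideal.Quotient.mkₐ_surjective k p

/-- An ideal of a polynomial ring all of whose prime divisors have transcendence degree at most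
`card σ - n` contains a weakly regular sequence of length at least `n`. -/
theorem exists_isWeaklyRegular_of_trdeg_le {k σ : Type*} [Field k] [Fintype σ]
    (I : Ideal (MvPolynomial σ k)) (n : ℕ)
    (h : ∀ p : Ideal (MvPolynomial σ k), p.IsPrime → I ≤ p → ∀ B : Finset σ,
      AlgebraicIndependent k (fun i : B => Ideal.Quotient.mk p (MvPolynomial.X (i : σ))) →
        B.card + n ≤ Fintype.card σ) :
    ∃ rs : List (MvPolynomial σ k), (∀ a ∈ rs, a ∈ I) ∧
      RingTheory.Sequence.IsWeaklyRegular (MvPolynomial σ k) rs ∧ n ≤ rs.length := by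
  by_cases hI : I = ⊤
  · refine ⟨List.replicate n 1, fun a _ => hI ▸ Submodule.mem_top, ?_, by simp⟩
    suffices H : ∀ (M : Type _) [AddCommGroup M] [Module (MvPolynomial σ k) M],
        RingTheory.Sequence.IsWeaklyRegular M (List.replicate n (1 : MvPolynomial σ k)) from H _
    clear h
    induction n with
    | zero => intro M _ _; simp
    | succ n ih =>
      intro M _ _
      rw [List.replicate_succ, RingTheory.Sequence.isWeaklyRegular_cons_iff]
      exact ⟨IsSMulRegular.one M, ih _⟩
  -- Noether normalization in numbered variables
  let e : MvPolynomial σ k ≃ₐ[k] MvPolynomial (Fin (Fintype.card σ)) k :=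
    MvPolynomial.renameEquiv k (Fintype.equivFin σ)
  let J : Ideal (MvPolynomial (Fin (Fintype.card σ)) k) := I.comap e.symm
  have hJ : J ≠ ⊤ := by
    intro hJ
    rw [Ideal.eq_top_iff_one] at hJ hI
    exact hI (by simpa [J] using hJ)
  obtain ⟨d, rs, hrsJ, hreg, hlen, g, hg⟩ := exists_isWeaklyRegular_and_injective J hJ
  refine ⟨rs.map e.symm, ?_, ?_, ?_⟩
  · intro a ha
    obtain ⟨b, hb, rfl⟩ := List.mem_map.1 ha
    exact hrsJ b hb
  · refine (AddEquiv.isWeaklyRegular_congr (e := e.symm.toAddEquiv) ?_).1 hreg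
    rw [List.forall₂_map_right_iff, List.forall₂_same]
    exact fun a _ x => map_mul e.symm a x
  · rw [List.length_map]
    let φ : MvPolynomial (Fin (Fintype.card σ)) k ⧸ J →ₐ[k] MvPolynomial σ k ⧸ I :=
      Ideal.quotientMapₐ I e.symm.toAlgHom le_rfl
    have hφ : Function.Injective φ := Ideal.quotientMap_injective
    -- a prime of `k[σ] / I` over the zero ideal of `k[y₁, …, y_d]`
    obtain ⟨q, hq, hqbot⟩ := Ideal.exists_comap_eq_of_mem_minimalPrimes_of_injective
      (f := (φ.comp g).toRingHom) (hφ.comp hg) ⊥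
      (by rw [IsDomain.minimalPrimes_eq_singleton_bot]; rfl)
    let p : Ideal (MvPolynomial σ k) := q.comap (Ideal.Quotient.mk I)
    have hp : p.IsPrime := Ideal.comap_isPrime _ _
    have hIp : I ≤ p := fun a ha => by
      simp only [p, Ideal.mem_comap, Ideal.Quotient.eq_zero_iff_mem.2 ha, zero_mem]
    let ψ : MvPolynomial (Fin d) k →ₐ[k] MvPolynomial σ k ⧸ p :=
      (Ideal.Quotient.factorₐ k hIp).comp (φ.comp g)
    have hψ : Function.Injective ψ := by
      rw [injective_iff_map_eq_zero]
      intro y hy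
      obtain ⟨w, hw⟩ := Ideal.Quotient.mk_surjective (φ (g y))
      have hw' : Ideal.Quotient.mk p w = 0 := by
        have : ψ y = Ideal.Quotient.factorₐ k hIp (φ (g y)) := rfl
        rw [hy, ← hw] at this
        exact this.symm
      have hyq : φ (g y) ∈ q := hw ▸ (Ideal.Quotient.eq_zero_iff_mem.1 hw' : w ∈ p)
      have : y ∈ q.comap (φ.comp g).toRingHom := hyq
      rwa [hqbot] at this
    obtain ⟨B, hB, hBcard⟩ := exists_algebraicIndependent_X p
    have h1 := h p hp hIp B hB
    have h2 : AlgebraicIndependent k fun i : Fin d => ψ (MvPolynomial.X i) := by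
      rw [algebraicIndependent_iff_injective_aeval]
      convert hψ
      ext i
      simp
    have h3 := h2.lift_cardinalMk_le_trdeg
    rw [hBcard] at h3
    have h4 : d ≤ B.card := by
      simpa using h3
    omega

/-! ### Invariant monomials on the Cox space -/

section Orbits

variable {n : ℕ} {Δ : Set (Set (Fin n → ℝ))} [Fintype (Ray Δ)]

theorem eval_coneMonomial_ne_zero_iff {σ : Set (Fin n → ℝ)} {x : Ray Δ → ℂ} :
    MvPolynomial.eval x (coneMonomial Δ σ) ≠ 0 ↔ ∀ ρ : Ray Δ, toReal ρ.gen ∉ σ → x ρ ≠ 0 := by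
  classical
  rw [coneMonomial, map_prod, Finset.prod_ne_zero_iff]
  refine forall_congr' fun ρ => ?_
  by_cases h : toReal ρ.gen ∈ σ <;> simp [h]

theorem mem_exceptionalSet_iff {x : Ray Δ → ℂ} :
    x ∈ exceptionalSet Δ ↔
      ∀ σ ∈ Δ, coneDim σ = n → ∃ ρ : Ray Δ, toReal ρ.gen ∉ σ ∧ x ρ = 0 := by
  rw [exceptionalSet, irrelevantIdeal, MvPolynomial.zeroLocus_span]
  simp only [Set.mem_ofPred_eq, Set.forall_mem_image, MvPolynomial.aeval_eq_eval, and_imp]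
  refine forall_congr' fun σ => forall_congr' fun _ => forall_congr' fun _ => ?_
  rw [← not_iff_not, ← ne_eq, eval_coneMonomial_ne_zero_iff]
  push Not
  rfl

/-- The exceptional set is a union of coordinate subspaces. -/
theorem mem_exceptionalSet_of_zeros {x y : Ray Δ → ℂ} (h : ∀ ρ, x ρ = 0 → y ρ = 0)
    (hx : x ∈ exceptionalSet Δ) : y ∈ exceptionalSet Δ := by
  rw [mem_exceptionalSet_iff] at hx ⊢
  intro σ hσ hd
  obtain ⟨ρ, h1, h2⟩ := hx σ hσ hd
  exact ⟨ρ, h1, h ρ h2⟩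

/-- The value of the character `m` at a point of the Cox space: the Laurent monomial
`∏ x_ρ ^ ⟨u_ρ, m⟩`, which is invariant under the group. It is used only at points at which no
coordinate with a negative exponent vanishes. -/
noncomputable def charValue (m : Fin n → ℤ) (x : Ray Δ → ℂ) : ℂ := ∏ ρ, x ρ ^ (ρ.gen ⬝ᵥ m)

theorem charValue_eq_of_mem_orbit (m : Fin n → ℤ) {x y : CoxSpace Δ} (h : y ∈ orbit x) :
    charValue m y.1 = charValue m x.1 := by
  obtain ⟨g, hg, hy⟩ := h
  have hg1 : ∏ ρ : Ray Δ, (g ρ) ^ (ρ.gen ⬝ᵥ m) = 1 := by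
    have h1 : ∀ ρ : Ray Δ, (g ρ) ^ (ρ.gen ⬝ᵥ m) = ∏ j, ((g ρ) ^ (ρ.gen j)) ^ (m j) := by
      intro ρ
      simp_rw [dotProduct, ← zpow_mul]
      exact (map_sum (zmultiplesHom (Additive ℂˣ) (Additive.ofMul (g ρ)))
        (fun j => ρ.gen j * m j) Finset.univ)
    simp_rw [h1]
    rw [Finset.prod_comm]
    refine Finset.prod_eq_one fun j _ => ?_
    rw [Finset.prod_zpow, hg j, one_zpow]
  have hg2 : ∏ ρ : Ray Δ, ((g ρ : ℂ)) ^ (ρ.gen ⬝ᵥ m) = 1 := by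
    have := congrArg (Units.val) hg1
    simpa [Units.coe_prod] using this
  simp only [charValue, hy, mul_zpow, Finset.prod_mul_distrib, hg2, one_mul]

theorem self_mem_orbit (x : CoxSpace Δ) : x ∈ orbit x :=
  ⟨1, by simp [coxGroup], by simp⟩

theorem eq_zero_of_mem_closure_orbit {y z : CoxSpace Δ} (h : z ∈ closure (orbit y)) {ρ : Ray Δ}
    (hy : y.1 ρ = 0) : z.1 ρ = 0 := by
  have hc : IsClosed {w : CoxSpace Δ | w.1 ρ = 0} :=
    isClosed_eq ((continuous_apply ρ).comp continuous_subtype_val) continuous_const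
  refine closure_minimal ?_ hc h
  rintro w ⟨g, -, hw⟩
  simp [hw ρ, hy]

theorem charValue_eq_of_mem_closure_orbit {m : Fin n → ℤ} {y z : CoxSpace Δ}
    (h : z ∈ closure (orbit y)) (hm : ∀ ρ : Ray Δ, z.1 ρ ≠ 0 ∨ 0 ≤ ρ.gen ⬝ᵥ m) :
    charValue m z.1 = charValue m y.1 := by
  have hcont : ContinuousAt (fun w : CoxSpace Δ => charValue m w.1) z := by
    unfold charValue
    refine tendsto_finsetProd _ fun ρ _ => ContinuousAt.zpow₀ ?_ _ (hm ρ)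
    exact ((continuous_apply ρ).comp continuous_subtype_val).continuousAt
  have := mem_closure_iff_nhdsWithin_neBot.1 h
  have h1 : Filter.Tendsto (fun w : CoxSpace Δ => charValue m w.1) (nhdsWithin z (orbit y))
      (nhds (charValue m z.1)) := hcont.tendsto.mono_left nhdsWithin_le_nhds
  have h2 : Filter.Tendsto (fun w : CoxSpace Δ => charValue m w.1) (nhdsWithin z (orbit y))
      (nhds (charValue m y.1)) := by
    refine tendsto_const_nhds.congr' ?_
    filter_upwards [self_mem_nhdsWithin] with w hw
    exact (charValue_eq_of_mem_orbit m hw).symm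
  exact tendsto_nhds_unique h1 h2

end Orbits

/-- Linearly independent lattice vectors admit integral dual vectors, up to positive factors. -/
theorem exists_dual_of_linearIndependent {n : ℕ} {ι : Type*} [Finite ι] {u : ι → Fin n → ℤ}
    (h : LinearIndependent ℝ fun i => toReal (u i)) (i₀ : ι) :
    ∃ m : Fin n → ℤ, 0 < u i₀ ⬝ᵥ m ∧ ∀ i, i ≠ i₀ → u i ⬝ᵥ m = 0 := by
  classical
  let w : ι → Fin n → ℚ := fun i j => (u i j : ℚ)
  let T : (Fin n → ℚ) →ₗ[ℚ] (Fin n → ℝ) :=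
    LinearMap.pi fun j => (Algebra.linearMap ℚ ℝ).comp (LinearMap.proj j)
  have hw : LinearIndependent ℚ w := by
    have h1 : LinearIndependent ℚ fun i => toReal (u i) :=
      h.restrict_scalars (fun a b hab => by simpa [Rat.smul_def] using hab)
    refine LinearIndependent.of_comp T ?_
    convert h1 using 2 with i
    funext j
    simp [T, w, toReal]
  obtain ⟨g, hg⟩ : ∃ g : (Fin n → ℚ) →ₗ[ℚ] ℚ, ∀ i, g (w i) = if i = i₀ then 1 else 0 := by
    let b := Module.Basis.extend hw.linearIndepOn_id
    refine ⟨b.constr ℚ fun v => if (v : Fin n → ℚ) = w i₀ then 1 else 0, fun i => ?_⟩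
    have hmem : w i ∈ hw.linearIndepOn_id.extend (Set.subset_univ _) :=
      hw.linearIndepOn_id.subset_extend _ ⟨i, rfl⟩
    have hb : b ⟨w i, hmem⟩ = w i := by simp [b]
    rw [← hb, Module.Basis.constr_basis]
    simp [hw.injective.eq_iff]
  obtain ⟨b, hb⟩ := IsLocalization.exist_integer_multiples_of_finite (nonZeroDivisors ℤ)
    (fun j => g (Pi.single j 1))
  choose m hm using hb
  have hgm : ∀ i, ((u i ⬝ᵥ m : ℤ) : ℚ) = (b : ℤ) * if i = i₀ then 1 else 0 := by
    intro i
    rw [← hg i]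
    have h1 : w i = ∑ j, w i j • Pi.single j (1 : ℚ) := by
      funext l
      simp [Finset.sum_apply, Pi.single_apply]
    have h2 : g (w i) = ∑ j, (u i j : ℚ) * g (Pi.single j 1) := by
      rw [h1, map_sum]
      simp [w]
    rw [h2, Finset.mul_sum, dotProduct, Int.cast_sum]
    refine Finset.sum_congr rfl fun j _ => ?_
    have h3 : (m j : ℚ) = (b : ℤ) * g (Pi.single j 1) := by
      simpa using hm j
    rw [Int.cast_mul, h3]
    ring
  have hb0 : (b : ℤ) ≠ 0 := nonZeroDivisors.ne_zero b.2
  have hgm' : ∀ i, u i ⬝ᵥ m = (b : ℤ) * if i = i₀ then 1 else 0 := by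
    intro i
    have := hgm i
    exact_mod_cast this
  refine ⟨(b : ℤ) • m, ?_, fun i hi => ?_⟩
  · rw [dotProduct_smul, hgm', if_pos rfl, smul_eq_mul, mul_one]
    exact mul_self_pos.2 hb0
  · rw [dotProduct_smul, hgm', if_neg hi]; simp

section Orbits

variable {n : ℕ} {Δ : Set (Set (Fin n → ℝ))} [Fintype (Ray Δ)]

/-- In the chart of a simplicial cone, the points of the closure of an orbit have the same vanishing
coordinates as the orbit. -/
theorem eq_zero_iff_of_mem_closure_orbit {σ : Set (Fin n → ℝ)} (hσ : IsSimplicialCone Δ σ)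
    {y z : CoxSpace Δ} (h : z ∈ closure (orbit y))
    (hz : ∀ ρ : Ray Δ, toReal ρ.gen ∉ σ → z.1 ρ ≠ 0) (ρ : Ray Δ) : y.1 ρ = 0 ↔ z.1 ρ = 0 := by
  refine ⟨eq_zero_of_mem_closure_orbit h, fun hρ => ?_⟩
  have hρσ : toReal ρ.gen ∈ σ := by
    by_contra hn
    exact hz ρ hn hρ
  obtain ⟨m, hm0, hm⟩ := exists_dual_of_linearIndependent
    (u := fun ρ : {ρ : Ray Δ // toReal ρ.gen ∈ σ} => ρ.1.gen) hσ ⟨ρ, hρσ⟩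
  have hm' : ∀ ρ' : Ray Δ, toReal ρ'.gen ∈ σ → ρ' ≠ ρ → ρ'.gen ⬝ᵥ m = 0 := fun ρ' h1 h2 =>
    hm ⟨ρ', h1⟩ fun h3 => h2 (congrArg Subtype.val h3)
  have hval := charValue_eq_of_mem_closure_orbit (m := m) h (fun ρ' => by
    by_cases h1 : toReal ρ'.gen ∈ σ
    · right
      by_cases h2 : ρ' = ρ
      · rw [h2]; exact hm0.le
      · exact (hm' ρ' h1 h2).ge
    · exact Or.inl (hz ρ' h1))
  have h0 : charValue m z.1 = 0 :=
    Finset.prod_eq_zero (Finset.mem_univ ρ) (by rw [hρ]; exact zero_zpow _ hm0.ne')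
  rw [h0] at hval
  obtain ⟨ρ', -, hρ'⟩ := Finset.prod_eq_zero_iff.1 hval.symm
  have hy' : y.1 ρ' = 0 := by
    by_contra hne
    exact zpow_ne_zero _ hne hρ'
  by_cases h2 : ρ' = ρ
  · rwa [← h2]
  · exfalso
    have h1 : toReal ρ'.gen ∈ σ := by
      by_contra hn
      exact hz ρ' hn (eq_zero_of_mem_closure_orbit h hy')
    rw [hm' ρ' h1 h2, zpow_zero] at hρ'
    exact one_ne_zero hρ'

/-- Over the simplicial part, points with the same image in `X` have the same vanishing coordinates
and the same values of all characters that are defined at them. -/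
theorem zeros_and_charValue_eq_of_proj_eq {y y' : CoxSpace Δ} (h : proj y = proj y')
    (hU : proj y ∈ simplicialPart Δ) : (∀ ρ, y.1 ρ = 0 ↔ y'.1 ρ = 0) ∧
      ∀ m : Fin n → ℤ, (∀ ρ : Ray Δ, y.1 ρ = 0 → ρ.gen ⬝ᵥ m = 0) →
        charValue m y.1 = charValue m y'.1 := by
  have hrel := Quot.eqvGen_exact h
  clear h
  induction hrel with
  | rel x y hxy =>
    obtain ⟨z, hzx, hzy⟩ := hxy
    -- `z` lies over the same point, hence in the chart of a simplicial cone
    have hz : proj z = proj x :=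
      Quot.sound ⟨z, subset_closure (self_mem_orbit z), hzx⟩
    obtain ⟨σ, -, hσ, hne⟩ := hU z hz
    rw [eval_coneMonomial_ne_zero_iff] at hne
    have h1 := eq_zero_iff_of_mem_closure_orbit hσ hzx hne
    have h2 := eq_zero_iff_of_mem_closure_orbit hσ hzy hne
    refine ⟨fun ρ => (h1 ρ).trans (h2 ρ).symm, fun m hm => ?_⟩
    have h3 : ∀ ρ : Ray Δ, z.1 ρ ≠ 0 ∨ 0 ≤ ρ.gen ⬝ᵥ m := fun ρ => by
      by_cases h : z.1 ρ = 0
      · exact Or.inr (hm ρ ((h1 ρ).2 h)).ge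
      · exact Or.inl h
    rw [← charValue_eq_of_mem_closure_orbit hzx h3, charValue_eq_of_mem_closure_orbit hzy h3]
  | refl x => exact ⟨fun _ => Iff.rfl, fun _ _ => rfl⟩
  | symm x y hxy ih =>
    have hxy' : proj x = proj y := Quot.eqvGen_sound hxy
    obtain ⟨h1, h2⟩ := ih (hxy' ▸ hU)
    exact ⟨fun ρ => (h1 ρ).symm, fun m hm => (h2 m fun ρ hρ => hm ρ ((h1 ρ).1 hρ)).symm⟩
  | trans x y z hxy hyz ih1 ih2 =>
    have hxy' : proj x = proj y := Quot.eqvGen_sound hxy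
    obtain ⟨h1, h2⟩ := ih1 hU
    obtain ⟨h3, h4⟩ := ih2 (hxy' ▸ hU)
    exact ⟨fun ρ => (h1 ρ).trans (h3 ρ), fun m hm =>
      (h2 m hm).trans (h4 m fun ρ hρ => hm ρ ((h1 ρ).2 hρ))⟩

end Orbits

/-! ### The dimension of the zero set in the Cox space -/

section Primes

open MvPolynomial

/-- A binomial relation between algebraically independent coordinate functions is trivial. -/
theorem eq_of_binomial_mem {k σ : Type*} [Field k] {p : Ideal (MvPolynomial σ k)} {B : Set σ}
    (hB : AlgebraicIndependent k fun i : B => Ideal.Quotient.mk p (X (i : σ)))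
    {d e : σ →₀ ℕ} (hd : ∀ i ∉ B, d i = 0) (he : ∀ i ∉ B, e i = 0) {c : k}
    (h : monomial d 1 - C c * monomial e 1 ∈ p) : d = e := by
  classical
  have key : ∀ d : σ →₀ ℕ, (∀ i ∉ B, d i = 0) → ∃ d' : B →₀ ℕ, d = d'.mapDomain Subtype.val := by
    intro d hd
    refine ⟨d.comapDomain Subtype.val Subtype.val_injective.injOn, ?_⟩
    rw [Finsupp.mapDomain_comapDomain _ Subtype.val_injective]
    intro i hi
    have : i ∈ B := by
      by_contra hn
      exact (Finsupp.mem_support_iff.1 hi) (hd i hn)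
    simpa using this
  obtain ⟨d', rfl⟩ := key d hd
  obtain ⟨e', rfl⟩ := key e he
  have h0 : (monomial d' 1 - C c * monomial e' 1 : MvPolynomial B k) = 0 := by
    refine algebraicIndependent_iff.1 hB _ ?_
    have h1 : (aeval fun i : B => Ideal.Quotient.mk p (X (i : σ))) =
        (Ideal.Quotient.mkₐ k p).comp (rename Subtype.val) := by
      ext i
      simp
    rw [h1, AlgHom.comp_apply, map_sub, map_mul, rename_monomial, rename_monomial, rename_C]
    exact Ideal.Quotient.eq_zero_iff_mem.2 h
  have h1 := congrArg (coeff d') h0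
  rw [coeff_sub, coeff_C_mul, coeff_monomial, coeff_monomial, if_pos rfl, coeff_zero] at h1
  by_cases hde : e' = d'
  · rw [hde]
  · rw [if_neg hde] at h1
    simp at h1

variable {n : ℕ} {Δ : Set (Set (Fin n → ℝ))} [Fintype (Ray Δ)]

/-- The exponent vector of the numerator of the Laurent monomial of a character; the denominator is
the numerator for the opposite character. -/
noncomputable def charNum (m : Fin n → ℤ) : Ray Δ →₀ ℕ :=
  Finsupp.equivFunOnFinite.symm fun ρ => (ρ.gen ⬝ᵥ m).toNat

theorem charNum_apply (m : Fin n → ℤ) (ρ : Ray Δ) : charNum m ρ = (ρ.gen ⬝ᵥ m).toNat := rfl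

theorem eval_monomial_charNum {m : Fin n → ℤ} {y : Ray Δ → ℂ}
    (hy : ∀ ρ : Ray Δ, y ρ = 0 → ρ.gen ⬝ᵥ m = 0) :
    eval y (monomial (charNum m) 1) = charValue m y * eval y (monomial (charNum (-m)) 1) := by
  rw [eval_monomial, eval_monomial, one_mul, one_mul, Finsupp.prod_fintype _ _ (by simp),
    Finsupp.prod_fintype _ _ (by simp), charValue, ← Finset.prod_mul_distrib]
  refine Finset.prod_congr rfl fun ρ _ => ?_
  rw [charNum_apply, charNum_apply, dotProduct_neg]
  by_cases h : y ρ = 0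
  · simp [hy ρ h]
  · rw [← zpow_natCast, ← zpow_natCast, ← zpow_add₀ h]
    congr 1
    omega

/-- A coordinate subspace that is contained in the exceptional set has codimension at least
`codim Z`. -/
theorem le_card_of_mem_exceptionalSet (T : Finset (Ray Δ))
    (h : ∀ y : Ray Δ → ℂ, (∀ ρ ∈ T, y ρ = 0) → y ∈ exceptionalSet Δ) :
    codimExceptionalSet Δ ≤ T.card := by
  classical
  let J : Ideal (CoxRing Δ) := Ideal.span ((T.image X : Finset (CoxRing Δ)) : Set (CoxRing Δ))
  have hJ : J ≠ ⊤ := by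
    intro hJ
    have h1 : (1 : CoxRing Δ) ∈ J := hJ ▸ Submodule.mem_top
    have h2 : J ≤ RingHom.ker (eval (0 : Ray Δ → ℂ)) := by
      rw [Ideal.span_le]
      intro a ha
      obtain ⟨i, -, rfl⟩ := Finset.mem_image.1 (Finset.mem_coe.1 ha)
      simp [RingHom.mem_ker]
    have := h2 h1
    simp [RingHom.mem_ker] at this
  obtain ⟨q, hq⟩ := Ideal.nonempty_minimalPrimes hJ
  have hle : vanishingIdeal ℂ (exceptionalSet Δ) ≤ q := by
    have h1 : zeroLocus ℂ J ⊆ exceptionalSet Δ := by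
      intro y hy
      refine h y fun ρ hρ => ?_
      have := (mem_zeroLocus_iff.1 hy) (X ρ)
        (Ideal.subset_span (Finset.mem_coe.2 (Finset.mem_image_of_mem _ hρ)))
      simpa using this
    refine (vanishingIdeal_anti_mono h1).trans ?_
    rw [vanishingIdeal_zeroLocus_eq_radical]
    exact hq.1.1.radical_le_iff.2 hq.1.2
  refine (Ideal.height_mono hle).trans
    ((Ideal.height_le_card_of_mem_minimalPrimes_span_finset hq).trans ?_)
  exact_mod_cast Finset.card_image_le

/-- On the part of `V(p)` on which precisely the variables in `p` vanish, a character takes finitely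
many values, as its value depends on the image in the finite set `V_X(I)` only. By the
Nullstellensatz and the irreducibility of `V(p)`, it is constant there. -/
theorem exists_binomial_mem {I : Ideal (CoxRing Δ)} (hfin : (zeroSet I).Finite)
    (hU : zeroSet I ⊆ simplicialPart Δ) {p : Ideal (CoxRing Δ)} (hp : p.IsPrime) (hIp : I ≤ p)
    (hZ : ∀ y : Ray Δ → ℂ, (∀ ρ, y ρ = 0 ↔ X ρ ∈ p) → y ∉ exceptionalSet Δ) {m : Fin n → ℤ}
    (hm : ∀ ρ : Ray Δ, X ρ ∈ p → ρ.gen ⬝ᵥ m = 0) :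
    ∃ c : ℂ, monomial (charNum m) 1 - C c * monomial (charNum (-m)) 1 ∈ p := by
  classical
  let V : Set (CoxSpace Δ) := {y | (∀ h ∈ p, eval y.1 h = 0) ∧ ∀ ρ, y.1 ρ = 0 ↔ X ρ ∈ p}
  have hVI : ∀ y ∈ V, proj y ∈ zeroSet I := fun y hy => ⟨y, rfl, fun h hh => hy.1 h (hIp hh)⟩
  have hCfin : ((fun y : CoxSpace Δ => charValue m y.1) '' V).Finite := by
    let F : ToricVariety Δ → ℂ := fun q =>
      if h : ∃ y : CoxSpace Δ, y ∈ V ∧ proj y = q then charValue m h.choose.1 else 0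
    refine (hfin.image F).subset ?_
    rintro _ ⟨y, hy, rfl⟩
    refine ⟨proj y, hVI y hy, ?_⟩
    have h : ∃ y' : CoxSpace Δ, y' ∈ V ∧ proj y' = proj y := ⟨y, hy, rfl⟩
    have h1 := h.choose_spec
    have h2 : F (proj y) = charValue m h.choose.1 := dif_pos h
    rw [h2]
    exact (zeros_and_charValue_eq_of_proj_eq h1.2 (hU (hVI _ h1.1))).2 m
      fun ρ hρ => hm ρ ((h1.1.2 ρ).1 hρ)
  let g : CoxRing Δ := (∏ ρ ∈ Finset.univ.filter fun ρ : Ray Δ => X ρ ∉ p, X ρ) *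
    ∏ c ∈ hCfin.toFinset, (monomial (charNum m) 1 - C c * monomial (charNum (-m)) 1)
  have hg : g ∈ p := by
    rw [← MvPolynomial.IsPrime.vanishingIdeal_zeroLocus (K := ℂ) p, mem_vanishingIdeal_iff]
    intro y hy
    rw [mem_zeroLocus_iff] at hy
    simp only [aeval_eq_eval] at hy ⊢
    rw [map_mul, mul_eq_zero, map_prod, map_prod, Finset.prod_eq_zero_iff, Finset.prod_eq_zero_iff]
    by_cases hy0 : ∃ ρ : Ray Δ, X ρ ∉ p ∧ y ρ = 0
    · obtain ⟨ρ, h1, h2⟩ := hy0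
      exact Or.inl ⟨ρ, by simpa using h1, by simpa using h2⟩
    · push Not at hy0
      have hyT : ∀ ρ, y ρ = 0 ↔ X ρ ∈ p := fun ρ =>
        ⟨fun h => by_contra fun hn => hy0 ρ hn h, fun h => by simpa using hy _ h⟩
      refine Or.inr ⟨charValue m y, ?_, ?_⟩
      · exact hCfin.mem_toFinset.2 ⟨⟨y, hZ y hyT⟩, ⟨hy, hyT⟩, rfl⟩
      · rw [map_sub, map_mul, eval_C, eval_monomial_charNum fun ρ hρ => hm ρ ((hyT ρ).1 hρ), sub_self]
  rcases hp.mem_or_mem hg with h | h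
  · obtain ⟨ρ, h1, h2⟩ := (hp.prod_mem_iff).1 h
    exact absurd h2 (Finset.mem_filter.1 h1).2
  · obtain ⟨c, -, h2⟩ := (hp.prod_mem_iff).1 h
    exact ⟨c, h2⟩

/-- If `V_X(I)` is finite and contained in the simplicial part, then every component of the zero set
of `I` in the affine space of the Cox ring has codimension at least `n`. -/
theorem card_add_le_of_algebraicIndependent (hinj : Function.Injective (charDiv Δ))
    {I : Ideal (CoxRing Δ)} (hfin : (zeroSet I).Finite) (hU : zeroSet I ⊆ simplicialPart Δ)
    (hZ : (n : ℕ∞) ≤ codimExceptionalSet Δ) (p : Ideal (CoxRing Δ)) (hp : p.IsPrime) (hIp : I ≤ p)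
    (B : Finset (Ray Δ))
    (hB : AlgebraicIndependent ℂ fun i : B => Ideal.Quotient.mk p (X (i : Ray Δ))) :
    B.card + n ≤ Fintype.card (Ray Δ) := by
  classical
  have hBp : ∀ ρ ∈ B, X ρ ∉ p := fun ρ hρ h =>
    hB.ne_zero ⟨ρ, hρ⟩ (Ideal.Quotient.eq_zero_iff_mem.2 h)
  let T : Finset (Ray Δ) := Finset.univ.filter fun ρ => X ρ ∈ p
  by_cases hT : ∃ y : Ray Δ → ℂ, (∀ ρ, y ρ = 0 ↔ X ρ ∈ p) ∧ y ∈ exceptionalSet Δ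
  · -- the variables in `p` alone force `V(p)` into the exceptional set
    obtain ⟨y, hy, hyZ⟩ := hT
    have h1 : n ≤ T.card := by
      have := hZ.trans (le_card_of_mem_exceptionalSet T fun x hx =>
        mem_exceptionalSet_of_zeros (fun ρ hρ => hx ρ (by simpa [T] using (hy ρ).1 hρ)) hyZ)
      exact_mod_cast this
    have h2 : Disjoint B T := by
      rw [Finset.disjoint_left]
      intro ρ h3 h4
      exact hBp ρ h3 (by simpa [T] using h4)
    have h3 := Finset.card_le_univ (B ∪ T)
    rw [Finset.card_union_of_disjoint h2] at h3
    omega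
  · push Not at hT
    -- the general point of `V(p)` lies over `V_X(I)`
    let L : (Fin n → ℤ) →ₗ[ℤ] ({ρ : Ray Δ // ρ ∉ B} → ℤ) :=
      (LinearMap.funLeft ℤ ℤ Subtype.val).comp (charDiv Δ).toIntLinearMap
    have hL : Function.Injective L := by
      rw [injective_iff_map_eq_zero]
      intro m hm
      have hm0 : ∀ ρ ∉ B, ρ.gen ⬝ᵥ m = 0 := fun ρ hρ => congrFun hm ⟨ρ, hρ⟩
      obtain ⟨c, hc⟩ := exists_binomial_mem hfin hU hp hIp hT
        (fun ρ hρ => hm0 ρ fun h => hBp ρ h hρ)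
      have h1 := eq_of_binomial_mem (B := (B : Set (Ray Δ))) hB
        (fun ρ hρ => by simp [charNum_apply, hm0 ρ hρ])
        (fun ρ hρ => by simp [charNum_apply, hm0 ρ hρ]) hc
      refine hinj ?_
      rw [map_zero]
      funext ρ
      have h2 := DFunLike.congr_fun h1 ρ
      rw [charNum_apply, charNum_apply, dotProduct_neg] at h2
      change ρ.gen ⬝ᵥ m = 0
      omega
    have h1 := LinearMap.finrank_le_finrank_of_injective hL
    rw [Module.finrank_fin_fun, Module.finrank_fintype_fun_eq_card, Fintype.card_subtype_compl,
      Fintype.card_coe] at h1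
    have := Finset.card_le_univ B
    omega

end Primes

/-! ### Cones and rays of the normal fan -/

section Fan

variable {n : ℕ} {A : Finset (Fin n → ℤ)}

theorem mem_normalCone_latticePolytope {v x : Fin n → ℝ} :
    v ∈ normalCone (latticePolytope A) x ↔ ∀ a ∈ A, v ⬝ᵥ x ≤ v ⬝ᵥ toReal a := by
  constructor
  · exact fun h a ha => h _ (subset_convexHull ℝ _ ⟨a, ha, rfl⟩)
  · intro h m hm
    have hconv : Convex ℝ {y : Fin n → ℝ | v ⬝ᵥ x ≤ v ⬝ᵥ y} := by
      refine convex_halfSpace_ge (f := fun y => v ⬝ᵥ y) ⟨fun a b => ?_, fun c a => ?_⟩ _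
      · exact dotProduct_add v a b
      · exact dotProduct_smul c v a
    refine convexHull_min ?_ hconv hm
    rintro _ ⟨a, ha, rfl⟩
    exact h a ha

theorem normalCone_smul {P : Set (Fin n → ℝ)} {x v : Fin n → ℝ} (hv : v ∈ normalCone P x) {c : ℝ}
    (hc : 0 ≤ c) : c • v ∈ normalCone P x := fun m hm => by
  rw [smul_dotProduct, smul_dotProduct]
  exact mul_le_mul_of_nonneg_left (hv m hm) hc

/-- A linear form that is constant on a full-dimensional polytope is zero. -/
theorem eq_zero_of_forall_dotProduct_eq (hA : affineSpan ℝ (latticePolytope A) = ⊤)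
    {v : Fin n → ℝ} {c : ℝ} (h : ∀ a ∈ A, v ⬝ᵥ toReal a = c) : v = 0 := by
  have key : ∀ x : Fin n → ℝ, v ⬝ᵥ x = c := by
    intro x
    have hx : x ∈ affineSpan ℝ (toReal '' (A : Set (Fin n → ℤ))) := by
      rw [← affineSpan_convexHull]
      change x ∈ affineSpan ℝ (latticePolytope A)
      rw [hA]
      trivial
    refine affineSpan_induction (p := fun x => v ⬝ᵥ x = c) hx ?_ ?_
    · rintro _ ⟨a, ha, rfl⟩
      exact h a ha
    · intro r y z w hy hz hw
      simp [dotProduct_add, dotProduct_sub, hy, hz, hw]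
  have h0 : c = 0 := by rw [← key 0, dotProduct_zero]
  exact dotProduct_self_eq_zero.1 ((key v).trans h0)

/-- Moving a point of a normal cone inside the smallest face that contains it, until a further
inequality becomes tight. -/
theorem exists_add_smul_mem_normalCone {p : Fin n → ℤ} {v w : Fin n → ℝ}
    (hv : v ∈ normalCone (latticePolytope A) (toReal p))
    (hw : ∀ a ∈ A, v ⬝ᵥ toReal a = v ⬝ᵥ toReal p → w ⬝ᵥ toReal a = w ⬝ᵥ toReal p)
    (hneg : ∃ a ∈ A, w ⬝ᵥ toReal a < w ⬝ᵥ toReal p) :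
    ∃ t : ℝ, 0 < t ∧ v + t • w ∈ normalCone (latticePolytope A) (toReal p) ∧
      (A.filter fun a => (v + t • w) ⬝ᵥ toReal a ≠ (v + t • w) ⬝ᵥ toReal p).card <
        (A.filter fun a => v ⬝ᵥ toReal a ≠ v ⬝ᵥ toReal p).card := by
  rw [mem_normalCone_latticePolytope] at hv
  obtain ⟨a₀, ha₀, ha₀'⟩ := hneg
  obtain ⟨b, hb, hmin⟩ := Finset.exists_min_image
    (A.filter fun a => w ⬝ᵥ toReal a < w ⬝ᵥ toReal p)
    (fun a => (v ⬝ᵥ toReal a - v ⬝ᵥ toReal p) / (w ⬝ᵥ toReal p - w ⬝ᵥ toReal a))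
    ⟨a₀, Finset.mem_filter.2 ⟨ha₀, ha₀'⟩⟩
  obtain ⟨hbA, hbw⟩ := Finset.mem_filter.1 hb
  have hbv : v ⬝ᵥ toReal b ≠ v ⬝ᵥ toReal p := fun h => hbw.ne (hw b hbA h)
  have hbw' : 0 < w ⬝ᵥ toReal p - w ⬝ᵥ toReal b := sub_pos.2 hbw
  obtain ⟨t, ht⟩ : ∃ t, t = (v ⬝ᵥ toReal b - v ⬝ᵥ toReal p) / (w ⬝ᵥ toReal p - w ⬝ᵥ toReal b) :=
    ⟨_, rfl⟩
  have ht0 : 0 < t := by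
    rw [ht]
    exact div_pos (sub_pos.2 (lt_of_le_of_ne (hv b hbA) hbv.symm)) hbw'
  have htb : t * (w ⬝ᵥ toReal p - w ⬝ᵥ toReal b) = v ⬝ᵥ toReal b - v ⬝ᵥ toReal p := by
    rw [ht, div_mul_cancel₀ _ hbw'.ne']
  refine ⟨t, ht0, ?_, ?_⟩
  · rw [mem_normalCone_latticePolytope]
    intro a ha
    rw [add_dotProduct, add_dotProduct, smul_dotProduct, smul_dotProduct, smul_eq_mul, smul_eq_mul]
    have h1 : t * (w ⬝ᵥ toReal p - w ⬝ᵥ toReal a) ≤ v ⬝ᵥ toReal a - v ⬝ᵥ toReal p := by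
      by_cases h : w ⬝ᵥ toReal a < w ⬝ᵥ toReal p
      · have := hmin a (Finset.mem_filter.2 ⟨ha, h⟩)
        rw [← ht, le_div_iff₀ (sub_pos.2 h)] at this
        exact this
      · have h2 := mul_nonpos_of_nonneg_of_nonpos ht0.le (sub_nonpos.2 (not_lt.1 h))
        linarith [hv a ha]
    linarith
  · refine Finset.card_lt_card ⟨fun a ha => ?_, fun h => ?_⟩
    · rw [Finset.mem_filter] at ha ⊢
      refine ⟨ha.1, fun h => ha.2 ?_⟩
      rw [add_dotProduct, add_dotProduct, smul_dotProduct, smul_dotProduct, hw a ha.1 h, h]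
    · have := (Finset.mem_filter.1 (h (Finset.mem_filter.2 ⟨hbA, hbv⟩))).2
      refine this ?_
      rw [add_dotProduct, add_dotProduct, smul_dotProduct, smul_dotProduct, smul_eq_mul,
        smul_eq_mul]
      linarith

/-- A line that is cut out by equations with integral coefficients is spanned by a primitive lattice
vector. -/
theorem exists_primitive_of_line {D : Set (Fin n → ℤ)} {v : Fin n → ℝ} (hv0 : v ≠ 0)
    (hv : ∀ d ∈ D, v ⬝ᵥ toReal d = 0)
    (hline : ∀ w : Fin n → ℝ, (∀ d ∈ D, w ⬝ᵥ toReal d = 0) → ∃ c : ℝ, w = c • v) :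
    ∃ u : Fin n → ℤ, Finset.univ.gcd u = 1 ∧ ∃ c : ℝ, 0 < c ∧ toReal u = c • v := by
  obtain ⟨j₀, hj₀⟩ := Function.ne_iff.1 hv0
  -- a `ℚ`-linear form on `ℝ` turns `v` into a rational solution of the equations
  obtain ⟨φ, hφ⟩ : ∃ φ : Module.Dual ℚ ℝ, φ (v j₀) ≠ 0 := by
    by_contra! h
    exact hj₀ ((Module.forall_dual_apply_eq_zero_iff ℚ (v j₀)).1 h)
  obtain ⟨b, hb⟩ := IsLocalization.exist_integer_multiples_of_finite (nonZeroDivisors ℤ)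
    (fun j => φ (v j))
  choose u₀ hu₀ using hb
  have hu₀' : ∀ j, (u₀ j : ℚ) = (b : ℤ) * φ (v j) := fun j => by simpa using hu₀ j
  have hb0 : ((b : ℤ) : ℚ) ≠ 0 := by exact_mod_cast nonZeroDivisors.ne_zero b.2
  have hu₀0 : u₀ j₀ ≠ 0 := by
    intro h
    have := hu₀' j₀
    rw [h, Int.cast_zero] at this
    exact (mul_ne_zero hb0 hφ) this.symm
  have hu₀D : ∀ d ∈ D, toReal u₀ ⬝ᵥ toReal d = 0 := by
    intro d hd
    have h1 : ∑ j, (d j : ℚ) * φ (v j) = 0 := by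
      have h2 : φ (∑ j, (d j : ℚ) • v j) = 0 := by
        rw [show ∑ j, (d j : ℚ) • v j = 0 from ?_, map_zero]
        refine Eq.trans (Finset.sum_congr rfl fun j _ => ?_) (hv d hd)
        rw [Rat.smul_def, Rat.cast_intCast, mul_comm]
        rfl
      rw [map_sum] at h2
      simpa using h2
    have h3 : ∑ j, (u₀ j : ℚ) * d j = 0 := by
      simp_rw [hu₀', mul_assoc, ← Finset.mul_sum]
      rw [show ∑ j, φ (v j) * (d j : ℚ) = 0 from ?_, mul_zero]
      rw [← h1]
      exact Finset.sum_congr rfl fun j _ => mul_comm _ _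
    have h4 : ∑ j, u₀ j * d j = 0 := by exact_mod_cast h3
    have h5 : ∑ j, (u₀ j : ℝ) * d j = 0 := by exact_mod_cast h4
    exact h5
  obtain ⟨u, hu, hgcd⟩ := Finset.extract_gcd u₀ ⟨j₀, Finset.mem_univ _⟩
  have hg : toReal u₀ = ((Finset.univ.gcd u₀ : ℤ) : ℝ) • toReal u := by
    funext j
    simp only [toReal, Pi.smul_apply, smul_eq_mul]
    rw [hu j (Finset.mem_univ _)]
    push_cast
    rfl
  have hg0 : ((Finset.univ.gcd u₀ : ℤ) : ℝ) ≠ 0 := by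
    intro h
    have h1 : u₀ j₀ = 0 := Finset.gcd_eq_zero_iff.1 (by exact_mod_cast h) j₀ (Finset.mem_univ _)
    exact hu₀0 h1
  have huD : ∀ d ∈ D, toReal u ⬝ᵥ toReal d = 0 := by
    intro d hd
    have h1 := hu₀D d hd
    rw [hg, smul_dotProduct, smul_eq_mul] at h1
    exact (mul_eq_zero.1 h1).resolve_left hg0
  obtain ⟨c, hc⟩ := hline _ huD
  have hc0 : c ≠ 0 := by
    rintro rfl
    rw [zero_smul] at hc
    rw [hc, smul_zero] at hg
    have := congrFun hg j₀
    simp only [toReal, Pi.zero_apply, Int.cast_eq_zero] at this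
    exact hu₀0 this
  rcases lt_or_gt_of_ne hc0 with h | h
  · refine ⟨-u, ?_, -c, by linarith, ?_⟩
    · rw [← hgcd]
      refine dvd_antisymm_of_normalize_eq Finset.normalize_gcd Finset.normalize_gcd ?_ ?_
      · exact Finset.dvd_gcd fun j hj => by
          have := Finset.gcd_dvd (f := -u) hj
          simpa using this
      · exact Finset.dvd_gcd fun j hj => by
          have := Finset.gcd_dvd (f := u) hj
          simpa using this
    · rw [neg_smul, ← hc]
      funext j; simp [toReal]
  · exact ⟨u, hgcd, c, h, hc⟩

/-- A vector of a normal cone that spans the linear space of the smallest face containing it spans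
a ray of the fan. -/
theorem exists_ray_of_line (hA : affineSpan ℝ (latticePolytope A) = ⊤) {p : Fin n → ℤ} (hp : p ∈ A)
    {v : Fin n → ℝ} (hv : v ∈ normalCone (latticePolytope A) (toReal p)) (hv0 : v ≠ 0)
    (hline : ∀ w : Fin n → ℝ,
      (∀ a ∈ A, v ⬝ᵥ toReal a = v ⬝ᵥ toReal p → w ⬝ᵥ toReal a = w ⬝ᵥ toReal p) →
        ∃ c : ℝ, w = c • v) :
    ∃ (ρ : Ray (normalFan (latticePolytope A))) (c : ℝ), 0 < c ∧ toReal ρ.gen = c • v := by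
  classical
  have hv' := mem_normalCone_latticePolytope.1 hv
  obtain ⟨T, hT⟩ : ∃ T : Finset (Fin n → ℤ), T = A.filter fun a => v ⬝ᵥ toReal a = v ⬝ᵥ toReal p :=
    ⟨_, rfl⟩
  have hpT : p ∈ T := by rw [hT]; exact Finset.mem_filter.2 ⟨hp, rfl⟩
  have hTA : ∀ a ∈ T, a ∈ A ∧ v ⬝ᵥ toReal a = v ⬝ᵥ toReal p := fun a ha => by
    rw [hT] at ha; exact Finset.mem_filter.1 ha
  obtain ⟨u, hu, c, hc, huv⟩ := exists_primitive_of_line (D := {d | ∃ a ∈ T, d = a - p}) hv0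
    (by
      rintro _ ⟨a, ha, rfl⟩
      rw [toReal_sub, dotProduct_sub, (hTA a ha).2, sub_self])
    (by
      intro w hw
      refine hline w fun a ha h => ?_
      have := hw (a - p) ⟨a, by rw [hT]; exact Finset.mem_filter.2 ⟨ha, h⟩, rfl⟩
      rw [toReal_sub, dotProduct_sub] at this
      linarith)
  -- the barycentre of the vertices of the face on which `v` is minimal
  obtain ⟨q, hq⟩ : ∃ q : Fin n → ℝ, q = (T.card : ℝ)⁻¹ • ∑ a ∈ T, toReal a := ⟨_, rfl⟩
  have hT0 : (0 : ℝ) < T.card := by exact_mod_cast Finset.card_pos.2 ⟨p, hpT⟩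
  have hqdot : ∀ w : Fin n → ℝ, (T.card : ℝ) * (w ⬝ᵥ q) = ∑ a ∈ T, w ⬝ᵥ toReal a := by
    intro w
    rw [hq, dotProduct_smul, dotProduct_sum, smul_eq_mul, mul_inv_cancel_left₀ hT0.ne']
  have hqP : q ∈ latticePolytope A := by
    rw [hq, Finset.smul_sum]
    refine (convex_latticePolytope A).sum_mem (fun _ _ => inv_nonneg.2 hT0.le) ?_ ?_
    · rw [Finset.sum_const, nsmul_eq_mul, mul_inv_cancel₀ hT0.ne']
    · exact fun a ha => subset_convexHull ℝ _ ⟨a, (hTA a ha).1, rfl⟩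
  have hcone : normalCone (latticePolytope A) q = raySet u := by
    ext w
    rw [mem_normalCone_latticePolytope]
    constructor
    · intro hw
      have h1 : ∀ a ∈ T, w ⬝ᵥ toReal a = w ⬝ᵥ q := by
        have h2 : ∑ a ∈ T, w ⬝ᵥ q = ∑ a ∈ T, w ⬝ᵥ toReal a := by
          rw [← hqdot, Finset.sum_const, nsmul_eq_mul]
        exact fun a ha => ((Finset.sum_eq_sum_iff_of_le fun a ha => hw a (hTA a ha).1).1 h2 a ha).symm
      obtain ⟨r, hr⟩ := hline w fun a ha h => by
        rw [h1 a (by rw [hT]; exact Finset.mem_filter.2 ⟨ha, h⟩), h1 p hpT]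
      have hr0 : 0 ≤ r := by
        by_contra! hneg
        refine hv0 (eq_zero_of_forall_dotProduct_eq hA (c := v ⬝ᵥ toReal p) fun a ha => ?_)
        refine le_antisymm ?_ (hv' a ha)
        have h2 := hw a ha
        rw [← h1 p hpT, hr, smul_dotProduct, smul_dotProduct, smul_eq_mul, smul_eq_mul] at h2
        exact (mul_le_mul_left_of_neg hneg).1 h2
      refine ⟨r * c⁻¹, mul_nonneg hr0 (inv_nonneg.2 hc.le), ?_⟩
      rw [huv, smul_smul, inv_mul_cancel_right₀ hc.ne', hr]
    · rintro ⟨r, hr, rfl⟩ a ha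
      have h1 : v ⬝ᵥ q = v ⬝ᵥ toReal p := by
        have h2 := hqdot v
        rw [Finset.sum_congr rfl fun a ha => (hTA a ha).2, Finset.sum_const, nsmul_eq_mul] at h2
        exact mul_left_cancel₀ hT0.ne' h2
      rw [huv]
      simp only [smul_dotProduct, smul_eq_mul, h1]
      exact mul_le_mul_of_nonneg_left (mul_le_mul_of_nonneg_left (hv' a ha) hc.le) hr
  exact ⟨⟨u, hu, q, hqP, hcone⟩, c, hc, huv⟩

/-- Every cone of the normal fan is generated by its rays. By duality this means that a linear form
that is nonnegative on the rays is nonnegative on the cone. -/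
theorem dotProduct_nonneg_of_forall_ray (hA : affineSpan ℝ (latticePolytope A) = ⊤) {p : Fin n → ℤ}
    (hp : p ∈ A) {y : Fin n → ℝ}
    (hy : ∀ ρ : Ray (normalFan (latticePolytope A)),
      toReal ρ.gen ∈ normalCone (latticePolytope A) (toReal p) → 0 ≤ toReal ρ.gen ⬝ᵥ y)
    {v : Fin n → ℝ} (hv : v ∈ normalCone (latticePolytope A) (toReal p)) : 0 ≤ v ⬝ᵥ y := by
  induction hN : (A.filter fun a => v ⬝ᵥ toReal a ≠ v ⬝ᵥ toReal p).card
    using Nat.strong_induction_on generalizing v with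
  | _ N ih =>
  subst hN
  by_cases hv0 : v = 0
  · simp [hv0]
  by_cases hline : ∀ w : Fin n → ℝ,
      (∀ a ∈ A, v ⬝ᵥ toReal a = v ⬝ᵥ toReal p → w ⬝ᵥ toReal a = w ⬝ᵥ toReal p) →
        ∃ c : ℝ, w = c • v
  · obtain ⟨ρ, c, hc, hρ⟩ := exists_ray_of_line hA hp hv hv0 hline
    have h1 := hy ρ (hρ ▸ normalCone_smul hv hc.le)
    rw [hρ, smul_dotProduct, smul_eq_mul] at h1
    exact nonneg_of_mul_nonneg_right h1 hc
  · push Not at hline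
    obtain ⟨w, hw, hwv⟩ := hline
    have hv' := mem_normalCone_latticePolytope.1 hv
    -- `e` is positive on `v`, so that a multiple of `v` can be subtracted from `w` to get `e w = 0`
    obtain ⟨e, he⟩ : ∃ e : Fin n → ℝ, e = ∑ a ∈ A, (toReal a - toReal p) := ⟨_, rfl⟩
    have hedot : ∀ x : Fin n → ℝ, x ⬝ᵥ e = ∑ a ∈ A, (x ⬝ᵥ toReal a - x ⬝ᵥ toReal p) := by
      intro x
      rw [he, dotProduct_sum]
      exact Finset.sum_congr rfl fun a _ => dotProduct_sub _ _ _
    have hve : 0 < v ⬝ᵥ e := by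
      rw [hedot]
      refine lt_of_le_of_ne (Finset.sum_nonneg fun a ha => sub_nonneg.2 (hv' a ha)) fun h => hv0 ?_
      refine eq_zero_of_forall_dotProduct_eq hA (c := v ⬝ᵥ toReal p) fun a ha => ?_
      have := (Finset.sum_eq_zero_iff_of_nonneg fun a ha => sub_nonneg.2 (hv' a ha)).1 h.symm a ha
      linarith
    obtain ⟨x, hx⟩ : ∃ x, x = w - ((w ⬝ᵥ e) / (v ⬝ᵥ e)) • v := ⟨_, rfl⟩
    have hx0 : x ≠ 0 := fun h => hwv ((w ⬝ᵥ e) / (v ⬝ᵥ e)) (sub_eq_zero.1 (hx ▸ h))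
    have hxe : x ⬝ᵥ e = 0 := by
      rw [hx, sub_dotProduct, smul_dotProduct, smul_eq_mul, div_mul_cancel₀ _ hve.ne', sub_self]
    have hxt : ∀ a ∈ A, v ⬝ᵥ toReal a = v ⬝ᵥ toReal p → x ⬝ᵥ toReal a = x ⬝ᵥ toReal p := by
      intro a ha h
      rw [hx, sub_dotProduct, sub_dotProduct, smul_dotProduct, smul_dotProduct, h, hw a ha h]
    have hneg : ∀ x : Fin n → ℝ, x ≠ 0 → x ⬝ᵥ e = 0 →
        ∃ a ∈ A, x ⬝ᵥ toReal a < x ⬝ᵥ toReal p := by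
      intro x hx0 hxe
      by_contra! hcon
      rw [hedot, Finset.sum_eq_zero_iff_of_nonneg fun a ha => sub_nonneg.2 (hcon a ha)] at hxe
      exact hx0 (eq_zero_of_forall_dotProduct_eq hA (c := x ⬝ᵥ toReal p) fun a ha => by
        have := hxe a ha
        linarith)
    obtain ⟨t, ht, htm, htN⟩ := exists_add_smul_mem_normalCone hv hxt (hneg x hx0 hxe)
    obtain ⟨s, hs, hsm, hsN⟩ := exists_add_smul_mem_normalCone (w := -x) hv
      (fun a ha h => by rw [neg_dotProduct, neg_dotProduct, hxt a ha h])
      (hneg (-x) (neg_ne_zero.2 hx0) (by rw [neg_dotProduct, hxe, neg_zero]))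
    have h1 := ih _ htN htm rfl
    have h2 := ih _ hsN hsm rfl
    simp only [add_dotProduct, smul_dotProduct, neg_dotProduct, smul_eq_mul] at h1 h2
    have h3 : 0 ≤ (s + t) * (v ⬝ᵥ y) := by
      have h4 := mul_nonneg hs.le h1
      have h5 := mul_nonneg ht.le h2
      linarith
    exact nonneg_of_mul_nonneg_right h3 (by linarith)

/-- The full-dimensional cones of the normal fan cover the space. -/
theorem exists_mem_normalCone_coneDim (hne : A.Nonempty) (v : Fin n → ℝ) :
    ∃ p ∈ A, v ∈ normalCone (latticePolytope A) (toReal p) ∧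
      coneDim (normalCone (latticePolytope A) (toReal p)) = n := by
  classical
  -- a linear form that separates the points of `A`
  obtain ⟨g, hg⟩ : ∃ g : Fin n → ℝ, ∀ a ∈ A, ∀ b ∈ A, a ≠ b → g ⬝ᵥ toReal a ≠ g ⬝ᵥ toReal b := by
    let ι := {ab : A × A // ab.1 ≠ ab.2}
    obtain ⟨φ, hφ⟩ := Module.exists_dual_forall_apply_ne_zero (K := ℝ)
      (fun ab : ι => toReal (ab.1.1 : Fin n → ℤ) - toReal (ab.1.2 : Fin n → ℤ)) (fun ab h =>
        ab.2 (Subtype.ext (toReal_injective (sub_eq_zero.1 h))))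
    refine ⟨fun i => φ (Pi.single i 1), fun a ha b hb hab h => hφ ⟨⟨⟨a, ha⟩, ⟨b, hb⟩⟩, fun h =>
      hab (congrArg Subtype.val h)⟩ ?_⟩
    have key : ∀ x : Fin n → ℝ, φ x = (fun i => φ (Pi.single i 1)) ⬝ᵥ x := by
      intro x
      conv_lhs => rw [← Finset.univ_sum_single x]
      rw [map_sum, dotProduct]
      refine Finset.sum_congr rfl fun i _ => ?_
      rw [show (Pi.single i (x i) : Fin n → ℝ) = x i • Pi.single i 1 by
        rw [← Pi.single_smul, smul_eq_mul, mul_one], map_smul, smul_eq_mul, mul_comm]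
    rw [map_sub, key, key, h, sub_self]
  obtain ⟨p₀, hp₀, hmin₀⟩ := Finset.exists_min_image A (fun a => v ⬝ᵥ toReal a) hne
  obtain ⟨p, hp, hmin⟩ := Finset.exists_min_image
    (A.filter fun a => v ⬝ᵥ toReal a = v ⬝ᵥ toReal p₀) (fun a => g ⬝ᵥ toReal a)
    ⟨p₀, Finset.mem_filter.2 ⟨hp₀, rfl⟩⟩
  obtain ⟨hpA, hpv⟩ := Finset.mem_filter.1 hp
  refine ⟨p, hpA, mem_normalCone_latticePolytope.2 fun a ha => hpv ▸ hmin₀ a ha, ?_⟩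
  -- near `v`, in the direction of `g`, the minimum is attained at `p` only
  have hev : ∀ᶠ t : ℝ in nhdsWithin 0 (Set.Ioi 0), ∀ a ∈ A, a ≠ p →
      (v + t • g) ⬝ᵥ toReal p < (v + t • g) ⬝ᵥ toReal a := by
    rw [Filter.eventually_all_finset]
    intro a ha
    by_cases hap : a = p
    · exact Filter.Eventually.of_forall fun t h => absurd hap h
    rcases (hmin₀ a ha).eq_or_lt with h | h
    · have h1 : g ⬝ᵥ toReal p < g ⬝ᵥ toReal a :=
        lt_of_le_of_ne (hmin a (Finset.mem_filter.2 ⟨ha, h.symm⟩))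
          (hg p hpA a ha fun h => hap h.symm)
      filter_upwards [self_mem_nhdsWithin] with t ht _
      rw [add_dotProduct, add_dotProduct, smul_dotProduct, smul_dotProduct, hpv, ← h]
      have := mul_lt_mul_of_pos_left h1 ht
      simpa using this
    · have hcont : ∀ b : Fin n → ℤ, Filter.Tendsto (fun t : ℝ => (v + t • g) ⬝ᵥ toReal b)
          (nhdsWithin 0 (Set.Ioi 0)) (nhds (v ⬝ᵥ toReal b)) := by
        intro b
        have h1 : Continuous fun t : ℝ => (v + t • g) ⬝ᵥ toReal b := by
          simp only [add_dotProduct, smul_dotProduct]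
          fun_prop
        have := h1.tendsto 0
        simp only [zero_smul, add_zero] at this
        exact this.mono_left nhdsWithin_le_nhds
      filter_upwards [(hcont p).eventually_lt (hcont a) (hpv ▸ h)] with t ht _
      exact ht
  obtain ⟨t, ht⟩ := hev.exists
  have hopen : IsOpen {w : Fin n → ℝ | ∀ a ∈ A, a ≠ p → w ⬝ᵥ toReal p < w ⬝ᵥ toReal a} := by
    have : {w : Fin n → ℝ | ∀ a ∈ A, a ≠ p → w ⬝ᵥ toReal p < w ⬝ᵥ toReal a} =
        ⋂ a ∈ A.erase p, {w : Fin n → ℝ | w ⬝ᵥ toReal p < w ⬝ᵥ toReal a} := by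
      ext w
      simp only [Set.mem_ofPred_eq, Set.mem_iInter, Finset.mem_erase]
      exact ⟨fun h a ha => h a ha.2 ha.1, fun h a h1 h2 => h a ⟨h2, h1⟩⟩
    rw [this]
    exact isOpen_biInter_finset fun a _ => isOpen_lt (by fun_prop) (by fun_prop)
  have hsub : {w : Fin n → ℝ | ∀ a ∈ A, a ≠ p → w ⬝ᵥ toReal p < w ⬝ᵥ toReal a} ⊆
      (Submodule.span ℝ (normalCone (latticePolytope A) (toReal p)) : Set (Fin n → ℝ)) := by
    refine fun w hw => Submodule.subset_span (mem_normalCone_latticePolytope.2 fun a ha => ?_)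
    by_cases hap : a = p
    · rw [hap]
    · exact (hw a ha hap).le
  have htop := Submodule.eq_top_of_nonempty_interior'
    (Submodule.span ℝ (normalCone (latticePolytope A) (toReal p)))
    ⟨v + t • g, interior_maximal hsub hopen ht⟩
  rw [coneDim, htop, finrank_top, Module.finrank_fin_fun]

end Fan

/-! ### Polytopes of torus-invariant divisors -/

section Divisors

variable {n : ℕ} {P : Set (Fin n → ℝ)} {A : Finset (Fin n → ℤ)}

/-- The characters of the torus embed into the torus-invariant divisors, because the rays of the
normal fan of a full-dimensional polytope span the space. -/
theorem charDiv_injective (hPA : P = latticePolytope A) (hP : affineSpan ℝ P = ⊤)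
    (hne : A.Nonempty) : Function.Injective (charDiv (normalFan P)) := by
  subst hPA
  rw [injective_iff_map_eq_zero]
  intro m hm
  have hm' : ∀ ρ : Ray (normalFan (latticePolytope A)), toReal ρ.gen ⬝ᵥ toReal m = 0 := fun ρ => by
    have h1 : ρ.gen ⬝ᵥ m = 0 := congrFun hm ρ
    have h2 : ((ρ.gen ⬝ᵥ m : ℤ) : ℝ) = 0 := by rw [h1, Int.cast_zero]
    simpa [dotProduct, toReal] using h2
  obtain ⟨p, hp, hv, -⟩ := exists_mem_normalCone_coneDim hne (-toReal m)
  have h := dotProduct_nonneg_of_forall_ray hP hp (y := toReal m) (fun ρ _ => (hm' ρ).ge) hv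
  have h0 : toReal m ⬝ᵥ toReal m = 0 := by
    refine le_antisymm ?_ (Finset.sum_nonneg fun i _ => mul_self_nonneg _)
    rw [neg_dotProduct] at h
    linarith
  have h1 : toReal m = toReal 0 := by
    rw [dotProduct_self_eq_zero.1 h0]
    funext i
    simp [toReal]
  exact toReal_injective h1

/-- The compact convex set `K` satisfies the inequalities `⟨u_ρ, x⟩ ≥ -a_ρ` of the rays of the
normal fan of `P = Conv A`, and for every full-dimensional cone, the cone of some `p ∈ A`, the inequalities
of its rays are equalities at a common point of `K`. If these points are lattice points, then the
divisor `∑ a_ρ D_ρ` is basepoint free with polytope `K`, as the characters of these points generate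
it at the fixed points of the charts. -/
structure IsDivisorPolytope (A : Finset (Fin n → ℤ)) (a : Ray (normalFan P) → ℤ)
    (K : Set (Fin n → ℝ)) : Prop where
  isCompact : IsCompact K
  convex : Convex ℝ K
  neg_le : ∀ x ∈ K, ∀ ρ : Ray (normalFan P), -(a ρ : ℝ) ≤ toReal ρ.gen ⬝ᵥ x
  exists_eq : ∀ p ∈ A, coneDim (normalCone P (toReal p)) = n →
    ∃ x ∈ K, ∀ ρ : Ray (normalFan P), toReal ρ.gen ∈ normalCone P (toReal p) →
      toReal ρ.gen ⬝ᵥ x = -(a ρ : ℝ)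

theorem IsDivisorPolytope.add {a b : Ray (normalFan P) → ℤ} {K L : Set (Fin n → ℝ)}
    (hK : IsDivisorPolytope A a K) (hL : IsDivisorPolytope A b L) :
    IsDivisorPolytope A (a + b) (K + L) where
  isCompact := hK.isCompact.add hL.isCompact
  convex := hK.convex.add hL.convex
  neg_le := by
    rintro _ ⟨x, hx, y, hy, rfl⟩ ρ
    have h1 := hK.neg_le x hx ρ
    have h2 := hL.neg_le y hy ρ
    simp only [dotProduct_add, Pi.add_apply, Int.cast_add]
    linarith
  exists_eq p hp hd := by
    obtain ⟨x, hx, hxρ⟩ := hK.exists_eq p hp hd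
    obtain ⟨y, hy, hyρ⟩ := hL.exists_eq p hp hd
    refine ⟨x + y, Set.add_mem_add hx hy, fun ρ hρ => ?_⟩
    simp only [dotProduct_add, Pi.add_apply, Int.cast_add, hxρ ρ hρ, hyρ ρ hρ]
    ring

theorem IsDivisorPolytope.sum {κ : Type*} (s : Finset κ) {a : κ → Ray (normalFan P) → ℤ}
    {K : κ → Set (Fin n → ℝ)} (h : ∀ j ∈ s, IsDivisorPolytope A (a j) (K j)) :
    IsDivisorPolytope A (∑ j ∈ s, a j) (∑ j ∈ s, K j) := by
  classical
  induction s using Finset.induction_on with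
  | empty =>
    refine ⟨?_, convex_singleton 0, ?_, fun p _ _ => ⟨0, ?_, ?_⟩⟩ <;> simp
  | insert j s hj ih =>
    rw [Finset.sum_insert hj, Finset.sum_insert hj]
    exact (h j (Finset.mem_insert_self j s)).add
      (ih fun i hi => h i (Finset.mem_insert_of_mem hi))

/-- The polytope of a basepoint free divisor is cut out by the inequalities of the rays: a linear
form that separates `x` from `K` lies in a full-dimensional cone, and is a nonnegative combination
of the rays of this cone. -/
theorem IsDivisorPolytope.mem_iff (hPA : P = latticePolytope A) (hP : affineSpan ℝ P = ⊤)
    (hne : A.Nonempty) {a : Ray (normalFan P) → ℤ} {K : Set (Fin n → ℝ)}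
    (hK : IsDivisorPolytope A a K) (x : Fin n → ℝ) :
    x ∈ K ↔ ∀ ρ : Ray (normalFan P), -(a ρ : ℝ) ≤ toReal ρ.gen ⬝ᵥ x := by
  subst hPA
  refine ⟨fun hx => hK.neg_le x hx, fun hx => ?_⟩
  by_contra hxK
  obtain ⟨φ, c, hφx, hφK⟩ :=
    geometric_hahn_banach_point_closed hK.convex hK.isCompact.isClosed hxK
  obtain ⟨v, hv⟩ : ∃ v : Fin n → ℝ, ∀ y, φ y = v ⬝ᵥ y := by
    refine ⟨(dotProductEquiv ℝ (Fin n)).symm φ.toLinearMap, fun y => ?_⟩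
    exact (LinearMap.congr_fun
      ((dotProductEquiv ℝ (Fin n)).apply_symm_apply φ.toLinearMap) y).symm
  obtain ⟨p, hp, hvp, hd⟩ := exists_mem_normalCone_coneDim hne v
  obtain ⟨k, hkK, hk⟩ := hK.exists_eq p hp hd
  have h := dotProduct_nonneg_of_forall_ray hP hp (y := x - k) (fun ρ hρ => by
    rw [dotProduct_sub, hk ρ hρ]
    linarith [hx ρ]) hvp
  have h1 := hφK k hkK
  rw [hv] at h1 hφx
  rw [dotProduct_sub] at h
  linarith

theorem divClass_eq_iff {Δ : Set (Set (Fin n → ℝ))} {a b : Ray Δ → ℤ} :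
    divClass a = divClass b ↔ ∃ m : Fin n → ℤ, ∀ ρ : Ray Δ, a ρ = ρ.gen ⬝ᵥ m + b ρ := by
  rw [eq_comm, divClass, divClass, QuotientAddGroup.eq]
  refine exists_congr fun m => ?_
  rw [funext_iff]
  refine forall_congr' fun ρ => ?_
  change ρ.gen ⬝ᵥ m = -b ρ + a ρ ↔ _
  omega

section Grading

variable {Δ : Set (Set (Fin n → ℝ))} [Fintype (Ray Δ)]

theorem weight_degVar (d : Ray Δ →₀ ℕ) :
    Finsupp.weight degVar d = divClass fun ρ => (d ρ : ℤ) := by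
  classical
  rw [Finsupp.weight_apply, Finsupp.sum_fintype _ _ (by simp)]
  have h : (fun ρ => (d ρ : ℤ)) = ∑ ρ, d ρ • (Pi.single ρ 1 : Ray Δ → ℤ) := by
    funext ρ
    simp [Finset.sum_apply, Pi.single_apply]
  rw [h]
  change _ = QuotientAddGroup.mk' _ _
  rw [map_sum]
  refine Finset.sum_congr rfl fun ρ _ => ?_
  rw [map_nsmul, degVar]
  congr!

/-- The monomial with exponents `⟨u_ρ, m⟩ + a_ρ` has degree `[∑ a_ρ D_ρ]`. -/
theorem weight_degVar_toNat {a : Ray Δ → ℤ} {m : Fin n → ℤ}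
    (hm : ∀ ρ : Ray Δ, 0 ≤ ρ.gen ⬝ᵥ m + a ρ) :
    Finsupp.weight degVar
      (Finsupp.equivFunOnFinite.symm fun ρ : Ray Δ => (ρ.gen ⬝ᵥ m + a ρ).toNat) = divClass a := by
  rw [weight_degVar, divClass_eq_iff]
  exact ⟨m, fun ρ => Int.toNat_of_nonneg (hm ρ)⟩

end Grading

theorem cast_dotProduct (u m : Fin n → ℤ) : ((u ⬝ᵥ m : ℤ) : ℝ) = toReal u ⬝ᵥ toReal m := by
  simp [dotProduct, toReal]

/-- The monomials of the graded piece of a basepoint free divisor are the lattice points of its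
polytope. -/
theorem IsDivisorPolytope.finrank_gradedPiece [Fintype (Ray (normalFan P))]
    (hPA : P = latticePolytope A) (hP : affineSpan ℝ P = ⊤) (hne : A.Nonempty)
    {a : Ray (normalFan P) → ℤ} {K : Set (Fin n → ℝ)} (hK : IsDivisorPolytope A a K) :
    FiniteDimensional ℂ (gradedPiece (divClass a)) ∧
      Module.finrank ℂ (gradedPiece (divClass a)) = latticeCount K := by
  have hmem : ∀ m : Fin n → ℤ, toReal m ∈ K ↔
      ∀ ρ : Ray (normalFan P), 0 ≤ ρ.gen ⬝ᵥ m + a ρ := by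
    intro m
    rw [hK.mem_iff hPA hP hne]
    refine forall_congr' fun ρ => ?_
    rw [← cast_dotProduct, neg_le_iff_add_nonneg]
    exact_mod_cast Iff.rfl
  let S : Set (Ray (normalFan P) →₀ ℕ) := {d | Finsupp.weight degVar d = divClass a}
  let F : {m : Fin n → ℤ // toReal m ∈ K} → S := fun m =>
    ⟨Finsupp.equivFunOnFinite.symm fun ρ => (ρ.gen ⬝ᵥ m.1 + a ρ).toNat,
      weight_degVar_toNat ((hmem m.1).1 m.2)⟩
  have hF : Function.Bijective F := by
    constructor
    · intro m m' h
      refine Subtype.ext (charDiv_injective hPA hP hne (funext fun ρ => ?_))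
      have h1 : (ρ.gen ⬝ᵥ m.1 + a ρ).toNat = (ρ.gen ⬝ᵥ m'.1 + a ρ).toNat :=
        DFunLike.congr_fun (congrArg Subtype.val h) ρ
      have h2 := (hmem m.1).1 m.2 ρ
      have h3 := (hmem m'.1).1 m'.2 ρ
      change ρ.gen ⬝ᵥ m.1 = ρ.gen ⬝ᵥ m'.1
      omega
    · rintro ⟨d, hd⟩
      have hd' : Finsupp.weight degVar d = divClass a := hd
      rw [weight_degVar, divClass_eq_iff] at hd'
      obtain ⟨m, hm⟩ := hd'
      refine ⟨⟨m, (hmem m).2 fun ρ => (hm ρ) ▸ Int.natCast_nonneg _⟩, Subtype.ext ?_⟩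
      ext ρ
      change (ρ.gen ⬝ᵥ m + a ρ).toNat = d ρ
      rw [← hm ρ, Int.toNat_natCast]
  have := finite_toReal_mem hK.isCompact.isBounded
  have hSfin : Finite S := Finite.of_surjective F hF.surjective
  have : Fintype S := Fintype.ofFinite S
  have hS : gradedPiece (divClass a) = AddMonoidAlgebra.supported ℂ ℂ S :=
    MvPolynomial.weightedHomogeneousSubmodule_eq_finsupp_supported ℂ _ _
  let e : gradedPiece (divClass a) ≃ₗ[ℂ] (S →₀ ℂ) :=
    (LinearEquiv.ofEq _ _ hS).trans (AddMonoidAlgebra.supportedEquivFinsupp S)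
  refine ⟨Module.Finite.equiv e.symm, ?_⟩
  rw [e.finrank_eq, Module.finrank_finsupp_self, latticeCount, Nat.card_eq_of_bijective F hF,
    Nat.card_eq_fintype_card]

/-- A basepoint free class is the class of a divisor with a lattice polytope. -/
theorem exists_isDivisorPolytope_of_basepointFree [Fintype (Ray (normalFan P))]
    (hPA : P = latticePolytope A) (hne : A.Nonempty) {a : Ray (normalFan P) → ℤ}
    (h : BasepointFree (divClass a)) :
    ∃ A₀ : Finset (Fin n → ℤ), A₀.Nonempty ∧ IsDivisorPolytope A a (latticePolytope A₀) := by
  classical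
  -- at the fixed point of a full-dimensional cone only one monomial does not vanish
  have key : ∀ p ∈ A, coneDim (normalCone P (toReal p)) = n → ∃ m : Fin n → ℤ,
      (∀ ρ : Ray (normalFan P), -a ρ ≤ ρ.gen ⬝ᵥ m) ∧
      ∀ ρ : Ray (normalFan P), toReal ρ.gen ∈ normalCone P (toReal p) → ρ.gen ⬝ᵥ m = -a ρ := by
    intro p hp hd
    let x : Ray (normalFan P) → ℂ := fun ρ =>
      if toReal ρ.gen ∈ normalCone P (toReal p) then 0 else 1
    have hx : x ∉ exceptionalSet (normalFan P) := by
      intro hx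
      rw [mem_exceptionalSet_iff] at hx
      have hpP : toReal p ∈ P := hPA ▸ subset_convexHull ℝ _ ⟨p, hp, rfl⟩
      obtain ⟨ρ, h1, h2⟩ := hx _ ⟨toReal p, hpP, rfl⟩ hd
      simp [x, h1] at h2
    obtain ⟨g, hg, hgx⟩ := h ⟨x, hx⟩
    rw [MvPolynomial.eval_eq] at hgx
    obtain ⟨d, hd, hdx⟩ := Finset.exists_ne_zero_of_sum_ne_zero hgx
    have hw := hg (MvPolynomial.mem_support_iff.1 hd)
    rw [weight_degVar, divClass_eq_iff] at hw
    obtain ⟨m, hm⟩ := hw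
    refine ⟨m, fun ρ => ?_, fun ρ hρ => ?_⟩
    · have h1 := hm ρ
      have h2 := Int.natCast_nonneg (d ρ)
      omega
    · have h0 : d ρ = 0 := by
        by_contra hne
        have h1 := Finset.prod_ne_zero_iff.1 (right_ne_zero_of_mul hdx) ρ
          (Finsupp.mem_support_iff.2 hne)
        simp [x, hρ, hne] at h1
      have h1 := hm ρ
      rw [h0, Nat.cast_zero] at h1
      omega
  choose! m hm1 hm2 using key
  refine ⟨(A.filter fun p => coneDim (normalCone P (toReal p)) = n).image m, ?_, ?_, ?_, ?_, ?_⟩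
  · obtain ⟨p, hp, -, hd⟩ := exists_mem_normalCone_coneDim hne 0
    exact ⟨m p, Finset.mem_image_of_mem _ (Finset.mem_filter.2 ⟨hp, hPA ▸ hd⟩)⟩
  · exact isCompact_latticePolytope _
  · exact convex_latticePolytope _
  · intro y hy ρ
    have hconv : Convex ℝ {y : Fin n → ℝ | -(a ρ : ℝ) ≤ toReal ρ.gen ⬝ᵥ y} :=
      convex_halfSpace_ge (f := fun y => toReal ρ.gen ⬝ᵥ y)
        ⟨fun b c => dotProduct_add _ b c, fun c b => dotProduct_smul c _ b⟩ _
    refine convexHull_min ?_ hconv hy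
    rintro _ ⟨_, hb, rfl⟩
    obtain ⟨p, hp, rfl⟩ := Finset.mem_image.1 (Finset.mem_coe.1 hb)
    obtain ⟨hpA, hd⟩ := Finset.mem_filter.1 hp
    have := hm1 p hpA hd ρ
    change -(a ρ : ℝ) ≤ toReal ρ.gen ⬝ᵥ toReal (m p)
    rw [← cast_dotProduct]
    exact_mod_cast this
  · intro p hp hd
    refine ⟨toReal (m p), subset_convexHull ℝ _ ⟨m p, ?_, rfl⟩, fun ρ hρ => ?_⟩
    · exact Finset.mem_coe.2 (Finset.mem_image_of_mem _ (Finset.mem_filter.2 ⟨hp, hd⟩))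
    · rw [← cast_dotProduct, hm2 p hp hd ρ hρ, Int.cast_neg]

end Divisors

/-! ### The homogenized system -/

section System

variable {n : ℕ}

theorem mem_finset_sum_iff {S : Fin n → Finset (Fin n → ℤ)} {x : Fin n → ℤ} :
    x ∈ ∑ j, S j ↔ ∃ q : Fin n → Fin n → ℤ, (∀ j, q j ∈ S j) ∧ ∑ j, q j = x := by
  rw [← Finset.mem_coe, Finset.coe_sum, Set.mem_finsetSum]
  simp

theorem newtonSum_eq_latticePolytope (f : Fin n → Laurent n) :
    newtonSum f = latticePolytope (∑ j, (f j).coeff.support) := by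
  let T : (Fin n → ℤ) →+ (Fin n → ℝ) :=
    { toFun := toReal, map_zero' := by funext i; simp [toReal], map_add' := toReal_add }
  have h : toReal '' ((∑ j, (f j).coeff.support : Finset (Fin n → ℤ)) : Set (Fin n → ℤ)) =
      ∑ j, toReal '' ((f j).coeff.support : Set (Fin n → ℤ)) := by
    rw [Finset.coe_sum]
    exact Set.image_finsetSum T _ _
  rw [latticePolytope, h, convexHull_sum]
  rfl

variable {f : Fin n → Laurent n}

theorem support_nonempty (hP : affineSpan ℝ (newtonSum f) = ⊤) (j : Fin n) :
    (f j).coeff.support.Nonempty := by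
  have h1 : (newtonSum f).Nonempty := by
    rw [← affineSpan_nonempty ℝ, hP]
    exact ⟨0, trivial⟩
  obtain ⟨x, hx⟩ := h1
  obtain ⟨g, hg, -⟩ := (Set.mem_finsetSum _ _ _).1 hx
  have h2 : (newtonPolytope (f j)).Nonempty := ⟨g j, hg (Finset.mem_univ j)⟩
  rw [newtonPolytope, convexHull_nonempty_iff] at h2
  simpa using h2

theorem sum_support_nonempty (hP : affineSpan ℝ (newtonSum f) = ⊤) :
    (∑ j, (f j).coeff.support).Nonempty :=
  ⟨_, mem_finset_sum_iff.2 ⟨_, fun j => (support_nonempty hP j).choose_spec, rfl⟩⟩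

theorem dotProduct_add_sysDiv_nonneg {j : Fin n} {m : Fin n → ℤ} (hm : m ∈ (f j).coeff.support)
    (ρ : Ray (sysFan f)) : 0 ≤ ρ.gen ⬝ᵥ m + sysDiv f j ρ := by
  have hbdd : BddBelow ((fun m => ρ.gen ⬝ᵥ m) '' ((f j).coeff.support : Set (Fin n → ℤ))) :=
    (((f j).coeff.support.finite_toSet).image _).bddBelow
  have h := csInf_le hbdd ⟨m, hm, rfl⟩
  rw [sysDiv]
  exact sub_nonneg.2 h

theorem homogenization_mem_gradedPiece (j : Fin n) :
    homogenization f j ∈ gradedPiece (sysDeg f j) :=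
  Submodule.sum_mem _ fun _ hm => MvPolynomial.isWeightedHomogeneous_monomial _ _ _
    (weight_degVar_toNat fun ρ => dotProduct_add_sysDiv_nonneg hm ρ)

theorem isDivisorPolytope_newtonPolytope (hne : ∀ j, (f j).coeff.support.Nonempty) (j : Fin n) :
    IsDivisorPolytope (P := newtonSum f) (∑ j, (f j).coeff.support) (sysDiv f j)
      (newtonPolytope (f j)) where
  isCompact := isCompact_latticePolytope _
  convex := convex_latticePolytope _
  neg_le := by
    intro x hx ρ
    have hconv : Convex ℝ {y : Fin n → ℝ | -(sysDiv f j ρ : ℝ) ≤ toReal ρ.gen ⬝ᵥ y} :=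
      convex_halfSpace_ge (f := fun y => toReal ρ.gen ⬝ᵥ y)
        ⟨fun b c => dotProduct_add _ b c, fun c b => dotProduct_smul c _ b⟩ _
    refine convexHull_min ?_ hconv hx
    rintro _ ⟨m, hm, rfl⟩
    have := dotProduct_add_sysDiv_nonneg hm ρ
    change -(sysDiv f j ρ : ℝ) ≤ toReal ρ.gen ⬝ᵥ toReal m
    rw [← cast_dotProduct, neg_le_iff_add_nonneg]
    exact_mod_cast this
  exists_eq := by
    classical
    intro p hp _
    obtain ⟨q, hq, rfl⟩ := mem_finset_sum_iff.1 hp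
    refine ⟨toReal (q j), subset_convexHull ℝ _ ⟨q j, hq j, rfl⟩,
      fun ρ hρ => ?_⟩
    -- a linear form that is minimal over `P` at `∑ qⱼ` is minimal over `Pⱼ` at `qⱼ`
    have hmin : ∀ m ∈ (f j).coeff.support, ρ.gen ⬝ᵥ q j ≤ ρ.gen ⬝ᵥ m := by
      intro m hm
      have h1 : ∑ i, Function.update q j m i ∈ ∑ j, (f j).coeff.support :=
        mem_finset_sum_iff.2 ⟨_, fun i => by
          by_cases hij : i = j
          · subst hij; simpa using hm
          · simpa [hij] using hq i, rfl⟩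
      have h2 := hρ (toReal (∑ i, Function.update q j m i)) (by
        rw [newtonSum_eq_latticePolytope]
        exact subset_convexHull ℝ _ ⟨_, h1, rfl⟩)
      rw [← cast_dotProduct, ← cast_dotProduct, Int.cast_le,
        ← Finset.add_sum_erase _ q (Finset.mem_univ j),
        ← Finset.add_sum_erase _ (Function.update q j m) (Finset.mem_univ j),
        Function.update_self, dotProduct_add, dotProduct_add,
        Finset.sum_congr rfl fun i hi => Function.update_of_ne (Finset.ne_of_mem_erase hi) m q] at h2
      exact le_of_add_le_add_right h2
    rw [← cast_dotProduct, ← Int.cast_neg, Int.cast_inj, sysDiv, neg_neg]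
    refine le_antisymm (le_csInf ((hne j).to_set.image _) ?_)
      (csInf_le (((f j).coeff.support.finite_toSet.image _).bddBelow)
        ⟨q j, hq j, rfl⟩)
    rintro _ ⟨m, hm, rfl⟩
    exact hmin m hm

/-- The Koszul complex of the homogenized system is exact in positive degrees. -/
theorem exists_koszulD_homogenization_eq (hP : affineSpan ℝ (newtonSum f) = ⊤)
    (hfin : (zeroSet (sysIdeal f)).Finite)
    (hU : zeroSet (sysIdeal f) ⊆ simplicialPart (sysFan f))
    (hZ : (n : ℕ∞) ≤ codimExceptionalSet (sysFan f)) (i : ℕ) (hi : 1 ≤ i)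
    (z : Finset (Fin n) → CoxRing (sysFan f)) (hz : SupportedIn i z)
    (hd : koszulD (CoxRing (sysFan f)) (homogenization f) z = 0) :
    ∃ y, SupportedIn (i + 1) y ∧ koszulD (CoxRing (sysFan f)) (homogenization f) y = z := by
  have hne := sum_support_nonempty hP
  obtain ⟨rs, hrs, hreg, hlen⟩ := exists_isWeaklyRegular_of_trdeg_le (sysIdeal f) n
    (card_add_le_of_algebraicIndependent
      (charDiv_injective (newtonSum_eq_latticePolytope f) hP hne) hfin hU hZ)
  exact exists_koszulD_eq (homogenization f) rs hrs hreg i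
    (by rw [Fintype.card_fin]; omega) z hz hd

/-- The Hilbert function of the system at a sum of basepoint free degrees is an alternating sum of
numbers of lattice points. -/
theorem hilbertFunction_sysIdeal (hP : affineSpan ℝ (newtonSum f) = ⊤)
    (hfin : (zeroSet (sysIdeal f)).Finite)
    (hU : zeroSet (sysIdeal f) ⊆ simplicialPart (sysFan f))
    (hZ : (n : ℕ∞) ≤ codimExceptionalSet (sysFan f)) {a₀ : Ray (sysFan f) → ℤ}
    {K : Set (Fin n → ℝ)} (hK : IsDivisorPolytope (∑ j, (f j).coeff.support) a₀ K) :
    FiniteDimensional ℂ (gradedPiece (divClass a₀ + ∑ j, sysDeg f j)) ∧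
    (hilbertFunction (sysIdeal f) (divClass a₀ + ∑ j, sysDeg f j) : ℤ) =
      ∑ J : Finset (Fin n),
        (-1) ^ J.card * (latticeCount (K + ∑ j ∈ Jᶜ, newtonPolytope (f j)) : ℤ) := by
  classical
  have hsupp := support_nonempty hP
  have hne := sum_support_nonempty hP
  have hpiece : ∀ J : Finset (Fin n),
      FiniteDimensional ℂ
        (gradedPiece (divClass a₀ + ∑ j, sysDeg f j - ∑ j ∈ J, sysDeg f j)) ∧
      Module.finrank ℂ
        (gradedPiece (divClass a₀ + ∑ j, sysDeg f j - ∑ j ∈ J, sysDeg f j)) =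
        latticeCount (K + ∑ j ∈ Jᶜ, newtonPolytope (f j)) := by
    intro J
    have h1 : divClass a₀ + ∑ j, sysDeg f j - ∑ j ∈ J, sysDeg f j =
        divClass (a₀ + ∑ j ∈ Jᶜ, sysDiv f j) := by
      rw [← Finset.sum_add_sum_compl J, add_sub_assoc, add_sub_cancel_left]
      exact (map_sum (QuotientAddGroup.mk' (charDiv (sysFan f)).range) _ _ ▸
        (map_add (QuotientAddGroup.mk' (charDiv (sysFan f)).range) a₀ _).symm)
    rw [h1]
    exact (hK.add (IsDivisorPolytope.sum Jᶜ fun j _ =>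
      isDivisorPolytope_newtonPolytope hsupp j)).finrank_gradedPiece
        (newtonSum_eq_latticePolytope f) hP hne
  have hgr : GradedAlgebra (gradedPiece (Δ := sysFan f)) :=
    MvPolynomial.weightedGradedAlgebra ℂ degVar
  refine ⟨by have := (hpiece ∅).1; rwa [Finset.sum_empty, sub_zero] at this, ?_⟩
  have h := finrank_quotient_eq_sum (𝒜 := gradedPiece (Δ := sysFan f)) (deg := sysDeg f)
    (f := homogenization f) (α := divClass a₀ + ∑ j, sysDeg f j) homogenization_mem_gradedPiece
    (exists_koszulD_homogenization_eq hP hfin hU hZ) fun J => (hpiece J).1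
  exact h.trans (Finset.sum_congr rfl fun J _ => by rw [(hpiece J).2])

end System

end CoxToric

theorem theorem4p9 {n : ℕ} (f : Fin n → CoxToric.Laurent n)
    (hP : affineSpan ℝ (CoxToric.newtonSum f) = ⊤)
    (hfin : (CoxToric.zeroSet (CoxToric.sysIdeal f)).Finite)
    (hU : CoxToric.zeroSet (CoxToric.sysIdeal f) ⊆ CoxToric.simplicialPart (CoxToric.sysFan f))
    (hZ : (n : ℕ∞) ≤ CoxToric.codimExceptionalSet (CoxToric.sysFan f))
    (α₀ : CoxToric.Cl (CoxToric.sysFan f)) (hα₀ : α₀ ∈ CoxToric.PicPlus (CoxToric.sysFan f))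
    (hbpf : CoxToric.BasepointFree α₀) :
    Module.Finite ℂ
        (CoxToric.GradedQuotient (CoxToric.sysIdeal f) (α₀ + ∑ j, CoxToric.sysDeg f j)) ∧
      CoxToric.IsMixedVolume (fun j => CoxToric.newtonPolytope (f j))
        (CoxToric.hilbertFunction (CoxToric.sysIdeal f) (α₀ + ∑ j, CoxToric.sysDeg f j) : ℝ) := by
  obtain ⟨a₀, rfl⟩ : ∃ a₀, CoxToric.divClass a₀ = α₀ := QuotientAddGroup.mk_surjective α₀
  have hsupp := CoxToric.support_nonempty hP
  have hne := CoxToric.sum_support_nonempty hP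
  obtain ⟨A₀, hA₀, hK⟩ := CoxToric.exists_isDivisorPolytope_of_basepointFree
    (CoxToric.newtonSum_eq_latticePolytope f) hne hbpf
  obtain ⟨hfd, hHF⟩ := CoxToric.hilbertFunction_sysIdeal hP hfin hU hZ hK
  refine ⟨Module.Finite.of_surjective (Submodule.mkQ _) (Submodule.mkQ_surjective _), ?_⟩
  have hHF' : (CoxToric.hilbertFunction (CoxToric.sysIdeal f)
      (CoxToric.divClass a₀ + ∑ j, CoxToric.sysDeg f j) : ℝ) =
      ∑ J : Finset (Fin n), (-1 : ℝ) ^ J.card * CoxToric.latticeCount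
        (CoxToric.latticePolytope A₀ +
          ∑ j ∈ Jᶜ, CoxToric.latticePolytope (f j).coeff.support) := by
    exact_mod_cast congrArg (Int.cast : ℤ → ℝ) hHF
  exact hHF' ▸ CoxToric.isMixedVolume_sum_latticeCount A₀ (fun j => (f j).coeff.support) hA₀ hsupp
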